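/- Let $\mathcal V$ be a complete and cocomplete symmetric monoidal closed category, with unit $I$ and internal hom $[-,-]$, equipped with a model structure which satisfies the pushout-product axiom (a monoidal model category) and for which $I$ is cofibrant, and suppose that the ordinary category $\mathcal V_0$ is locally presentable. For a small $\mathcal V$-category $\mathcal D$, write $[\mathcal D,\mathcal V]$ for the $\mathcal V$-category of $\mathcal V$-functors $\mathcal D\to\mathcal V$, and $\mathcal I$ for the unit $\mathcal V$-category (one object, with hom-object $I$). Definitions. * An *interval* is an object $J$ of $\mathcal V$ with maps $d,c\colon I\to J$ and $e\colon J\to I$ such that $ed=ec=1_I$, the map $(d\ c)\colon I+I\to J$ is a cofibration and $e$ is a weak equivalence. A morphism $f\colon A\to B$ of $\mathcal V$ is *shrinkable* if there are $s\colon B\to A$ with $fs=1_B$, an interval $(J,d,c,e)$, and $h\colon J\to[A,A]$ such that $hd$ and $hc$ are the maps $I\to[A,A]$ corresponding to $sf$ and $1_A$, and $[A,f]\circ h$ is the composite of $e$ with the map $I\to[A,B]$ corresponding to $f$. Write $\mathcal E$ for the class of shrinkable morphisms of $\mathcal V$, regarded as a full sub-$\mathcal V$-category of the $\mathcal V$-category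 $\mathcal V^{\mathbf 2}$ of arrows of $\mathcal V$. * For a weight $W\colon\mathcal D\to\mathcal V$ with $\mathcal D$ small, $W$-weighted limits are *$\mathcal E$-stable* if $\mathcal E$ is closed in $\mathcal V^{\mathbf 2}$ under $W$-weighted limits. A $\mathcal V$-category has *$\mathcal E$-stable limits* if it has $W$-weighted limits for every such $W$ for which $W$-weighted limits are $\mathcal E$-stable. * A weight $Q\colon\mathcal D\to\mathcal V$ is *cofibrant* if, for each $\mathcal V$-natural transformation $p\colon F\to G$ in $[\mathcal D,\mathcal V]$ which is pointwise a trivial fibration, $[\mathcal D,\mathcal V](Q,p)$ is a trivial fibration in $\mathcal V$. A $\mathcal V$-category $\mathcal B$ has *enough cofibrantly-weighted limits* if for each small $\mathcal V$-category $\mathcal D$ and each $\mathcal V$-functor $P\colon\mathcal D\to\mathcal I$ there are a cofibrant weight $Q\colon\mathcal D\to\mathcal V$ and a pointwise trivial fibration from $Q$ to the composite $\mathcal D\xrightarrow{P}\mathcal I\xrightarrow{I}\mathcal V$, where $I$ selects the unit object, such that $\mathcal B$ has $Q$-weighted limits. Shrinkable morphisms are *closed in $\mathcal V^{\mathbf 2}$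 under enough cofibrantly-weighted limits* if for each such $\mathcal D$ and $P$ there are such a $Q$ and such a pointwise trivial fibration for which $Q$-weighted limits are $\mathcal E$-stable. * A $\mathcal V$-category $\mathcal C$ has *$\mathcal E$-weak colimits* if for each small $\mathcal V$-category $\mathcal D$, each weight $W\colon\mathcal D^{\mathrm{op}}\to\mathcal V$ and each $\mathcal V$-functor $S\colon\mathcal D\to\mathcal C$ there are an object $c$ of $\mathcal C$ and a $\mathcal V$-natural transformation $\eta\colon W\to\mathcal C(S-,c)$ such that for all $a\in\mathcal C$ the induced map $\mathcal C(c,a)\to[\mathcal D^{\mathrm{op}},\mathcal V](W,\mathcal C(S-,a))$ is shrinkable. * A *conical colimit* in $\mathcal C$ is a colimit in the underlying ordinary category $\mathcal C_0$ which each $\mathcal C(-,c)$ sends to a limit in $\mathcal V_0$. For a regular cardinal $\lambda$, an object $A$ of $\mathcal C$ is *$\lambda$-presentable* if $\mathcal C(A,-)\colon\mathcal C\to\mathcal V$ preserves conical $\lambda$-filtered colimits, and $\mathcal C$ is *$\lambda$-accessible* if it has conical $\lambda$-filtered colimits and a (small) set of $\lambda$-presentable objects such that every object is a conical $\lambda$-filtered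 colimit of objects in this set. $\mathcal C$ is *accessible* if it is $\lambda$-accessible for some regular cardinal $\lambda\ge\lambda_0$, where $\lambda_0$ is a regular cardinal such that $\mathcal V_0$ is locally $\lambda_0$-presentable, $I$ is $\lambda_0$-presentable in $\mathcal V_0$, and $\lambda_0$-presentable objects of $\mathcal V_0$ are closed under $\otimes$. Theorem. Suppose that the shrinkable morphisms in $\mathcal V$ are closed in $\mathcal V^{\mathbf 2}$ under enough cofibrantly-weighted limits, and let $\mathcal C$ be an accessible $\mathcal V$-category. Then the following are equivalent: 1. $\mathcal C$ has $\mathcal E$-stable limits; 2. $\mathcal C$ has powers by all objects of $\mathcal V$ and enough cofibrantly-weighted limits; 3. $\mathcal C$ has $\mathcal E$-weak colimits. -/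

import Mathlib

noncomputable section

namespace HEnriched

open CategoryTheory Category Limits MonoidalCategory HomotopicalAlgebra Opposite
open scoped CategoryTheory.MonoidalClosed

universe v u u₁ u₂ u₃


/-! ### Composition of hom-objects -/

lemma eHomWhiskerLeft_eComp {V : Type u} [Category.{v} V] [MonoidalCategory V]
    {B : Type u₂} [Category.{v} B] [EnrichedOrdinaryCategory V B]
    (X : B) {Y Y' : B} (g : Y ⟶ Y') (Z : B) :
    eHomWhiskerLeft V X g ▷ _ ≫ eComp V X Y' Z =
      _ ◁ eHomWhiskerRight V g Z ≫ eComp V X Y Z := by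
  simp only [eHomWhiskerLeft, eHomWhiskerRight, MonoidalCategory.whiskerLeft_comp_assoc,
    comp_whiskerRight_assoc]
  rw [← e_assoc, ← e_assoc']
  simp

/-! ### Monoidal model categories -/

/-- The pushout-product axiom for a model structure on a monoidal category. -/
class PushoutProductAxiom (V : Type u) [Category.{v} V] [MonoidalCategory V]
    [ModelCategory V] : Prop where
  cofibration {A B X Y : V} (i : A ⟶ B) (j : X ⟶ Y) (hi : Cofibration i) (hj : Cofibration j) :
    Cofibration
      ((MonoidalCategory.Arrow.pushoutProduct.obj (Arrow.mk i)).obj (Arrow.mk j)).hom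
  weakEquivalence {A B X Y : V} (i : A ⟶ B) (j : X ⟶ Y)
    (hi : Cofibration i) (hj : Cofibration j) (hw : WeakEquivalence i ∨ WeakEquivalence j) :
    WeakEquivalence
      ((MonoidalCategory.Arrow.pushoutProduct.obj (Arrow.mk i)).obj (Arrow.mk j)).hom

/-! ### The object of `V`-natural transformations -/

section NatObj

variable {V : Type u} [Category.{v} V] [MonoidalCategory V] [SymmetricCategory V]
  [MonoidalClosed V] [HasLimits V]
variable {D : Type v} [EnrichedCategory V D] {B : Type u₁} [EnrichedCategory V B]

/-- `(F x ⟶ F y) ⊗ (F y ⟶ G y) ⟶ (F x ⟶ G y)`, as a map out of the product of all `B(Fx, Gx)`. -/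
def natObjFst (F G : EnrichedFunctor V D B) :
    (∏ᶜ fun x : D => (EnrichedCategory.Hom (F.obj x) (G.obj x) : V)) ⟶
      ∏ᶜ fun p : D × D => (ihom (EnrichedCategory.Hom p.1 p.2 : V)).obj
        (EnrichedCategory.Hom (F.obj p.1) (G.obj p.2) : V) :=
  Pi.lift fun p => MonoidalClosed.curry
    ((F.map p.1 p.2 ⊗ₘ Pi.π (fun x : D => (EnrichedCategory.Hom (F.obj x) (G.obj x) : V)) p.2) ≫
      eComp V (F.obj p.1) (F.obj p.2) (G.obj p.2))

/-- `(F x ⟶ G x) ⊗ (G x ⟶ G y) ⟶ (F x ⟶ G y)`, as a map out of the product of all `B(Fx, Gx)`. -/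
def natObjSnd (F G : EnrichedFunctor V D B) :
    (∏ᶜ fun x : D => (EnrichedCategory.Hom (F.obj x) (G.obj x) : V)) ⟶
      ∏ᶜ fun p : D × D => (ihom (EnrichedCategory.Hom p.1 p.2 : V)).obj
        (EnrichedCategory.Hom (F.obj p.1) (G.obj p.2) : V) :=
  Pi.lift fun p => MonoidalClosed.curry
    ((β_ _ _).hom ≫
      (Pi.π (fun x : D => (EnrichedCategory.Hom (F.obj x) (G.obj x) : V)) p.1 ⊗ₘ
        G.map p.1 p.2) ≫
      eComp V (F.obj p.1) (G.obj p.1) (G.obj p.2))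

/-- The hom-object `[D, B](F, G)`, i.e. the end of `B(F-, G-)` computed in `V`. -/
def natObj (F G : EnrichedFunctor V D B) : V :=
  equalizer (natObjFst F G) (natObjSnd F G)

/-- The component `[D, B](F, G) ⟶ B(Fx, Gx)`. -/
def natObjπ (F G : EnrichedFunctor V D B) (x : D) :
    natObj F G ⟶ (EnrichedCategory.Hom (F.obj x) (G.obj x) : V) :=
  equalizer.ι _ _ ≫ Pi.π (fun x : D => (EnrichedCategory.Hom (F.obj x) (G.obj x) : V)) x

lemma natObjπ_condition (F G : EnrichedFunctor V D B) (x y : D) :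
    (F.map x y ⊗ₘ natObjπ F G y) ≫ eComp V (F.obj x) (F.obj y) (G.obj y) =
      (β_ _ _).hom ≫ (natObjπ F G x ⊗ₘ G.map x y) ≫
        eComp V (F.obj x) (G.obj x) (G.obj y) := by
  have h := equalizer.condition (natObjFst F G) (natObjSnd F G) =≫ Pi.π _ (x, y)
  rw [Category.assoc, Category.assoc, natObjFst, natObjSnd, Pi.lift_π, Pi.lift_π,
    ← MonoidalClosed.curry_natural_left, ← MonoidalClosed.curry_natural_left] at h
  replace h := MonoidalClosed.curry_injective h
  rw [BraidedCategory.braiding_naturality_right_assoc, whiskerLeft_comp_tensorHom_assoc,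
    whiskerRight_comp_tensorHom_assoc] at h
  exact h

/-- The universal property of `[D, B](F, G)`. -/
def natObjLift (F G : EnrichedFunctor V D B) {T : V}
    (φ : ∀ x, T ⟶ (EnrichedCategory.Hom (F.obj x) (G.obj x) : V))
    (hφ : ∀ x y, (F.map x y ⊗ₘ φ y) ≫ eComp V (F.obj x) (F.obj y) (G.obj y) =
      (β_ _ _).hom ≫ (φ x ⊗ₘ G.map x y) ≫ eComp V (F.obj x) (G.obj x) (G.obj y)) :
    T ⟶ natObj F G :=
  equalizer.lift (Pi.lift φ) (by
    refine Pi.hom_ext _ _ fun p => ?_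
    rw [Category.assoc, Category.assoc, natObjFst, natObjSnd, Pi.lift_π, Pi.lift_π,
      ← MonoidalClosed.curry_natural_left, ← MonoidalClosed.curry_natural_left,
      BraidedCategory.braiding_naturality_right_assoc, whiskerLeft_comp_tensorHom_assoc,
      whiskerRight_comp_tensorHom_assoc, Pi.lift_π, Pi.lift_π, hφ])

@[simp]
lemma natObjLift_π (F G : EnrichedFunctor V D B) {T : V}
    (φ : ∀ x, T ⟶ (EnrichedCategory.Hom (F.obj x) (G.obj x) : V)) (hφ) (x : D) :
    natObjLift F G φ hφ ≫ natObjπ F G x = φ x := by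
  unfold natObjLift natObjπ
  exact (equalizer.lift_ι_assoc _ _ _).trans (Pi.lift_π _ _)

lemma natObj_hom_ext (F G : EnrichedFunctor V D B) {T : V} {f g : T ⟶ natObj F G}
    (h : ∀ x, f ≫ natObjπ F G x = g ≫ natObjπ F G x) : f = g := by
  refine equalizer.hom_ext (Pi.hom_ext _ _ fun x => ?_)
  exact ((Category.assoc _ _ _).trans (h x)).trans (Category.assoc _ _ _).symm

end NatObj

/-! ### Weights, `V`-natural transformations, representables -/

section Weights

variable (V : Type u) [Category.{v} V] [MonoidalCategory V] [SymmetricCategory V]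
  [MonoidalClosed V]

/-- A weight: a `V`-functor from `D` to `V`. -/
abbrev Weight (D : Type u₁) [EnrichedCategory V D] := EnrichedFunctor V D V

variable {V}

/-- `V`-natural transformations `F ⟶ G` between `V`-functors `D → V`: the naturality square is
required on the level of hom-objects, not just on the level of underlying morphisms. -/
structure VNatTrans {D : Type u₁} [EnrichedCategory V D] (F G : Weight V D) where
  app (x : D) : F.obj x ⟶ G.obj x
  naturality (x y : D) :
    F.map x y ≫ eHomWhiskerLeft V (F.obj x) (app y) =
      G.map x y ≫ eHomWhiskerRight V (app x) (G.obj y)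

variable {C : Type u₁} [EnrichedCategory V C]

lemma uncurry_tensorHom_comp {a b c P Q : V} (f : P ⟶ (ihom a).obj b) (g : Q ⟶ (ihom b).obj c) :
    MonoidalClosed.uncurry ((f ⊗ₘ g) ≫ MonoidalClosed.comp a b c) =
      (α_ _ _ _).inv ≫ MonoidalClosed.uncurry f ▷ Q ≫ MonoidalClosed.uncurry g := by
  have h : MonoidalClosed.comp a b c = MonoidalClosed.curry (MonoidalClosed.compTranspose a b c) := rfl
  rw [h, ← MonoidalClosed.curry_natural_left, MonoidalClosed.uncurry_curry,
    MonoidalClosed.compTranspose_eq, MonoidalClosed.uncurry_eq, MonoidalClosed.uncurry_eq,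
    comp_whiskerRight, Category.assoc, ← whisker_exchange_assoc]
  simp [MonoidalCategory.tensorHom_def]

/-- The `V`-functor `C(X, -) : C → V`. -/
def corep (X : C) : Weight V C where
  obj Y := (EnrichedCategory.Hom X Y : V)
  map Y Z := MonoidalClosed.curry (eComp V X Y Z)
  map_id Y := by
    apply MonoidalClosed.uncurry_injective
    rw [← MonoidalClosed.curry_natural_left, MonoidalClosed.uncurry_curry]
    have h : eId V (EnrichedCategory.Hom X Y : V) = MonoidalClosed.curry (ρ_ _).hom := rfl
    rw [h, MonoidalClosed.uncurry_curry]
    have := e_comp_id V X Y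
    rw [Iso.inv_comp_eq] at this
    simpa using this
  map_comp Y Z T := by
    apply MonoidalClosed.uncurry_injective
    have h : eComp V (EnrichedCategory.Hom X Y : V) (EnrichedCategory.Hom X Z : V)
      (EnrichedCategory.Hom X T : V) = MonoidalClosed.comp _ _ _ := rfl
    rw [h, uncurry_tensorHom_comp, ← MonoidalClosed.curry_natural_left,
      MonoidalClosed.uncurry_curry, MonoidalClosed.uncurry_curry, MonoidalClosed.uncurry_curry,
      e_assoc]

/-- The opposite of a `V`-functor. -/
def opFunctor {D : Type u₂} [EnrichedCategory V D] (S : EnrichedFunctor V D C) :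
    EnrichedFunctor V Dᵒᵖ Cᵒᵖ where
  obj x := op (S.obj x.unop)
  map x y := S.map y.unop x.unop
  map_id x := S.map_id x.unop
  map_comp x y z := by
    rw [eComp_op_eq, Category.assoc]
    erw [S.map_comp]
    rw [← BraidedCategory.braiding_naturality_assoc]
    rfl

end Weights

/-! ### Weighted limits -/

section WeightedLimits

variable {V : Type u} [Category.{v} V] [MonoidalCategory V] [SymmetricCategory V]
  [MonoidalClosed V] [HasLimits V]
variable {D : Type v} [EnrichedCategory V D] {C : Type u₁} [EnrichedCategory V C]

/-- The map `[D, V](Q, p) : [D, V](Q, F) ⟶ [D, V](Q, G)` induced by a `V`-natural transformation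
`p : F ⟶ G`. -/
def natObjMap (Q : Weight V D) {F G : Weight V D} (p : VNatTrans F G) :
    natObj Q F ⟶ natObj Q G :=
  natObjLift Q G (fun x => natObjπ Q F x ≫ eHomWhiskerLeft V (Q.obj x) (p.app x)) (by
    intro x y
    rw [← tensorHom_comp_whiskerLeft_assoc, ← eComp_eHomWhiskerLeft,
      reassoc_of% natObjπ_condition Q F x y, eComp_eHomWhiskerLeft,
      tensorHom_comp_whiskerLeft_assoc, p.naturality, ← tensorHom_comp_whiskerLeft_assoc,
      ← eHomWhiskerLeft_eComp, tensorHom_comp_whiskerRight_assoc])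

lemma comparison_aux {a b d : V} {L Sx Sy : C} (w : d ⟶ (ihom a).obj b)
    (s : d ⟶ (EnrichedCategory.Hom Sx Sy : V)) (ηx : a ⟶ (EnrichedCategory.Hom L Sx : V))
    (ηy : b ⟶ (EnrichedCategory.Hom L Sy : V))
    (hη : w ≫ eHomWhiskerLeft V a ηy =
      (s ≫ MonoidalClosed.curry (eComp V L Sx Sy)) ≫
        eHomWhiskerRight V ηx (EnrichedCategory.Hom L Sy : V)) (X : C) :
    (w ⊗ₘ MonoidalClosed.curry
        ((β_ _ _).hom ≫ (EnrichedCategory.Hom X L : V) ◁ ηy ≫ eComp V X L Sy)) ≫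
        MonoidalClosed.comp a b (EnrichedCategory.Hom X Sy : V) =
      (β_ d (EnrichedCategory.Hom X L : V)).hom ≫
        (MonoidalClosed.curry
            ((β_ _ _).hom ≫ (EnrichedCategory.Hom X L : V) ◁ ηx ≫ eComp V X L Sx) ⊗ₘ
          (s ≫ MonoidalClosed.curry (eComp V X Sx Sy))) ≫
          MonoidalClosed.comp a (EnrichedCategory.Hom X Sx : V)
            (EnrichedCategory.Hom X Sy : V) := by
  have hη' : MonoidalClosed.uncurry w ≫ ηy = (ηx ⊗ₘ s) ≫ eComp V L Sx Sy := by
    have h := congrArg MonoidalClosed.uncurry hη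
    rw [MonoidalClosed.enrichedOrdinaryCategorySelf_eHomWhiskerLeft,
      MonoidalClosed.enrichedOrdinaryCategorySelf_eHomWhiskerRight,
      MonoidalClosed.uncurry_natural_right, MonoidalClosed.uncurry_pre_app,
      MonoidalClosed.uncurry_natural_left, MonoidalClosed.uncurry_curry] at h
    rw [h, MonoidalCategory.tensorHom_def, Category.assoc]
  apply MonoidalClosed.uncurry_injective
  rw [uncurry_tensorHom_comp, MonoidalClosed.uncurry_natural_left, uncurry_tensorHom_comp,
    MonoidalClosed.uncurry_curry, MonoidalClosed.uncurry_curry,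
    MonoidalClosed.uncurry_natural_left, MonoidalClosed.uncurry_curry,
    ← BraidedCategory.braiding_naturality_left_assoc, ← comp_whiskerRight_assoc, hη',
    BraidedCategory.braiding_naturality_left_assoc, MonoidalCategory.whiskerLeft_comp_assoc,
    ← e_assoc]
  simp [MonoidalCategory.tensorHom_def, ← whisker_exchange_assoc]

/-- The component at `d` of the comparison map: the transpose of
`W d ⊗ C(X, L) ⟶ C(X, L) ⊗ C(L, S d) ⟶ C(X, S d)`. -/
def comparisonApp {W : Weight V D} {S : EnrichedFunctor V D C} {L : C}
    (η : VNatTrans W (S.comp V (corep L))) (X : C) (d : D) :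
    (EnrichedCategory.Hom X L : V) ⟶
      (ihom (W.obj d)).obj (EnrichedCategory.Hom X (S.obj d) : V) :=
  MonoidalClosed.curry
    ((β_ _ _).hom ≫ (EnrichedCategory.Hom X L : V) ◁ η.app d ≫ eComp V X L (S.obj d))

/-- The map `C(X, L) ⟶ [D, V](W, C(X, S-))` induced by `η : W ⟶ C(L, S-)`. -/
def comparison {W : Weight V D} {S : EnrichedFunctor V D C} {L : C}
    (η : VNatTrans W (S.comp V (corep L))) (X : C) :
    (EnrichedCategory.Hom X L : V) ⟶ natObj W (S.comp V (corep X)) :=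
  natObjLift W (S.comp V (corep X)) (comparisonApp η X) fun x y =>
    comparison_aux (W.map x y) (S.map x y) (η.app x) (η.app y) (η.naturality x y) X

end WeightedLimits

section Notions

variable (V : Type u) [Category.{v} V] [MonoidalCategory V] [SymmetricCategory V]
  [MonoidalClosed V] [HasLimits V]

section

variable {V} {D : Type v} [EnrichedCategory V D] {C : Type u₁} [EnrichedCategory V C]

/-- `η : W ⟶ C(L, S-)` exhibits `L` as the limit of `S` weighted by `W`. -/
def IsWeightedLimit {W : Weight V D} {S : EnrichedFunctor V D C} {L : C}
    (η : VNatTrans W (S.comp V (corep L))) : Prop :=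
  ∀ X : C, IsIso (comparison η X)

/-- `C` has all limits weighted by `W`. -/
def HasWeightedLimits (C : Type u₁) [EnrichedCategory V C] (W : Weight V D) : Prop :=
  ∀ S : EnrichedFunctor V D C,
    ∃ (L : C) (η : VNatTrans W (S.comp V (corep L))), IsWeightedLimit η

end

/-- `C` has powers: for all `X : V` and `c : C` there are `P : C` and `κ : X ⟶ C(P, c)` inducing
isomorphisms `C(B, P) ≅ [X, C(B, c)]`. -/
def HasPowers (C : Type u₁) [EnrichedCategory V C] : Prop :=
  ∀ (X : V) (c : C), ∃ (P : C) (κ : X ⟶ (EnrichedCategory.Hom P c : V)),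
    ∀ B : C, IsIso (MonoidalClosed.curry
      ((β_ X (EnrichedCategory.Hom B P : V)).hom ≫
        (EnrichedCategory.Hom B P : V) ◁ κ ≫ eComp V B P c))

end Notions

/-! ### The arrow category as a `V`-category -/

section Arrow

variable (V : Type u) [Category.{v} V] [MonoidalCategory V] [HasPullbacks V]
variable {C : Type u₁} [Category.{v} C] [EnrichedOrdinaryCategory V C]

/-- The hom-object of arrows `f ⟶ g`, i.e. the pullback of
`C(A, A') ⟶ C(A, B') ⟵ C(B, B')` for `f : A ⟶ B` and `g : A' ⟶ B'`. -/
def arrowHom (f g : Arrow C) : V :=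
  pullback (eHomWhiskerLeft V f.left g.hom) (eHomWhiskerRight V f.hom g.right)

/-- The component `C^𝟚(f, g) ⟶ C(A, A')` at the domains. -/
def arrowHomLeft (f g : Arrow C) :
    arrowHom V f g ⟶ (EnrichedCategory.Hom f.left g.left : V) := pullback.fst _ _

/-- The component `C^𝟚(f, g) ⟶ C(B, B')` at the codomains. -/
def arrowHomRight (f g : Arrow C) :
    arrowHom V f g ⟶ (EnrichedCategory.Hom f.right g.right : V) := pullback.snd _ _

lemma arrowHom_condition (f g : Arrow C) :
    arrowHomLeft V f g ≫ eHomWhiskerLeft V f.left g.hom =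
      arrowHomRight V f g ≫ eHomWhiskerRight V f.hom g.right := pullback.condition

/-- The universal property of the hom-object of arrows. -/
def arrowHomLift {f g : Arrow C} {T : V} (l : T ⟶ (EnrichedCategory.Hom f.left g.left : V))
    (r : T ⟶ (EnrichedCategory.Hom f.right g.right : V))
    (h : l ≫ eHomWhiskerLeft V f.left g.hom = r ≫ eHomWhiskerRight V f.hom g.right) :
    T ⟶ arrowHom V f g := pullback.lift l r h

@[simp]
lemma arrowHomLift_left {f g : Arrow C} {T : V}
    (l : T ⟶ (EnrichedCategory.Hom f.left g.left : V))
    (r : T ⟶ (EnrichedCategory.Hom f.right g.right : V)) (h) :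
    arrowHomLift V l r h ≫ arrowHomLeft V f g = l := pullback.lift_fst _ _ _

@[simp]
lemma arrowHomLift_right {f g : Arrow C} {T : V}
    (l : T ⟶ (EnrichedCategory.Hom f.left g.left : V))
    (r : T ⟶ (EnrichedCategory.Hom f.right g.right : V)) (h) :
    arrowHomLift V l r h ≫ arrowHomRight V f g = r := pullback.lift_snd _ _ _

lemma arrowHom_ext {f g : Arrow C} {T : V} {a b : T ⟶ arrowHom V f g}
    (h₁ : a ≫ arrowHomLeft V f g = b ≫ arrowHomLeft V f g)
    (h₂ : a ≫ arrowHomRight V f g = b ≫ arrowHomRight V f g) : a = b :=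
  pullback.hom_ext h₁ h₂

/-- The identity of an arrow in the `V`-category of arrows. -/
def arrowId (f : Arrow C) : 𝟙_ V ⟶ arrowHom V f f :=
  arrowHomLift V (eId V f.left) (eId V f.right) (by
    have h₁ : eId V f.left ≫ eHomWhiskerLeft V f.left f.hom = eHomEquiv V f.hom := by
      rw [← eHomEquiv_id, ← Category.id_comp f.hom, eHomEquiv_comp, eHomWhiskerLeft]
      simp [MonoidalCategory.tensorHom_def, unitors_inv_equal]
    have h₂ : eId V f.right ≫ eHomWhiskerRight V f.hom f.right = eHomEquiv V f.hom := by
      rw [← eHomEquiv_id, ← Category.comp_id f.hom, eHomEquiv_comp, eHomWhiskerRight]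
      simp [MonoidalCategory.tensorHom_def']
    rw [h₁, h₂])

/-- Composition in the `V`-category of arrows. -/
def arrowComp (f g h : Arrow C) : arrowHom V f g ⊗ arrowHom V g h ⟶ arrowHom V f h :=
  arrowHomLift V
    ((arrowHomLeft V f g ⊗ₘ arrowHomLeft V g h) ≫ eComp V f.left g.left h.left)
    ((arrowHomRight V f g ⊗ₘ arrowHomRight V g h) ≫ eComp V f.right g.right h.right) (by
      rw [Category.assoc, Category.assoc, eComp_eHomWhiskerLeft, eComp_eHomWhiskerRight,
        tensorHom_comp_whiskerLeft_assoc, tensorHom_comp_whiskerRight_assoc,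
        arrowHom_condition, ← arrowHom_condition V f g,
        ← tensorHom_comp_whiskerLeft_assoc, ← tensorHom_comp_whiskerRight_assoc,
        eHomWhiskerLeft_eComp])

lemma arrowComp_left (f g h : Arrow C) :
    arrowComp V f g h ≫ arrowHomLeft V f h =
      (arrowHomLeft V f g ⊗ₘ arrowHomLeft V g h) ≫ eComp V f.left g.left h.left :=
  arrowHomLift_left _ _ _ _

lemma arrowComp_right (f g h : Arrow C) :
    arrowComp V f g h ≫ arrowHomRight V f h =
      (arrowHomRight V f g ⊗ₘ arrowHomRight V g h) ≫ eComp V f.right g.right h.right :=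
  arrowHomLift_right _ _ _ _

lemma arrowId_left (f : Arrow C) : arrowId V f ≫ arrowHomLeft V f f = eId V f.left :=
  arrowHomLift_left _ _ _ _

lemma arrowId_right (f : Arrow C) : arrowId V f ≫ arrowHomRight V f f = eId V f.right :=
  arrowHomLift_right _ _ _ _

/-- The `V`-category of arrows of `C`. For `C = V` this is the power of `V` by the arrow category. -/
instance arrowEnriched : EnrichedCategory V (Arrow C) where
  Hom f g := arrowHom V f g
  id f := arrowId V f
  comp f g h := arrowComp V f g h
  id_comp f g := by
    apply arrowHom_ext
    · rw [Category.assoc, Category.assoc, arrowComp_left, whiskerRight_comp_tensorHom_assoc,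
        arrowId_left, MonoidalCategory.tensorHom_def', Category.assoc,
        ← leftUnitor_inv_naturality_assoc, e_id_comp, Category.id_comp, Category.comp_id]
    · rw [Category.assoc, Category.assoc, arrowComp_right, whiskerRight_comp_tensorHom_assoc,
        arrowId_right, MonoidalCategory.tensorHom_def', Category.assoc,
        ← leftUnitor_inv_naturality_assoc, e_id_comp, Category.id_comp, Category.comp_id]
  comp_id f g := by
    apply arrowHom_ext
    · rw [Category.assoc, Category.assoc, arrowComp_left, whiskerLeft_comp_tensorHom_assoc,
        arrowId_left, MonoidalCategory.tensorHom_def, Category.assoc,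
        ← rightUnitor_inv_naturality_assoc, e_comp_id, Category.id_comp, Category.comp_id]
    · rw [Category.assoc, Category.assoc, arrowComp_right, whiskerLeft_comp_tensorHom_assoc,
        arrowId_right, MonoidalCategory.tensorHom_def, Category.assoc,
        ← rightUnitor_inv_naturality_assoc, e_comp_id, Category.id_comp, Category.comp_id]
  assoc f g h k := by
    apply arrowHom_ext
    · rw [Category.assoc, Category.assoc, Category.assoc, arrowComp_left, arrowComp_left,
        whiskerRight_comp_tensorHom_assoc, whiskerLeft_comp_tensorHom_assoc, arrowComp_left,
        arrowComp_left, ← tensorHom_comp_whiskerRight_assoc, ← tensorHom_comp_whiskerLeft_assoc,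
        ← e_assoc, ← associator_inv_naturality_assoc]
    · rw [Category.assoc, Category.assoc, Category.assoc, arrowComp_right, arrowComp_right,
        whiskerRight_comp_tensorHom_assoc, whiskerLeft_comp_tensorHom_assoc, arrowComp_right,
        arrowComp_right, ← tensorHom_comp_whiskerRight_assoc, ← tensorHom_comp_whiskerLeft_assoc,
        ← e_assoc, ← associator_inv_naturality_assoc]

end Arrow

/-! ### The unit `V`-category -/

section Unit

variable (V : Type u) [Category.{v} V] [MonoidalCategory V]

/-- The type of objects of the unit `V`-category: a single object. -/
inductive UnitCat (V : Type u) : Type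
  | star : UnitCat V

/-- The unit `V`-category, with one object whose endomorphism object is the unit of `V`. -/
instance unitCatEnriched : EnrichedCategory V (UnitCat V) where
  Hom _ _ := 𝟙_ V
  id _ := 𝟙 _
  comp _ _ _ := (λ_ (𝟙_ V)).hom
  id_comp _ _ := by simp
  comp_id _ _ := by simp [unitors_equal]
  assoc _ _ _ _ := by simp [unitors_equal]

/-- The `V`-functor from the unit `V`-category to `V` selecting the unit object of `V`. -/
def unitFunctor [MonoidalClosed V] : Weight V (UnitCat V) where
  obj _ := 𝟙_ V
  map _ _ := eId V (𝟙_ V)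
  map_id _ := Category.id_comp _
  map_comp _ _ _ := by
    change (λ_ (𝟙_ V)).hom ≫ eId V (𝟙_ V) =
      ((eId V (𝟙_ V) ⊗ₘ eId V (𝟙_ V)) : 𝟙_ V ⊗ 𝟙_ V ⟶ _) ≫ eComp V (𝟙_ V) (𝟙_ V) (𝟙_ V)
    rw [← Iso.eq_inv_comp, MonoidalCategory.tensorHom_def', Category.assoc,
      ← leftUnitor_inv_naturality_assoc, e_id_comp, Category.comp_id]

end Unit

/-! ### Intervals, shrinkable morphisms, cofibrant weights -/

section Model

variable (V : Type u) [Category.{v} V] [MonoidalCategory V] [ModelCategory V]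

/-- An interval in `V`: a factorisation of the codiagonal of the unit object as a cofibration
`(d c)` followed by a weak equivalence `e`. -/
structure Interval where
  J : V
  d : 𝟙_ V ⟶ J
  c : 𝟙_ V ⟶ J
  e : J ⟶ 𝟙_ V
  d_e : d ≫ e = 𝟙 _
  c_e : c ≫ e = 𝟙 _
  cofibration : Cofibration (coprod.desc d c)
  weakEquivalence : WeakEquivalence e

/-- A morphism `f : A ⟶ B` of (the underlying category of) a `V`-category is shrinkable if it has
a section `s` and, for some interval, a `V`-homotopy from `s ∘ f` to the identity of `A` which
becomes trivial upon composing with `f`. -/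
def Shrinkable {C : Type u₁} [Category.{v} C] [EnrichedOrdinaryCategory V C] {A B : C}
    (f : A ⟶ B) : Prop :=
  ∃ s : B ⟶ A, s ≫ f = 𝟙 B ∧
    ∃ (J : Interval V) (h : J.J ⟶ (EnrichedCategory.Hom A A : V)),
      J.d ≫ h = eHomEquiv V (f ≫ s) ∧ J.c ≫ h = eHomEquiv V (𝟙 A) ∧
        h ≫ eHomWhiskerLeft V A f = J.e ≫ eHomEquiv V f

variable {V} [SymmetricCategory V] [MonoidalClosed V] [HasLimits V]
variable {D : Type v} [EnrichedCategory V D]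

/-- A `V`-natural transformation is a (pointwise) trivial fibration. -/
def VNatTrans.IsTrivialFibration {F G : Weight V D} (p : VNatTrans F G) : Prop :=
  ∀ x, trivialFibrations V (p.app x)

/-- A weight `Q` is cofibrant if `[D, V](Q, -)` sends trivial fibrations to trivial fibrations. -/
def IsCofibrantWeight (Q : Weight V D) : Prop :=
  ∀ (F G : Weight V D) (p : VNatTrans F G), p.IsTrivialFibration →
    trivialFibrations V (natObjMap Q p)

/-- `Q` is a cofibrant weight admitting a pointwise trivial fibration to the composite of
`P : D → UnitCat V` and the `V`-functor selecting the unit object. -/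
def IsCofibrantReplacement (P : EnrichedFunctor V D (UnitCat V)) (Q : Weight V D) : Prop :=
  IsCofibrantWeight Q ∧
    ∃ q : VNatTrans Q (P.comp V (unitFunctor V)), q.IsTrivialFibration

/-- `W`-weighted limits are `ℰ`-stable: the full sub-`V`-category of the `V`-category of arrows
of `V` consisting of the shrinkable morphisms is closed under `W`-weighted limits. -/
def IsEStable (W : Weight V D) : Prop :=
  ∀ (S : EnrichedFunctor V D (Arrow V)), (∀ x, Shrinkable V (S.obj x).hom) →
    ∀ (L : Arrow V) (η : VNatTrans W (S.comp V (corep L))),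
      IsWeightedLimit η → Shrinkable V L.hom

variable (V)

/-- Shrinkable morphisms are closed in the `V`-category of arrows of `V` under enough
cofibrantly-weighted limits. -/
def EnoughCofibrantlyWeightedLimitsEStable : Prop :=
  ∀ (D : Type v) [EnrichedCategory V D] (P : EnrichedFunctor V D (UnitCat V)),
    ∃ Q : Weight V D, IsCofibrantReplacement P Q ∧ IsEStable Q

/-- `C` has enough cofibrantly-weighted limits. -/
def HasEnoughCofibrantlyWeightedLimits (C : Type u₁) [EnrichedCategory V C] : Prop :=
  ∀ (D : Type v) [EnrichedCategory V D] (P : EnrichedFunctor V D (UnitCat V)),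
    ∃ Q : Weight V D, IsCofibrantReplacement P Q ∧ HasWeightedLimits C Q

/-- `C` has `ℰ`-stable limits. -/
def HasEStableLimits (C : Type u₁) [EnrichedCategory V C] : Prop :=
  ∀ (D : Type v) [EnrichedCategory V D] (W : Weight V D), IsEStable W → HasWeightedLimits C W

/-- `C` has `ℰ`-weak colimits: for every weight `W : Dᵒᵖ → V` and diagram `S : D → C` there is
`η : W ⟶ C(S-, c)` for which the induced maps `C(c, a) ⟶ [Dᵒᵖ, V](W, C(S-, a))` are shrinkable.
Here `C(S-, c)` is written as `Cᵒᵖ(op c, Sᵒᵖ-)`, so that the induced map is an instance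
of `comparison`. -/
def HasEWeakColimits (C : Type u₁) [EnrichedCategory V C] : Prop :=
  ∀ (D : Type v) [EnrichedCategory V D] (W : Weight V Dᵒᵖ) (S : EnrichedFunctor V D C),
    ∃ (c : C) (η : VNatTrans W ((opFunctor S).comp V (corep (op c)))),
      ∀ a : C, Shrinkable V (comparison η (op a))

end Model

/-! ### Accessible `V`-categories -/

section Accessible

variable (V : Type u) [Category.{v} V] [MonoidalCategory V]
variable {C : Type u₁} [Category.{v} C] [EnrichedOrdinaryCategory V C]

/-- A conical colimit: a colimit in the underlying category which is sent by each
`C(-, c)` to a limit in `V`. -/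
structure IsConicalColimit {H : Type v} [SmallCategory H] {F : H ⥤ C} (t : Cocone F) : Prop where
  isColimit : Nonempty (IsColimit t)
  isLimit (c : C) : Nonempty (IsLimit (((eHomFunctor V C).flip.obj c).mapCone t.op))

/-- `A` is `κ`-presentable in the enriched sense: `C(A, -)` preserves (conical) `κ`-filtered
colimits. -/
def IsEnrichedPresentable [MonoidalClosed V] (κ : Cardinal.{v}) [Fact κ.IsRegular] (A : C) :
    Prop :=
  ∀ (H : Type v) [SmallCategory H] [IsCardinalFiltered H κ] (F : H ⥤ C) (t : Cocone F),
    IsConicalColimit V t → IsConicalColimit V ((eCoyoneda V A).mapCocone t)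

variable (C) in
/-- `C` is `κ`-accessible as a `V`-category: it has `κ`-filtered colimits and a small family of
`κ`-presentable objects of which every object is a `κ`-filtered colimit. -/
structure IsEnrichedCardinalAccessible [MonoidalClosed V] (κ : Cardinal.{v}) [Fact κ.IsRegular] :
    Prop where
  exists_colimit (H : Type v) [SmallCategory H] [IsCardinalFiltered H κ] (F : H ⥤ C) :
    ∃ t : Cocone F, IsConicalColimit V t
  exists_generator : ∃ (ι : Type v) (G : ι → C), (∀ i, IsEnrichedPresentable V κ (G i)) ∧
    ∀ X : C, ∃ (H : Type v) (_ : SmallCategory H) (_ : IsCardinalFiltered H κ) (F : H ⥤ C)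
      (t : F ⟶ (Functor.const H).obj X),
      (∀ h, F.obj h ∈ Set.range G) ∧ IsConicalColimit V (Cocone.mk X t)

/-- The condition on a regular cardinal that makes it an admissible lower bound for enriched
accessibility: `V` is locally `κ`-presentable, its unit object is `κ`-presentable, and
`κ`-presentable objects are closed under the tensor product. -/
structure IsBaseCardinal (κ : Cardinal.{v}) [Fact κ.IsRegular] : Prop where
  locallyPresentable : IsCardinalLocallyPresentable V κ
  unit : IsCardinalPresentable (𝟙_ V) κ
  tensor (X Y : V) (hX : IsCardinalPresentable X κ) (hY : IsCardinalPresentable Y κ) :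
    IsCardinalPresentable (X ⊗ Y) κ

variable (C) in
/-- `C` is accessible as a `V`-category: it is `κ`-accessible for some regular cardinal `κ`
above some base cardinal. -/
def IsEnrichedAccessible [MonoidalClosed V] : Prop :=
  ∃ (κ₀ κ : Cardinal.{v}) (_ : Fact κ₀.IsRegular) (_ : Fact κ.IsRegular),
    IsBaseCardinal V κ₀ ∧ κ₀ ≤ κ ∧ IsEnrichedCardinalAccessible V C κ

end Accessible

end HEnriched

end

open CategoryTheory MonoidalCategory Limits HomotopicalAlgebra HEnriched

universe v u w

/-!
A power of a shrinkable morphism is shrinkable, because `[X, -]` preserves homotopies parametrised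
by an interval; so powers are among the `ℰ`-stable limits.

For a weight `W` and a diagram `S`, an `ℰ`-weak colimit is a shrinkable `V`-natural transformation
`C(c, -) ⟶ M`, where `M = [Dᵒᵖ, V](W, C(S, -))`. Since `C` is accessible, `M` has a small family of
elements through which every element factors. The limit of the diagram of these elements, weighted
by a cofibrant replacement of the constant weight, is preserved by `M`, and the element of `M` that
it carries is weakly initial, uniquely up to homotopy. Given powers, the hom-objects of the category
of elements can be replaced by their ordinary points, and this is enough for shrinkability.

Conversely, the cone functor `[D, V](W, C(-, S))` of an `ℰ`-stable weight, restricted to a small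
generator of presentable objects, has an `ℰ`-weak colimit `c`. Stability of shrinkable morphisms
under `W`-weighted limits turns the shrinkings into a `W`-cone with vertex `c` that exhibits the
cone functor as a retract of `C(-, c)` on the generator. The resulting idempotent comes from one on
`c`, and a splitting of the latter represents the cone functor on the generator, hence everywhere.
-/

noncomputable section

namespace HEnriched

open Opposite
open scoped CategoryTheory.MonoidalClosed

universe u₁ u₂ u₃

/-! ### Precomposition with points of hom-objects -/

section Precomp

variable {V : Type u} [Category.{v} V] [MonoidalCategory V] {C : Type u₁} [EnrichedCategory V C]

/-- Precomposition `C(Y, Z) ⟶ C(X, Z)` with a point of `C(X, Y)`. -/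
def precomp {X Y : C} (u : 𝟙_ V ⟶ (EnrichedCategory.Hom X Y : V)) (Z : C) :
    (EnrichedCategory.Hom Y Z : V) ⟶ (EnrichedCategory.Hom X Z : V) :=
  (λ_ _).inv ≫ u ▷ _ ≫ eComp V X Y Z

lemma eComp_precomp {X Y : C} (u : 𝟙_ V ⟶ (EnrichedCategory.Hom X Y : V)) (Z T : C) :
    eComp V Y Z T ≫ precomp u T = precomp u Z ▷ _ ≫ eComp V X Z T := by
  simp only [precomp, comp_whiskerRight, Category.assoc]
  rw [leftUnitor_inv_naturality_assoc, whisker_exchange_assoc, ← e_assoc']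
  simp

lemma precomp_id (X Z : C) : precomp (eId V X) Z = 𝟙 _ := e_id_comp V X Z

lemma precomp_precomp {X Y Z : C} (u : 𝟙_ V ⟶ (EnrichedCategory.Hom X Y : V))
    (t : 𝟙_ V ⟶ (EnrichedCategory.Hom Y Z : V)) (T : C) :
    precomp t T ≫ precomp u T = precomp (t ≫ precomp u Z) T := by
  rw [precomp, Category.assoc, Category.assoc, eComp_precomp]
  simp [precomp]

lemma precomp_eHomEquiv {C : Type u₁} [Category.{v} C] [EnrichedOrdinaryCategory V C]
    {X Y : C} (f : X ⟶ Y) (Z : C) :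
    precomp (eHomEquiv V f) Z = eHomWhiskerRight V f Z := rfl

end Precomp

/-! ### Weights as right modules -/

section Modules

variable {V : Type u} [Category.{v} V] [MonoidalCategory V] [SymmetricCategory V]
  [MonoidalClosed V]
variable {C : Type u₁} [EnrichedCategory V C] {D : Type u₂} [EnrichedCategory V D]

/-- The action `M x ⊗ C(x, y) ⟶ M y` of a weight `M`: a weight is a right module over `C`, and
working with actions avoids transposing through the internal hom. -/
def act (M : EnrichedFunctor V C V) (x y : C) :
    M.obj x ⊗ (EnrichedCategory.Hom x y : V) ⟶ M.obj y :=
  MonoidalClosed.uncurry (M.map x y)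

omit [SymmetricCategory V] in
lemma act_id (M : EnrichedFunctor V C V) (x : C) :
    M.obj x ◁ eId V x ≫ act M x x = (ρ_ _).hom := by
  rw [act, ← MonoidalClosed.uncurry_natural_left, M.map_id]
  exact MonoidalClosed.uncurry_curry _

lemma act_comp (M : EnrichedFunctor V C V) (x y z : C) :
    M.obj x ◁ eComp V x y z ≫ act M x z =
      (α_ _ _ _).inv ≫ act M x y ▷ _ ≫ act M y z := by
  rw [act, ← MonoidalClosed.uncurry_natural_left, M.map_comp]
  exact uncurry_tensorHom_comp _ _

/-- A weight from a family of objects with an action. -/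
def Weight.ofAct (obj : C → V) (a : ∀ x y, obj x ⊗ (EnrichedCategory.Hom x y : V) ⟶ obj y)
    (h_id : ∀ x, obj x ◁ eId V x ≫ a x x = (ρ_ _).hom)
    (h_comp : ∀ x y z, obj x ◁ eComp V x y z ≫ a x z =
      (α_ _ _ _).inv ≫ a x y ▷ _ ≫ a y z) : EnrichedFunctor V C V where
  obj := obj
  map x y := MonoidalClosed.curry (a x y)
  map_id x := by
    rw [← MonoidalClosed.curry_natural_left, h_id]
    rfl
  map_comp x y z := by
    apply MonoidalClosed.uncurry_injective
    refine Eq.trans ?_ (uncurry_tensorHom_comp _ _).symm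
    rw [MonoidalClosed.uncurry_natural_left, MonoidalClosed.uncurry_curry,
      MonoidalClosed.uncurry_curry, MonoidalClosed.uncurry_curry, h_comp]

lemma Weight.act_ofAct (obj : C → V)
    (a : ∀ x y, obj x ⊗ (EnrichedCategory.Hom x y : V) ⟶ obj y) (h_id) (h_comp) (x y : C) :
    act (Weight.ofAct obj a h_id h_comp) x y = a x y :=
  MonoidalClosed.uncurry_curry _

omit [SymmetricCategory V] in
lemma act_functorComp (S : EnrichedFunctor V D C) (M : EnrichedFunctor V C V) (x y : D) :
    act (S.comp V M) x y = (M.obj (S.obj x) ◁ S.map x y ≫ act M (S.obj x) (S.obj y) :) :=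
  MonoidalClosed.uncurry_natural_left _ _

lemma Weight.ofAct_eq {F : EnrichedFunctor V C V}
    (a : ∀ x y, F.obj x ⊗ (EnrichedCategory.Hom x y : V) ⟶ F.obj y) (h_id) (h_comp)
    (h : ∀ x y, a x y = act F x y) : Weight.ofAct F.obj a h_id h_comp = F := by
  obtain rfl : a = act F := funext fun x => funext (h x)
  have map_eq : ∀ x y, MonoidalClosed.curry (act F x y) = F.map x y := fun x y =>
    MonoidalClosed.curry_uncurry _
  obtain ⟨obj, map, map_id, map_comp⟩ := F
  simp only [Weight.ofAct, map_eq]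

/-- The map `C(x, y) ⟶ M y` given by acting on a point `p` of `M x`. -/
def evalAt (M : EnrichedFunctor V C V) {x : C} (p : 𝟙_ V ⟶ M.obj x) (y : C) :
    (EnrichedCategory.Hom x y : V) ⟶ M.obj y :=
  (λ_ _).inv ≫ p ▷ _ ≫ act M x y

omit [SymmetricCategory V] in
@[simp]
lemma eId_evalAt (M : EnrichedFunctor V C V) {x : C} (p : 𝟙_ V ⟶ M.obj x) :
    eId V x ≫ evalAt M p x = p := by
  rw [evalAt, leftUnitor_inv_naturality_assoc, whisker_exchange_assoc, act_id]
  simp [unitors_inv_equal]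

lemma eComp_evalAt (M : EnrichedFunctor V C V) {x : C} (p : 𝟙_ V ⟶ M.obj x) (y z : C) :
    eComp V x y z ≫ evalAt M p z = evalAt M p y ▷ _ ≫ act M y z := by
  simp only [evalAt, comp_whiskerRight, Category.assoc]
  rw [leftUnitor_inv_naturality_assoc, whisker_exchange_assoc, act_comp]
  simp

lemma act_corep (X y z : C) : act (corep (V := V) X) y z = eComp V X y z :=
  MonoidalClosed.uncurry_curry _

lemma precomp_evalAt (M : EnrichedFunctor V C V) {X Y : C} (p : 𝟙_ V ⟶ M.obj X)
    (u : 𝟙_ V ⟶ (EnrichedCategory.Hom X Y : V)) (Z : C) :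
    precomp u Z ≫ evalAt M p Z = evalAt M (u ≫ evalAt M p Y) Z := by
  rw [precomp, Category.assoc, Category.assoc, eComp_evalAt]
  simp [evalAt]

/-- The map `M X ⟶ M Y` given by the action of a point of `C(X, Y)`. -/
def mapPoint (M : EnrichedFunctor V C V) {X Y : C}
    (u : 𝟙_ V ⟶ (EnrichedCategory.Hom X Y : V)) : M.obj X ⟶ M.obj Y :=
  (ρ_ _).inv ≫ M.obj X ◁ u ≫ act M X Y

omit [SymmetricCategory V] in
lemma mapPoint_eId (M : EnrichedFunctor V C V) (X : C) : mapPoint M (eId V X) = 𝟙 _ := by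
  rw [mapPoint, act_id, Iso.inv_hom_id]

lemma whiskerLeft_precomp_act (M : EnrichedFunctor V C V) {X Y : C}
    (u : 𝟙_ V ⟶ (EnrichedCategory.Hom X Y : V)) (Z : C) :
    M.obj X ◁ precomp u Z ≫ act M X Z = mapPoint M u ▷ _ ≫ act M Y Z := by
  simp only [precomp, mapPoint, MonoidalCategory.whiskerLeft_comp, comp_whiskerRight,
    Category.assoc, act_comp]
  simp

lemma mapPoint_comp (M : EnrichedFunctor V C V) {X Y Z : C}
    (u : 𝟙_ V ⟶ (EnrichedCategory.Hom X Y : V)) (t : 𝟙_ V ⟶ (EnrichedCategory.Hom Y Z : V)) :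
    mapPoint M (t ≫ precomp u Z) = mapPoint M u ≫ mapPoint M t := by
  rw [mapPoint, MonoidalCategory.whiskerLeft_comp, Category.assoc, whiskerLeft_precomp_act,
    whisker_exchange_assoc, mapPoint, mapPoint]
  simp

omit [SymmetricCategory V] in
lemma VNatTrans.act_app {F G : Weight V D} (p : VNatTrans F G) (x y : D) :
    act F x y ≫ p.app y = p.app x ▷ _ ≫ act G x y := by
  have h := congrArg MonoidalClosed.uncurry (p.naturality x y)
  rwa [MonoidalClosed.enrichedOrdinaryCategorySelf_eHomWhiskerLeft,
    MonoidalClosed.enrichedOrdinaryCategorySelf_eHomWhiskerRight,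
    MonoidalClosed.uncurry_natural_right, MonoidalClosed.uncurry_pre_app] at h

omit [SymmetricCategory V] in
lemma VNatTrans.mapPoint_app {F G : Weight V D} (p : VNatTrans F G) {X Y : D}
    (u : 𝟙_ V ⟶ (EnrichedCategory.Hom X Y : V)) :
    mapPoint F u ≫ p.app Y = p.app X ≫ mapPoint G u := by
  rw [mapPoint, Category.assoc, Category.assoc, p.act_app, whisker_exchange_assoc, mapPoint]
  simp

/-- A `V`-natural transformation from a family of maps compatible with the actions. -/
def VNatTrans.ofAct {F G : Weight V D} (app : ∀ x, F.obj x ⟶ G.obj x)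
    (h : ∀ x y, act F x y ≫ app y = app x ▷ _ ≫ act G x y) : VNatTrans F G where
  app := app
  naturality x y := by
    apply MonoidalClosed.uncurry_injective
    rw [MonoidalClosed.enrichedOrdinaryCategorySelf_eHomWhiskerLeft,
      MonoidalClosed.enrichedOrdinaryCategorySelf_eHomWhiskerRight,
      MonoidalClosed.uncurry_natural_right, MonoidalClosed.uncurry_pre_app]
    exact h x y

/-! ### Cones -/

section Cones

variable {W : Weight V D} {S : EnrichedFunctor V D C}

/-- The components `W d ⟶ C(L, S d)` of a cone. -/
def coneHom {L : C} (η : VNatTrans W (S.comp V (corep L))) (d : D) :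
    W.obj d ⟶ (EnrichedCategory.Hom L (S.obj d) : V) :=
  η.app d

lemma act_coneHom {L : C} (η : VNatTrans W (S.comp V (corep L))) (x y : D) :
    act W x y ≫ coneHom η y =
      coneHom η x ▷ _ ≫ _ ◁ S.map x y ≫ eComp V L (S.obj x) (S.obj y) := by
  have h := η.act_app x y
  rw [act_functorComp, act_corep] at h
  exact h

/-- A cone from its components. -/
def coneOf {L : C} (app : ∀ d, W.obj d ⟶ (EnrichedCategory.Hom L (S.obj d) : V))
    (h : ∀ x y, act W x y ≫ app y =
      app x ▷ _ ≫ _ ◁ S.map x y ≫ eComp V L (S.obj x) (S.obj y)) :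
    VNatTrans W (S.comp V (corep L)) :=
  VNatTrans.ofAct app fun x y => by
    rw [act_functorComp, act_corep]
    exact h x y

end Cones

/-! ### Objects of natural transformations as classifiers of module maps -/

section NatObjEval

variable [HasLimits V] {D : Type v} [EnrichedCategory V D]

/-- The evaluation `[D, V](F, G) ⊗ F x ⟶ G x`. -/
def natObjEval (F G : Weight V D) (x : D) : natObj F G ⊗ F.obj x ⟶ G.obj x :=
  (β_ _ _).hom ≫ MonoidalClosed.uncurry (natObjπ F G x)

lemma whiskerRight_natObjEval {F G : Weight V D} {T : V} (f : T ⟶ natObj F G) (x : D) :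
    f ▷ F.obj x ≫ natObjEval F G x =
      (β_ _ _).hom ≫ MonoidalClosed.uncurry (f ≫ natObjπ F G x) := by
  rw [natObjEval, BraidedCategory.braiding_naturality_left_assoc,
    ← MonoidalClosed.uncurry_natural_left]

lemma natObjEval_act (F G : Weight V D) (x y : D) :
    natObj F G ◁ act F x y ≫ natObjEval F G y =
      (α_ _ _ _).inv ≫ natObjEval F G x ▷ _ ≫ act G x y := by
  have condition : MonoidalClosed.uncurry (F.map x y) ▷ natObj F G ≫
      MonoidalClosed.uncurry (natObjπ F G y) = (α_ _ _ _).hom ≫ F.obj x ◁ (β_ _ _).hom ≫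
        (α_ _ _ _).inv ≫ MonoidalClosed.uncurry (natObjπ F G x) ▷ _ ≫
          MonoidalClosed.uncurry (G.map x y) := by
    rw [← Iso.inv_comp_eq]
    refine (uncurry_tensorHom_comp (F.map x y) (natObjπ F G y)).symm.trans ?_
    refine (congrArg MonoidalClosed.uncurry (natObjπ_condition F G x y)).trans ?_
    exact (MonoidalClosed.uncurry_natural_left _ _).trans
      (congrArg _ (uncurry_tensorHom_comp (natObjπ F G x) (G.map x y)))
  simp only [natObjEval, comp_whiskerRight, Category.assoc,
    BraidedCategory.braiding_naturality_right_assoc]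
  change _ ≫ MonoidalClosed.uncurry (F.map x y) ▷ _ ≫ _ = _
  rw [condition]
  simp [act, ← MonoidalCategory.whiskerLeft_comp_assoc]

/-- The map `T ⟶ [D, V](F, G)` induced by a family of maps `T ⊗ F x ⟶ G x` compatible with the
actions. -/
def natObjCurry {F G : Weight V D} {T : V} (ψ : ∀ x, T ⊗ F.obj x ⟶ G.obj x)
    (hψ : ∀ x y, T ◁ act F x y ≫ ψ y = (α_ _ _ _).inv ≫ ψ x ▷ _ ≫ act G x y) :
    T ⟶ natObj F G :=
  natObjLift F G (fun x => MonoidalClosed.curry ((β_ _ _).hom ≫ ψ x)) fun x y => by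
    apply MonoidalClosed.uncurry_injective
    refine (uncurry_tensorHom_comp _ _).trans (Eq.trans ?_
      ((MonoidalClosed.uncurry_natural_left _ _).trans
        (congrArg _ (uncurry_tensorHom_comp _ _))).symm)
    rw [MonoidalClosed.uncurry_curry, MonoidalClosed.uncurry_curry,
      BraidedCategory.braiding_naturality_left_assoc]
    change _ ≫ _ ≫ T ◁ act F x y ≫ _ = _ ≫ _ ≫ _ ≫ act G x y
    rw [hψ]
    simp

@[simp]
lemma natObjCurry_eval {F G : Weight V D} {T : V} (ψ : ∀ x, T ⊗ F.obj x ⟶ G.obj x) (hψ) (x : D) :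
    natObjCurry ψ hψ ▷ F.obj x ≫ natObjEval F G x = ψ x := by
  rw [whiskerRight_natObjEval, natObjCurry, natObjLift_π,
    MonoidalClosed.uncurry_curry, SymmetricCategory.symmetry_assoc]

lemma natObj_ext {F G : Weight V D} {T : V} {f g : T ⟶ natObj F G}
    (h : ∀ x, f ▷ F.obj x ≫ natObjEval F G x = g ▷ F.obj x ≫ natObjEval F G x) : f = g := by
  refine natObj_hom_ext F G fun x => MonoidalClosed.uncurry_injective ?_
  rw [← cancel_epi (β_ _ _).hom, ← whiskerRight_natObjEval, ← whiskerRight_natObjEval]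
  exact h x

@[simp]
lemma natObjMap_eval (Q : Weight V D) {F G : Weight V D} (p : VNatTrans F G) (x : D) :
    natObjMap Q p ▷ Q.obj x ≫ natObjEval Q G x = natObjEval Q F x ≫ p.app x := by
  rw [whiskerRight_natObjEval, natObjMap, natObjLift_π,
    MonoidalClosed.enrichedOrdinaryCategorySelf_eHomWhiskerLeft,
    MonoidalClosed.uncurry_natural_right, natObjEval, Category.assoc]

/-- A `V`-natural transformation as a point of the object of natural transformations. -/
def natObjPoint {F G : Weight V D} (p : VNatTrans F G) : 𝟙_ V ⟶ natObj F G :=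
  natObjCurry (fun x => (λ_ _).hom ≫ p.app x) fun x y => by simp [p.act_app]

@[simp]
lemma natObjPoint_eval {F G : Weight V D} (p : VNatTrans F G) (x : D) :
    natObjPoint p ▷ F.obj x ≫ natObjEval F G x = (λ_ _).hom ≫ p.app x :=
  natObjCurry_eval _ _ _

/-- The `V`-natural transformation determined by a point of the object of natural
transformations. -/
def natTransOfPoint {F G : Weight V D} (z : 𝟙_ V ⟶ natObj F G) : VNatTrans F G :=
  VNatTrans.ofAct (fun x => (λ_ _).inv ≫ z ▷ _ ≫ natObjEval F G x) fun x y => by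
    rw [leftUnitor_inv_naturality_assoc, whisker_exchange_assoc, natObjEval_act]
    simp

lemma natTransOfPoint_app {F G : Weight V D} (z : 𝟙_ V ⟶ natObj F G) (x : D) :
    (natTransOfPoint z).app x = (λ_ _).inv ≫ z ▷ _ ≫ natObjEval F G x := rfl

end NatObjEval

section WeightEval

variable [HasLimits V] {D : Type v} [EnrichedCategory V D] {W : Weight V D}
  {S : EnrichedFunctor V D C} (M : Weight V C)

variable (W S)

/-- The evaluation `[D, V](W, M S-) ⊗ W d ⟶ M (S d)`. -/
def weightEval (d : D) : natObj W (S.comp V M) ⊗ W.obj d ⟶ M.obj (S.obj d) :=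
  natObjEval W (S.comp V M) d

lemma weightEval_act (x y : D) :
    natObj W (S.comp V M) ◁ act W x y ≫ weightEval W S M y =
      (α_ _ _ _).inv ≫ weightEval W S M x ▷ _ ≫ _ ◁ S.map x y ≫
        act M (S.obj x) (S.obj y) := by
  have h := natObjEval_act W (S.comp V M) x y
  rw [act_functorComp] at h
  exact h

variable {W S M}

/-- The map `T ⟶ [D, V](W, M S-)` induced by a compatible family `T ⊗ W d ⟶ M (S d)`. -/
def weightCurry {T : V} (ψ : ∀ d, T ⊗ W.obj d ⟶ M.obj (S.obj d))
    (hψ : ∀ x y, T ◁ act W x y ≫ ψ y =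
      (α_ _ _ _).inv ≫ ψ x ▷ _ ≫ _ ◁ S.map x y ≫ act M (S.obj x) (S.obj y)) :
    T ⟶ natObj W (S.comp V M) :=
  natObjCurry ψ fun x y => by
    rw [act_functorComp]
    exact hψ x y

@[simp]
lemma weightCurry_eval {T : V} (ψ : ∀ d, T ⊗ W.obj d ⟶ M.obj (S.obj d)) (hψ) (d : D) :
    weightCurry (S := S) (M := M) ψ hψ ▷ W.obj d ≫ weightEval W S M d = ψ d :=
  natObjCurry_eval _ _ _

lemma weightEval_ext {T : V} {f g : T ⟶ natObj W (S.comp V M)}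
    (h : ∀ d, f ▷ W.obj d ≫ weightEval W S M d = g ▷ W.obj d ≫ weightEval W S M d) : f = g :=
  natObj_ext h

variable (W S)

/-- The evaluation `[D, V](W, C(X, S-)) ⊗ W d ⟶ C(X, S d)`. -/
def coneEval (X : C) (d : D) :
    natObj W (S.comp V (corep X)) ⊗ W.obj d ⟶ (EnrichedCategory.Hom X (S.obj d) : V) :=
  weightEval W S (corep X) d

lemma coneEval_act (X : C) (x y : D) :
    natObj W (S.comp V (corep X)) ◁ act W x y ≫ coneEval W S X y =
      (α_ _ _ _).inv ≫ coneEval W S X x ▷ _ ≫ _ ◁ S.map x y ≫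
        eComp V X (S.obj x) (S.obj y) := by
  have h := weightEval_act W S (corep X) x y
  rwa [act_corep] at h

variable {W S}

lemma coneEval_ext {X : C} {T : V} {f g : T ⟶ natObj W (S.comp V (corep X))}
    (h : ∀ d, f ▷ W.obj d ≫ coneEval W S X d = g ▷ W.obj d ≫ coneEval W S X d) : f = g :=
  weightEval_ext h

/-- The map `M L ⟶ [D, V](W, M S-)` induced by `η : W ⟶ C(L, S-)`. -/
def weightComparison (M : Weight V C) {L : C}
    (η : VNatTrans W (S.comp V (corep L))) : M.obj L ⟶ natObj W (S.comp V M) :=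
  weightCurry (fun d => M.obj L ◁ coneHom η d ≫ act M L (S.obj d)) fun x y => by
    simp only [← MonoidalCategory.whiskerLeft_comp_assoc, act_coneHom]
    simp only [MonoidalCategory.whiskerLeft_comp, Category.assoc, act_comp,
      associator_inv_naturality_right_assoc, whisker_exchange_assoc]
    simp

@[simp]
lemma weightComparison_eval (M : Weight V C) {L : C}
    (η : VNatTrans W (S.comp V (corep L))) (d : D) :
    weightComparison M η ▷ W.obj d ≫ weightEval W S M d =
      M.obj L ◁ coneHom η d ≫ act M L (S.obj d) :=
  weightCurry_eval _ _ _

@[simp]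
lemma comparison_eval {L : C} (η : VNatTrans W (S.comp V (corep L))) (X : C) (d : D) :
    comparison η X ▷ W.obj d ≫ coneEval W S X d =
      (EnrichedCategory.Hom X L : V) ◁ coneHom η d ≫ eComp V X L (S.obj d) := by
  have h : comparison η X ≫ natObjπ W (S.comp V (corep X)) d = comparisonApp η X d :=
    natObjLift_π _ _ _ _ _
  refine (whiskerRight_natObjEval _ d).trans ?_
  rw [h]
  refine (congrArg _ (MonoidalClosed.uncurry_curry _)).trans ?_
  exact SymmetricCategory.symmetry_assoc _ _ _

end WeightEval

end Modules

/-! ### Shrinkable morphisms of `V` -/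

section Shrinkable

variable {V : Type u} [Category.{v} V] [MonoidalCategory V] [SymmetricCategory V]
  [MonoidalClosed V] [ModelCategory V]

lemma shrinkable_iff {A B : V} (f : A ⟶ B) :
    Shrinkable V f ↔ ∃ s : B ⟶ A, s ≫ f = 𝟙 B ∧
      ∃ (J : Interval V) (H : J.J ⊗ A ⟶ A),
        J.d ▷ A ≫ H = (λ_ A).hom ≫ f ≫ s ∧ J.c ▷ A ≫ H = (λ_ A).hom ∧
          H ≫ f = J.e ▷ A ≫ (λ_ A).hom ≫ f := by
  have hom_eq {X Y : V} (g : X ⟶ Y) :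
      eHomEquiv V g = MonoidalClosed.curry ((ρ_ X).hom ≫ g) := rfl
  refine exists_congr fun s => and_congr_right fun _ => exists_congr fun J => ?_
  constructor
  · rintro ⟨h, hd, hc, he⟩
    refine ⟨(β_ _ _).hom ≫ MonoidalClosed.uncurry h, ?_, ?_, ?_⟩
    · rw [BraidedCategory.braiding_naturality_left_assoc, ← MonoidalClosed.uncurry_natural_left,
        hd, hom_eq, MonoidalClosed.uncurry_curry]
      simp
    · rw [BraidedCategory.braiding_naturality_left_assoc, ← MonoidalClosed.uncurry_natural_left,
        hc, hom_eq, MonoidalClosed.uncurry_curry]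
      simp
    · rw [MonoidalClosed.enrichedOrdinaryCategorySelf_eHomWhiskerLeft] at he
      rw [Category.assoc, ← MonoidalClosed.uncurry_natural_right, he,
        MonoidalClosed.uncurry_natural_left, hom_eq, MonoidalClosed.uncurry_curry,
        ← BraidedCategory.braiding_naturality_left_assoc]
      simp
  · rintro ⟨H, hd, hc, he⟩
    refine ⟨MonoidalClosed.curry ((β_ _ _).hom ≫ H), ?_, ?_, ?_⟩
    · rw [← MonoidalClosed.curry_natural_left, BraidedCategory.braiding_naturality_right_assoc,
        hd, hom_eq]
      simp
    · rw [← MonoidalClosed.curry_natural_left, BraidedCategory.braiding_naturality_right_assoc,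
        hc, hom_eq]
      simp
    · rw [MonoidalClosed.enrichedOrdinaryCategorySelf_eHomWhiskerLeft,
        ← MonoidalClosed.curry_natural_right, Category.assoc, he, hom_eq,
        ← MonoidalClosed.curry_natural_left, ← BraidedCategory.braiding_naturality_right_assoc]
      simp

lemma Shrinkable.of_retract {A B A' B' : V} {f : A ⟶ B} {f' : A' ⟶ B'} (hf' : Shrinkable V f')
    (i : A ⟶ A') (r : A' ⟶ A) (i' : B ⟶ B') (r' : B' ⟶ B) (hi : i ≫ f' = f ≫ i')
    (hr : r ≫ f = f' ≫ r') (hir : i ≫ r = 𝟙 A) (hir' : i' ≫ r' = 𝟙 B) : Shrinkable V f := by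
  rw [shrinkable_iff] at hf' ⊢
  obtain ⟨s, hs, J, H, hd, hc, he⟩ := hf'
  refine ⟨i' ≫ s ≫ r, ?_, J, J.J ◁ i ≫ H ≫ r, ?_, ?_, ?_⟩
  · simp only [Category.assoc, hr, reassoc_of% hs, hir']
  · rw [← whisker_exchange_assoc, reassoc_of% hd, id_whiskerLeft_assoc]
    simp [reassoc_of% hi]
  · rw [← whisker_exchange_assoc, reassoc_of% hc, id_whiskerLeft_assoc]
    simp [hir]
  · simp only [Category.assoc, hr, reassoc_of% he]
    rw [whisker_exchange_assoc, id_whiskerLeft_assoc]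
    simp [reassoc_of% hi, hir']

end Shrinkable

/-! ### Weighted limits and the category of weights -/

section Comparison

variable {V : Type u} [Category.{v} V] [MonoidalCategory V] [SymmetricCategory V]
  [MonoidalClosed V] [HasLimits V] {D : Type v} [EnrichedCategory V D]
  {C : Type u₁} [EnrichedCategory V C] {W : Weight V D} {S : EnrichedFunctor V D C}

/-- The point of `[D, V](W, C(X, S-))` given by a cone. -/
def conePoint {X : C} (η : VNatTrans W (S.comp V (corep X))) :
    𝟙_ V ⟶ natObj W (S.comp V (corep X)) := natObjPoint η

lemma conePoint_eval {X : C} (η : VNatTrans W (S.comp V (corep X))) (d : D) :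
    conePoint η ▷ W.obj d ≫ coneEval W S X d = (λ_ _).hom ≫ coneHom η d :=
  natObjPoint_eval _ _

lemma conePoint_surjective {X : C} :
    Function.Surjective (conePoint : VNatTrans W (S.comp V (corep X)) → _) := fun x =>
  ⟨natTransOfPoint x, natObj_ext fun d => by
    rw [conePoint, natObjPoint_eval, natTransOfPoint_app, Iso.hom_inv_id_assoc]⟩

lemma comp_comparison_eval {X Y : C} (η : VNatTrans W (S.comp V (corep Y)))
    (g : 𝟙_ V ⟶ (EnrichedCategory.Hom X Y : V)) (d : D) :
    (g ≫ comparison η X) ▷ W.obj d ≫ coneEval W S X d =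
      (λ_ _).hom ≫ coneHom η d ≫ precomp g (S.obj d) := by
  rw [comp_whiskerRight, Category.assoc, comparison_eval, ← whisker_exchange_assoc,
    id_whiskerLeft_assoc]
  simp [precomp]

lemma comp_comparison_eq_conePoint_iff {X Y : C} {η : VNatTrans W (S.comp V (corep X))}
    {η' : VNatTrans W (S.comp V (corep Y))} {g : 𝟙_ V ⟶ (EnrichedCategory.Hom X Y : V)} :
    g ≫ comparison η' X = conePoint η ↔
      ∀ d, coneHom η' d ≫ precomp g (S.obj d) = coneHom η d := by
  refine ⟨fun h d => ?_, fun h => coneEval_ext fun d => ?_⟩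
  · rw [← cancel_epi (λ_ (W.obj d)).hom, ← comp_comparison_eval, h, conePoint_eval]
  · rw [comp_comparison_eval, h, conePoint_eval]

lemma eId_comparison {X : C} (η : VNatTrans W (S.comp V (corep X))) :
    eId V X ≫ comparison η X = conePoint η :=
  comp_comparison_eq_conePoint_iff.2 fun d => by rw [precomp_id, Category.comp_id]

lemma IsWeightedLimit.exists_retract {X Y : C} {η : VNatTrans W (S.comp V (corep X))}
    {η' : VNatTrans W (S.comp V (corep Y))} (hη : IsWeightedLimit η) (hη' : IsWeightedLimit η') :
    ∃ (i : 𝟙_ V ⟶ (EnrichedCategory.Hom X Y : V)) (r : 𝟙_ V ⟶ (EnrichedCategory.Hom Y X : V)),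
      r ≫ precomp i X = eId V X := by
  have := hη X
  have := hη Y
  have := hη' X
  have hi := comp_comparison_eq_conePoint_iff.1
    (show (conePoint η ≫ inv (comparison η' X)) ≫ comparison η' X = conePoint η by simp)
  have hr := comp_comparison_eq_conePoint_iff.1
    (show (conePoint η' ≫ inv (comparison η Y)) ≫ comparison η Y = conePoint η' by simp)
  refine ⟨conePoint η ≫ inv (comparison η' X), conePoint η' ≫ inv (comparison η Y), ?_⟩
  rw [← cancel_mono (comparison η X), eId_comparison, comp_comparison_eq_conePoint_iff]
  intro d
  rw [← precomp_precomp, ← Category.assoc, hr, hi]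

/-- The whiskering of a `V`-natural transformation between weights on `C` with a `V`-functor
`D → C`. -/
def VNatTrans.whiskerLeft (S : EnrichedFunctor V D C) {M N : Weight V C} (p : VNatTrans M N) :
    VNatTrans (S.comp V M) (S.comp V N) :=
  VNatTrans.ofAct (fun d => p.app (S.obj d)) fun x y => by
    have condition : (M.obj (S.obj x) ◁ S.map x y ≫ act M _ _) ≫ p.app (S.obj y) =
        p.app (S.obj x) ▷ _ ≫ N.obj (S.obj x) ◁ S.map x y ≫ act N _ _ := by
      rw [Category.assoc, p.act_app, whisker_exchange_assoc]
    rw [act_functorComp, act_functorComp]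
    exact condition

variable (W S)

@[simp]
lemma natObjMap_whiskerLeft_eval {M N : Weight V C} (p : VNatTrans M N) (d : D) :
    natObjMap W (p.whiskerLeft S) ▷ W.obj d ≫ weightEval W S N d =
      weightEval W S M d ≫ p.app (S.obj d) :=
  natObjMap_eval W (p.whiskerLeft S) d

/-- The map `M X ⊗ [D, V](W, C(X, S-)) ⟶ [D, V](W, M S-)` by which a weight `M` acts on cones. -/
def weightTransport (M : Weight V C) (X : C) :
    M.obj X ⊗ natObj W (S.comp V (corep X)) ⟶ natObj W (S.comp V M) :=
  weightCurry (fun d => (α_ _ _ _).hom ≫ M.obj X ◁ coneEval W S X d ≫ act M X (S.obj d))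
    fun x y => by
      simp only [comp_whiskerRight, Category.assoc]
      rw [associator_naturality_right_assoc, ← MonoidalCategory.whiskerLeft_comp_assoc,
        coneEval_act]
      simp only [MonoidalCategory.whiskerLeft_comp, Category.assoc, act_comp,
        whisker_exchange_assoc, associator_inv_naturality_right_assoc]
      simp

variable {W S}

@[simp]
lemma weightTransport_eval (M : Weight V C) (X : C) (d : D) :
    weightTransport W S M X ▷ W.obj d ≫ weightEval W S M d =
      (α_ _ _ _).hom ≫ M.obj X ◁ coneEval W S X d ≫ act M X (S.obj d) :=
  weightCurry_eval _ _ _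

lemma whiskerLeft_comparison_weightTransport (M : Weight V C) {L : C}
    (η : VNatTrans W (S.comp V (corep L))) (X : C) :
    M.obj X ◁ comparison η X ≫ weightTransport W S M X = act M X L ≫ weightComparison M η := by
  refine weightEval_ext fun d => ?_
  simp only [comp_whiskerRight, Category.assoc, weightTransport_eval, weightComparison_eval]
  rw [associator_naturality_middle_assoc, ← MonoidalCategory.whiskerLeft_comp_assoc,
    comparison_eval, MonoidalCategory.whiskerLeft_comp_assoc, act_comp, ← whisker_exchange_assoc]
  simp

lemma weightTransport_natObjMap {M N : Weight V C} (p : VNatTrans M N) (X : C) :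
    weightTransport W S M X ≫ natObjMap W (p.whiskerLeft S) =
      p.app X ▷ _ ≫ weightTransport W S N X := by
  refine weightEval_ext fun d => ?_
  simp only [comp_whiskerRight, Category.assoc, natObjMap_whiskerLeft_eval, weightTransport_eval]
  rw [reassoc_of% weightTransport_eval, p.act_app, whisker_exchange_assoc]
  simp

omit [HasLimits V] in
lemma whiskerLeft_act_comp_of_act_eq (M : Weight V C) {L : C}
    {π : ∀ d, W.obj d ⟶ (EnrichedCategory.Hom L (S.obj d) : V)}
    (φ : ∀ d, M.obj L ⊗ W.obj d ⟶ M.obj (S.obj d))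
    (hπ : ∀ d, M.obj L ◁ π d ≫ act M L (S.obj d) = φ d)
    (hφ : ∀ x y, M.obj L ◁ act W x y ≫ φ y =
      (α_ _ _ _).inv ≫ φ x ▷ _ ≫ _ ◁ S.map x y ≫ act M (S.obj x) (S.obj y)) (x y : D) :
    M.obj L ◁ (act W x y ≫ π y) ≫ act M L (S.obj y) =
      M.obj L ◁ (π x ▷ _ ≫ _ ◁ S.map x y ≫ eComp V L (S.obj x) (S.obj y)) ≫
        act M L (S.obj y) := by
  simp only [MonoidalCategory.whiskerLeft_comp, Category.assoc, act_comp, hπ, hφ]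
  rw [associator_inv_naturality_right_assoc, whisker_exchange_assoc,
    associator_inv_naturality_middle_assoc, ← comp_whiskerRight_assoc, hπ]

end Comparison

/-! ### Weighted limits in the `V`-category of arrows -/

section ArrowWeights

variable {V : Type u} [Category.{v} V] [MonoidalCategory V] [MonoidalClosed V] [HasPullbacks V]

/-- The `V`-functor `V^𝟚 → V` sending an arrow to its domain. -/
def arrowDom : Weight V (Arrow V) where
  obj f := f.left
  map f g := arrowHomLeft V f g
  map_id f := arrowId_left V f
  map_comp f g h := arrowComp_left V f g h

/-- The `V`-functor `V^𝟚 → V` sending an arrow to its codomain. -/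
def arrowCod : Weight V (Arrow V) where
  obj f := f.right
  map f g := arrowHomRight V f g
  map_id f := arrowId_right V f
  map_comp f g h := arrowComp_right V f g h

/-- The `V`-natural transformation from domains to codomains whose component at an arrow is the
arrow itself. -/
def arrowTrans : VNatTrans (arrowDom (V := V)) arrowCod where
  app f := f.hom
  naturality f g := arrowHom_condition V f g

/-- The map `T ⟶ V^𝟚(X, Y)` induced by compatible maps `X ⊗ T ⟶ Y` on domains and codomains. -/
def arrowCurry {X Y : Arrow V} {T : V} (l : arrowDom.obj X ⊗ T ⟶ arrowDom.obj Y)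
    (r : arrowCod.obj X ⊗ T ⟶ arrowCod.obj Y)
    (h : l ≫ arrowTrans.app Y = arrowTrans.app X ▷ T ≫ r) :
    T ⟶ (EnrichedCategory.Hom X Y : V) :=
  arrowHomLift V (MonoidalClosed.curry l) (MonoidalClosed.curry r) (by
    apply MonoidalClosed.uncurry_injective
    rw [MonoidalClosed.enrichedOrdinaryCategorySelf_eHomWhiskerLeft,
      MonoidalClosed.enrichedOrdinaryCategorySelf_eHomWhiskerRight,
      MonoidalClosed.uncurry_natural_right, MonoidalClosed.uncurry_pre_app]
    exact (congrArg (· ≫ Y.hom) (MonoidalClosed.uncurry_curry (A := X.left) l)).trans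
      (h.trans (congrArg _ (MonoidalClosed.uncurry_curry (A := X.right) r).symm)))

section

variable {X Y : Arrow V} {T : V} (l : arrowDom.obj X ⊗ T ⟶ arrowDom.obj Y)
  (r : arrowCod.obj X ⊗ T ⟶ arrowCod.obj Y) (h : l ≫ arrowTrans.app Y = arrowTrans.app X ▷ T ≫ r)

@[simp]
lemma whiskerLeft_arrowCurry_act_dom :
    arrowDom.obj X ◁ arrowCurry l r h ≫ act arrowDom X Y = l := by
  refine (MonoidalClosed.uncurry_natural_left _ _).symm.trans ?_
  exact (congrArg _ (arrowHomLift_left V _ _ _)).trans (MonoidalClosed.uncurry_curry l)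

@[simp]
lemma whiskerLeft_arrowCurry_act_cod :
    arrowCod.obj X ◁ arrowCurry l r h ≫ act arrowCod X Y = r := by
  refine (MonoidalClosed.uncurry_natural_left _ _).symm.trans ?_
  exact (congrArg _ (arrowHomLift_right V _ _ _)).trans (MonoidalClosed.uncurry_curry r)

end

lemma arrow_act_ext {X Y : Arrow V} {T : V} {f g : T ⟶ (EnrichedCategory.Hom X Y : V)}
    (hdom : arrowDom.obj X ◁ f ≫ act arrowDom X Y = arrowDom.obj X ◁ g ≫ act arrowDom X Y)
    (hcod : arrowCod.obj X ◁ f ≫ act arrowCod X Y = arrowCod.obj X ◁ g ≫ act arrowCod X Y) :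
    f = g := by
  simp only [act, ← MonoidalClosed.uncurry_natural_left] at hdom hcod
  exact arrowHom_ext V (MonoidalClosed.uncurry_injective hdom)
    (MonoidalClosed.uncurry_injective hcod)

end ArrowWeights

section ArrowLimits

variable {V : Type u} [Category.{v} V] [MonoidalCategory V] [SymmetricCategory V]
  [MonoidalClosed V] [HasLimits V] {D : Type v} [EnrichedCategory V D]
  (W : Weight V D) (S : EnrichedFunctor V D (Arrow V))

/-- The pointwise limit of a diagram of arrows. -/
def arrowLimit : Arrow V := Arrow.mk (natObjMap W (arrowTrans.whiskerLeft S))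

/-- The projections from the pointwise limit of a diagram of arrows. -/
def arrowLimitπ (d : D) : W.obj d ⟶ (EnrichedCategory.Hom (arrowLimit W S) (S.obj d) : V) :=
  arrowCurry (X := arrowLimit W S) (weightEval W S arrowDom d) (weightEval W S arrowCod d)
    (natObjMap_whiskerLeft_eval W S arrowTrans d).symm

lemma whiskerLeft_arrowLimitπ_act_dom (d : D) :
    arrowDom.obj (arrowLimit W S) ◁ arrowLimitπ W S d ≫ act arrowDom _ (S.obj d) =
      weightEval W S arrowDom d :=
  whiskerLeft_arrowCurry_act_dom _ _ (natObjMap_whiskerLeft_eval W S arrowTrans d).symm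

lemma whiskerLeft_arrowLimitπ_act_cod (d : D) :
    arrowCod.obj (arrowLimit W S) ◁ arrowLimitπ W S d ≫ act arrowCod _ (S.obj d) =
      weightEval W S arrowCod d :=
  whiskerLeft_arrowCurry_act_cod _ _ (natObjMap_whiskerLeft_eval W S arrowTrans d).symm

/-- The limit cone on the pointwise limit of a diagram of arrows. -/
def arrowLimitCone : VNatTrans W (S.comp V (corep (arrowLimit W S))) :=
  coneOf (arrowLimitπ W S) fun x y => arrow_act_ext
    (whiskerLeft_act_comp_of_act_eq arrowDom (weightEval W S arrowDom)
      (whiskerLeft_arrowLimitπ_act_dom W S) (weightEval_act W S arrowDom) x y)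
    (whiskerLeft_act_comp_of_act_eq arrowCod (weightEval W S arrowCod)
      (whiskerLeft_arrowLimitπ_act_cod W S) (weightEval_act W S arrowCod) x y)

lemma weightComparison_dom_arrowLimitCone :
    weightComparison arrowDom (arrowLimitCone W S) = 𝟙 _ :=
  weightEval_ext fun d => ((weightComparison_eval _ _ d).trans
    (whiskerLeft_arrowLimitπ_act_dom W S d)).trans
      ((Category.id_comp _).symm.trans
        (congrArg (· ≫ weightEval W S arrowDom d) (id_whiskerRight _ _).symm))

lemma weightComparison_cod_arrowLimitCone :
    weightComparison arrowCod (arrowLimitCone W S) = 𝟙 _ :=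
  weightEval_ext fun d => ((weightComparison_eval _ _ d).trans
    (whiskerLeft_arrowLimitπ_act_cod W S d)).trans
      ((Category.id_comp _).symm.trans
        (congrArg (· ≫ weightEval W S arrowCod d) (id_whiskerRight _ _).symm))

lemma whiskerLeft_comparison_arrowLimitCone_dom (X : Arrow V) :
    arrowDom.obj X ◁ comparison (arrowLimitCone W S) X ≫ weightTransport W S arrowDom X =
      act arrowDom X (arrowLimit W S) := by
  rw [whiskerLeft_comparison_weightTransport, weightComparison_dom_arrowLimitCone]
  exact Category.comp_id _

lemma whiskerLeft_comparison_arrowLimitCone_cod (X : Arrow V) :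
    arrowCod.obj X ◁ comparison (arrowLimitCone W S) X ≫ weightTransport W S arrowCod X =
      act arrowCod X (arrowLimit W S) := by
  rw [whiskerLeft_comparison_weightTransport, weightComparison_cod_arrowLimitCone]
  exact Category.comp_id _

variable {W S}

lemma weightTransport_ext {X : Arrow V} {T : V} {f g : T ⟶ natObj W (S.comp V (corep X))}
    (hdom : arrowDom.obj X ◁ f ≫ weightTransport W S arrowDom X =
      arrowDom.obj X ◁ g ≫ weightTransport W S arrowDom X)
    (hcod : arrowCod.obj X ◁ f ≫ weightTransport W S arrowCod X =
      arrowCod.obj X ◁ g ≫ weightTransport W S arrowCod X) : f = g := by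
  have eval_eq (M : Weight V (Arrow V)) (f : T ⟶ natObj W (S.comp V (corep X))) (d : D) :
      M.obj X ◁ (f ▷ W.obj d ≫ coneEval W S X d) ≫ act M X (S.obj d) =
        (α_ _ _ _).inv ≫ (M.obj X ◁ f ≫ weightTransport W S M X) ▷ W.obj d ≫
          weightEval W S M d := by
    simp
  refine coneEval_ext fun d => arrow_act_ext ?_ ?_
  · rw [eval_eq, eval_eq, hdom]
  · rw [eval_eq, eval_eq, hcod]

variable (W S)

lemma isWeightedLimit_arrowLimitCone : IsWeightedLimit (arrowLimitCone W S) := by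
  intro X
  have condition := weightTransport_natObjMap (W := W) (S := S) arrowTrans X
  let inverse : natObj W (S.comp V (corep X)) ⟶
      (EnrichedCategory.Hom X (arrowLimit W S) : V) :=
    arrowCurry (weightTransport W S arrowDom X) (weightTransport W S arrowCod X) condition
  have inverse_dom : arrowDom.obj X ◁ inverse ≫ act arrowDom X (arrowLimit W S) = _ :=
    whiskerLeft_arrowCurry_act_dom _ _ condition
  have inverse_cod : arrowCod.obj X ◁ inverse ≫ act arrowCod X (arrowLimit W S) = _ :=
    whiskerLeft_arrowCurry_act_cod _ _ condition
  refine ⟨inverse, arrow_act_ext ?_ ?_, weightTransport_ext ?_ ?_⟩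
  · rw [MonoidalCategory.whiskerLeft_comp, Category.assoc, inverse_dom]
    refine (whiskerLeft_comparison_arrowLimitCone_dom W S X).trans ?_
    rw [MonoidalCategory.whiskerLeft_id]
    exact (Category.id_comp _).symm
  · rw [MonoidalCategory.whiskerLeft_comp, Category.assoc, inverse_cod]
    refine (whiskerLeft_comparison_arrowLimitCone_cod W S X).trans ?_
    rw [MonoidalCategory.whiskerLeft_id]
    exact (Category.id_comp _).symm
  · rw [MonoidalCategory.whiskerLeft_comp, Category.assoc]
    refine ((congrArg _ (whiskerLeft_comparison_arrowLimitCone_dom W S X)).trans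
      inverse_dom).trans ?_
    rw [MonoidalCategory.whiskerLeft_id]
    exact (Category.id_comp _).symm
  · rw [MonoidalCategory.whiskerLeft_comp, Category.assoc]
    refine ((congrArg _ (whiskerLeft_comparison_arrowLimitCone_cod W S X)).trans
      inverse_cod).trans ?_
    rw [MonoidalCategory.whiskerLeft_id]
    exact (Category.id_comp _).symm

/-- Limits of arrows are pointwise and unique up to isomorphism, and shrinkable morphisms are
closed under retracts, so only the pointwise limits matter. -/
lemma isEStable_iff [ModelCategory V] : IsEStable W ↔
    ∀ S : EnrichedFunctor V D (Arrow V), (∀ d, Shrinkable V (S.obj d).hom) →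
      Shrinkable V (natObjMap W (arrowTrans.whiskerLeft S)) := by
  refine ⟨fun h S hS => h S hS _ _ (isWeightedLimit_arrowLimitCone W S),
    fun h S hS L η hη => ?_⟩
  obtain ⟨i, r, hir⟩ := hη.exists_retract (isWeightedLimit_arrowLimitCone W S)
  have retract (M : Weight V (Arrow V)) : mapPoint M i ≫ mapPoint M r = 𝟙 _ := by
    rw [← mapPoint_comp, hir, mapPoint_eId]
  exact (h S hS).of_retract (mapPoint arrowDom i) (mapPoint arrowDom r) (mapPoint arrowCod i)
    (mapPoint arrowCod r) (arrowTrans.mapPoint_app i) (arrowTrans.mapPoint_app r)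
    (retract _) (retract _)

end ArrowLimits

section ArrowFunctor

variable {V : Type u} [Category.{v} V] [MonoidalCategory V] [SymmetricCategory V]
  [MonoidalClosed V]

omit [SymmetricCategory V] in
lemma whiskerLeft_eId_comp_act_of_act_eq {D : Type u₁} [EnrichedCategory V D] {C : Type u₂}
    [EnrichedCategory V C] (M : Weight V C) {x : D} {X : C}
    {m : (EnrichedCategory.Hom x x : V) ⟶ EnrichedCategory.Hom X X}
    {φ : M.obj X ⊗ (EnrichedCategory.Hom x x : V) ⟶ M.obj X}
    (hm : M.obj X ◁ m ≫ act M X X = φ) (hφ : M.obj X ◁ eId V x ≫ φ = (ρ_ _).hom) :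
    M.obj X ◁ (eId V x ≫ m) ≫ act M X X = M.obj X ◁ eId V X ≫ act M X X := by
  rw [MonoidalCategory.whiskerLeft_comp, Category.assoc, hm, hφ, act_id]

lemma whiskerLeft_comp_act_of_act_eq {D : Type u₁} [EnrichedCategory V D] {C : Type u₂}
    [EnrichedCategory V C] (M : Weight V C) {A : D → C}
    {m : ∀ x y, (EnrichedCategory.Hom x y : V) ⟶ EnrichedCategory.Hom (A x) (A y)}
    (φ : ∀ x y, M.obj (A x) ⊗ (EnrichedCategory.Hom x y : V) ⟶ M.obj (A y))
    (hm : ∀ x y, M.obj (A x) ◁ m x y ≫ act M (A x) (A y) = φ x y) {x y z : D}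
    (hφ : M.obj (A x) ◁ eComp V x y z ≫ φ x z = (α_ _ _ _).inv ≫ φ x y ▷ _ ≫ φ y z) :
    M.obj (A x) ◁ (eComp V x y z ≫ m x z) ≫ act M (A x) (A z) =
      M.obj (A x) ◁ ((m x y ⊗ₘ m y z) ≫ eComp V (A x) (A y) (A z)) ≫ act M (A x) (A z) := by
  simp only [MonoidalCategory.whiskerLeft_comp, Category.assoc, act_comp, hm, hφ,
    MonoidalCategory.tensorHom_def]
  rw [associator_inv_naturality_right_assoc, whisker_exchange_assoc,
    associator_inv_naturality_middle_assoc, ← comp_whiskerRight_assoc, hm, hm]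

/-- The `V`-functor to the `V`-category of arrows given by a `V`-natural transformation. -/
def arrowFunctor [HasPullbacks V] {D : Type u₁} [EnrichedCategory V D] {F G : Weight V D}
    (p : VNatTrans F G) : EnrichedFunctor V D (Arrow V) where
  obj x := Arrow.mk (p.app x)
  map x y := arrowCurry (X := Arrow.mk (p.app x)) (Y := Arrow.mk (p.app y))
    (act F x y) (act G x y) (p.act_app x y)
  map_id x := arrow_act_ext
    (whiskerLeft_eId_comp_act_of_act_eq arrowDom
      (whiskerLeft_arrowCurry_act_dom _ _ (p.act_app x x)) (act_id F x))
    (whiskerLeft_eId_comp_act_of_act_eq arrowCod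
      (whiskerLeft_arrowCurry_act_cod _ _ (p.act_app x x)) (act_id G x))
  map_comp x y z := arrow_act_ext
    (whiskerLeft_comp_act_of_act_eq arrowDom (A := fun x => Arrow.mk (p.app x)) (act F)
      (fun x y => whiskerLeft_arrowCurry_act_dom _ _ (p.act_app x y)) (act_comp F x y z))
    (whiskerLeft_comp_act_of_act_eq arrowCod (A := fun x => Arrow.mk (p.app x)) (act G)
      (fun x y => whiskerLeft_arrowCurry_act_cod _ _ (p.act_app x y)) (act_comp G x y z))

lemma act_arrowFunctor_dom [HasPullbacks V] {D : Type u₁} [EnrichedCategory V D]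
    {F G : Weight V D} (p : VNatTrans F G) (x y : D) :
    act ((arrowFunctor p).comp V arrowDom) x y = act F x y := by
  rw [act_functorComp]
  exact whiskerLeft_arrowCurry_act_dom _ _ (p.act_app x y)

lemma act_arrowFunctor_cod [HasPullbacks V] {D : Type u₁} [EnrichedCategory V D]
    {F G : Weight V D} (p : VNatTrans F G) (x y : D) :
    act ((arrowFunctor p).comp V arrowCod) x y = act G x y := by
  rw [act_functorComp]
  exact whiskerLeft_arrowCurry_act_cod _ _ (p.act_app x y)

lemma Shrinkable.natObjMap_of_retract [HasLimits V] [ModelCategory V] {D : Type v}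
    [EnrichedCategory V D] {W F G F' G' : Weight V D} {p : VNatTrans F G} {p' : VNatTrans F' G'}
    (hp' : Shrinkable V (natObjMap W p')) (i : VNatTrans F F') (r : VNatTrans F' F)
    (i' : VNatTrans G G') (r' : VNatTrans G' G)
    (hi : ∀ d, i.app d ≫ p'.app d = p.app d ≫ i'.app d)
    (hr : ∀ d, r.app d ≫ p.app d = p'.app d ≫ r'.app d)
    (hir : ∀ d, i.app d ≫ r.app d = 𝟙 _) (hir' : ∀ d, i'.app d ≫ r'.app d = 𝟙 _) :
    Shrinkable V (natObjMap W p) :=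
  hp'.of_retract (natObjMap W i) (natObjMap W r) (natObjMap W i') (natObjMap W r')
    (natObj_ext fun d => by simp [reassoc_of% natObjMap_eval, hi])
    (natObj_ext fun d => by simp [reassoc_of% natObjMap_eval, hr])
    (natObj_ext fun d => by simp [reassoc_of% natObjMap_eval, hir])
    (natObj_ext fun d => by simp [reassoc_of% natObjMap_eval, hir'])

lemma IsEStable.shrinkable_natObjMap [HasLimits V] [ModelCategory V] {D : Type v}
    [EnrichedCategory V D] {W F G : Weight V D} (hW : IsEStable W) (p : VNatTrans F G)
    (hp : ∀ d, Shrinkable V (p.app d)) : Shrinkable V (natObjMap W p) := by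
  have comp_id_eq {A B X : V} (f : A ⊗ X ⟶ B) : f ≫ 𝟙 B = 𝟙 A ▷ X ≫ f := by simp
  -- `arrowFunctor p` restricts to `F` and `G` only up to transformations with identity components
  let toDom : VNatTrans F ((arrowFunctor p).comp V arrowDom) :=
    .ofAct (fun d => 𝟙 (F.obj d)) fun x y =>
      (comp_id_eq _).trans (congrArg (_ ≫ ·) (act_arrowFunctor_dom p x y).symm)
  let ofDom : VNatTrans ((arrowFunctor p).comp V arrowDom) F :=
    .ofAct (fun d => 𝟙 (F.obj d)) fun x y =>
      (congrArg (· ≫ _) (act_arrowFunctor_dom p x y)).trans (comp_id_eq _)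
  let toCod : VNatTrans G ((arrowFunctor p).comp V arrowCod) :=
    .ofAct (fun d => 𝟙 (G.obj d)) fun x y =>
      (comp_id_eq _).trans (congrArg (_ ≫ ·) (act_arrowFunctor_cod p x y).symm)
  let ofCod : VNatTrans ((arrowFunctor p).comp V arrowCod) G :=
    .ofAct (fun d => 𝟙 (G.obj d)) fun x y =>
      (congrArg (· ≫ _) (act_arrowFunctor_cod p x y)).trans (comp_id_eq _)
  exact ((isEStable_iff W).1 hW (arrowFunctor p) hp).natObjMap_of_retract toDom ofDom toCod ofCod
    (fun d => (Category.id_comp _).trans (Category.comp_id _).symm)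
    (fun d => (Category.id_comp _).trans (Category.comp_id _).symm)
    (fun d => Category.comp_id _) (fun d => Category.comp_id _)

end ArrowFunctor

/-! ### Powers as weighted limits -/

/-- The object type of the unit `V`-category, in the universe of the domains of weights. -/
def PointCat (V : Type u) [Category.{v} V] : Type v := PUnit

section Powers

variable {V : Type u} [Category.{v} V] [MonoidalCategory V]

instance pointCatEnriched : EnrichedCategory V (PointCat V) where
  Hom _ _ := 𝟙_ V
  id _ := 𝟙 _
  comp _ _ _ := (λ_ (𝟙_ V)).hom
  id_comp _ _ := by simp
  comp_id _ _ := by simp [unitors_equal]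
  assoc _ _ _ _ := by simp [unitors_equal]

variable (V) in
/-- The object of the small unit `V`-category. -/
def pointCatStar : PointCat V := PUnit.unit

variable [SymmetricCategory V] [MonoidalClosed V]

omit [SymmetricCategory V] in
lemma act_pointCat (F : Weight V (PointCat V)) (x y : PointCat V) :
    act F x y = (ρ_ (F.obj x)).hom := by
  have eId_eq : F.obj x ◁ eId V x = 𝟙 (F.obj x ⊗ 𝟙_ V) := MonoidalCategory.whiskerLeft_id _ _
  exact (Category.id_comp _).symm.trans
    ((congrArg (fun a => a ≫ act F x x) eId_eq).symm.trans (act_id F x))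

/-- The `V`-functor on the unit `V`-category selecting an object. For an object `X` of `V` it is the
weight whose weighted limits are powers by `X`. -/
def pointFunctor {C : Type u₁} [EnrichedCategory V C] (c : C) :
    EnrichedFunctor V (PointCat V) C where
  obj _ := c
  map _ _ := eId V c
  map_id _ := Category.id_comp _
  map_comp _ _ _ := by
    change (λ_ (𝟙_ V)).hom ≫ eId V c =
      ((eId V c ⊗ₘ eId V c) : 𝟙_ V ⊗ 𝟙_ V ⟶ _) ≫ eComp V c c c
    rw [← Iso.eq_inv_comp, MonoidalCategory.tensorHom_def', Category.assoc,
      ← leftUnitor_inv_naturality_assoc, e_id_comp, Category.comp_id]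

variable [HasLimits V]

omit [SymmetricCategory V] [HasLimits V] in
lemma pointCat_compatible (F G : Weight V (PointCat V)) {T : V}
    (ψ : ∀ x, T ⊗ F.obj x ⟶ G.obj x) (x y : PointCat V) :
    T ◁ act F x y ≫ ψ y = (α_ _ _ _).inv ≫ ψ x ▷ _ ≫ act G x y := by
  rw [act_pointCat, act_pointCat]
  change T ◁ (ρ_ (F.obj x)).hom ≫ ψ x = (α_ T (F.obj x) (𝟙_ V)).inv ≫ ψ x ▷ 𝟙_ V ≫ _
  simp

instance isIso_natObjπ_pointCat (F G : Weight V (PointCat V)) (x : PointCat V) :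
    IsIso (natObjπ F G x) := by
  let g : (ihom (F.obj x)).obj (G.obj x) ⟶ natObj F G :=
    natObjCurry (fun y => (β_ _ _).hom ≫ (ihom.ev (F.obj x)).app (G.obj x))
      (pointCat_compatible F G _)
  have hg : g ≫ natObjπ F G x = 𝟙 ((ihom (F.obj x)).obj (G.obj x)) := by
    apply MonoidalClosed.uncurry_injective
    rw [← cancel_epi (β_ _ _).hom, ← whiskerRight_natObjEval]
    refine (natObjCurry_eval _ _ x).trans (congrArg _ ?_)
    exact (MonoidalClosed.uncurry_id_eq_ev _ _).symm
  refine ⟨g, natObj_ext fun y => ?_, hg⟩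
  rw [whiskerRight_natObjEval, whiskerRight_natObjEval, Category.assoc]
  have comp_π : natObjπ F G x ≫ g ≫ natObjπ F G y = 𝟙 _ ≫ natObjπ F G y :=
    (congrArg (natObjπ F G x ≫ ·) hg).trans
      ((Category.comp_id _).trans (Category.id_comp _).symm)
  rw [comp_π]

omit [HasLimits V] in
lemma Shrinkable.ihom_map [ModelCategory V] {A B : V} {f : A ⟶ B} (hf : Shrinkable V f) (X : V) :
    Shrinkable V ((ihom X).map f) := by
  rw [shrinkable_iff] at hf ⊢
  obtain ⟨s, hs, J, H, hd, hc, he⟩ := hf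
  let swap (K Y : V) : X ⊗ K ⊗ Y ⟶ K ⊗ X ⊗ Y := (α_ _ _ _).inv ≫ (β_ X K).hom ▷ _ ≫ (α_ _ _ _).hom
  have swap_naturality {K K' : V} (i : K ⟶ K') (Y : V) :
      X ◁ i ▷ Y ≫ swap K' Y = swap K Y ≫ i ▷ (X ⊗ Y) := by
    simp only [swap]
    rw [associator_inv_naturality_middle_assoc, ← comp_whiskerRight_assoc,
      BraidedCategory.braiding_naturality_right]
    simp
  have swap_unit (Y : V) : swap (𝟙_ V) Y ≫ (λ_ _).hom = X ◁ (λ_ Y).hom := by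
    simp [swap, braiding_tensorUnit_right]
  let ev (Y : V) : X ⊗ (ihom X).obj Y ⟶ Y := (ihom.ev X).app Y
  have ev_naturality {Y Y' : V} (g : Y ⟶ Y') : X ◁ (ihom X).map g ≫ ev Y' = ev Y ≫ g :=
    (ihom.ev X).naturality g
  refine ⟨(ihom X).map s, by rw [← Functor.map_comp, hs]; exact (ihom X).map_id B, J,
    MonoidalClosed.curry (swap _ _ ≫ J.J ◁ ev A ≫ H), ?_, ?_, ?_⟩
  all_goals apply MonoidalClosed.uncurry_injective
  · rw [MonoidalClosed.uncurry_natural_left, MonoidalClosed.uncurry_curry,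
      reassoc_of% swap_naturality, ← whisker_exchange_assoc, hd, id_whiskerLeft_assoc]
    simp only [MonoidalClosed.uncurry_eq, whiskerLeft_comp, Category.assoc, Iso.inv_hom_id_assoc,
      reassoc_of% swap_unit]
    refine congrArg _ (((reassoc_of% (ev_naturality f)) s).symm.trans ?_)
    exact congrArg _ (ev_naturality s).symm
  · rw [MonoidalClosed.uncurry_natural_left, MonoidalClosed.uncurry_curry,
      reassoc_of% swap_naturality, ← whisker_exchange_assoc, hc, id_whiskerLeft_assoc]
    simp only [MonoidalClosed.uncurry_eq, reassoc_of% swap_unit, Iso.inv_hom_id, Category.comp_id]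
    rfl
  · rw [MonoidalClosed.uncurry_natural_right, MonoidalClosed.uncurry_curry]
    simp only [MonoidalClosed.uncurry_natural_left, Category.assoc]
    rw [he, whisker_exchange_assoc, ← reassoc_of% swap_naturality, id_whiskerLeft_assoc,
      Iso.inv_hom_id_assoc, reassoc_of% swap_unit, MonoidalClosed.uncurry_eq]
    exact congrArg _ (congrArg _ (ev_naturality f).symm)

lemma natObjMap_comp_natObjπ {D : Type v} [EnrichedCategory V D] (W : Weight V D)
    {F G : Weight V D} (p : VNatTrans F G) (x : D) :
    natObjMap W p ≫ natObjπ W G x = natObjπ W F x ≫ (ihom (W.obj x)).map (p.app x) := by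
  rw [natObjMap, natObjLift_π, MonoidalClosed.enrichedOrdinaryCategorySelf_eHomWhiskerLeft]

omit [HasLimits V] in
lemma Shrinkable.of_isIso [ModelCategory V] {A B A' B' : V} {f : A ⟶ B} {f' : A' ⟶ B'}
    (hf' : Shrinkable V f') (i : A ⟶ A') (i' : B ⟶ B') (hi : IsIso i) (hi' : IsIso i')
    (w : i ≫ f' = f ≫ i') : Shrinkable V f :=
  hf'.of_retract i (inv i) i' (inv i') w (by simp [← w]) (by simp) (by simp)

lemma isEStable_pointCat [ModelCategory V] (W : Weight V (PointCat V)) : IsEStable W := by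
  refine (isEStable_iff W).2 fun S hS => ?_
  let x := pointCatStar V
  exact ((hS x).ihom_map (W.obj x)).of_isIso (natObjπ W _ x) (natObjπ W _ x)
    (isIso_natObjπ_pointCat _ _ _) (isIso_natObjπ_pointCat _ _ _)
    (natObjMap_comp_natObjπ W (arrowTrans.whiskerLeft S) x).symm

variable {C : Type u₁} [EnrichedCategory V C]

/-- `κ : X ⟶ C(P, c)` exhibits `P` as the power of `c` by `X`. -/
def IsPower {X : V} {P c : C} (κ : X ⟶ (EnrichedCategory.Hom P c : V)) : Prop :=
  ∀ B : C, IsIso (MonoidalClosed.curry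
    ((β_ X (EnrichedCategory.Hom B P : V)).hom ≫
      (EnrichedCategory.Hom B P : V) ◁ κ ≫ eComp V B P c))

/-- The cone on a power. -/
def powerCone {X : V} {P c : C} (κ : X ⟶ (EnrichedCategory.Hom P c : V)) :
    VNatTrans (pointFunctor X) ((pointFunctor c).comp V (corep P)) :=
  coneOf (fun _ => κ) fun x y => by
    rw [act_pointCat]
    refine (rightUnitor_naturality κ).symm.trans (congrArg (κ ▷ 𝟙_ V ≫ ·) ?_)
    have comp_id := e_comp_id V P c
    rw [Iso.inv_comp_eq, Category.comp_id] at comp_id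
    exact comp_id.symm

lemma isPower_iff {X : V} {P c : C} (κ : X ⟶ (EnrichedCategory.Hom P c : V)) :
    IsPower κ ↔ IsWeightedLimit (powerCone κ) := by
  refine forall_congr' fun B => ?_
  have comparison_point : comparison (powerCone κ) B ≫ natObjπ _ _ (pointCatStar V) =
    MonoidalClosed.curry ((β_ X (EnrichedCategory.Hom B P : V)).hom ≫
      (EnrichedCategory.Hom B P : V) ◁ κ ≫ eComp V B P c) := natObjLift_π _ _ _ _ _
  rw [← comparison_point]
  have hπ := isIso_natObjπ_pointCat (pointFunctor X) ((pointFunctor c).comp V (corep B))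
    (pointCatStar V)
  exact ⟨fun hcomp => @IsIso.of_isIso_comp_right _ _ _ _ _ _ _ hπ hcomp,
    fun hη => @IsIso.comp_isIso _ _ _ _ _ _ _ hη hπ⟩

lemma hasPowers_of_hasEStableLimits [ModelCategory V] (h : HasEStableLimits V C) :
    HasPowers V C := by
  intro X c
  obtain ⟨P, η, hη⟩ := h (PointCat V) (pointFunctor X) (isEStable_pointCat _) (pointFunctor c)
  refine ⟨P, coneHom η (pointCatStar V), ?_⟩
  exact (isPower_iff _).2 hη

end Powers

/-! ### Fibrewise homotopies between points -/

section Homotopy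

variable {V : Type u} [Category.{v} V] [MonoidalCategory V] [ModelCategory V]

/-- Two points of `X` are homotopic over `p : X ⟶ Y` if some interval maps to `X` with these points
as end points, and constantly to `Y`. -/
def HomotopicOver {X Y : V} (p : X ⟶ Y) (a b : 𝟙_ V ⟶ X) : Prop :=
  ∃ (J : Interval V) (h : J.J ⟶ X), J.d ≫ h = a ∧ J.c ≫ h = b ∧ h ≫ p = J.e ≫ a ≫ p

lemma HomotopicOver.comp_eq {X Y : V} {p : X ⟶ Y} {a b : 𝟙_ V ⟶ X} (h : HomotopicOver p a b) :
    a ≫ p = b ≫ p := by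
  obtain ⟨J, h, -, hc, he⟩ := h
  have := J.c ≫= he
  rw [reassoc_of% hc, reassoc_of% J.c_e] at this
  exact this.symm

/-- The interval with its end points interchanged. -/
def Interval.swap (J : Interval V) : Interval V where
  J := J.J
  d := J.c
  c := J.d
  e := J.e
  d_e := J.c_e
  c_e := J.d_e
  cofibration := by
    have := J.cofibration
    have h : coprod.desc J.c J.d = (coprod.braiding _ _).hom ≫ coprod.desc J.d J.c := by
      ext
      · rw [coprod.inl_desc, coprod.braiding_hom, coprod.inl_desc_assoc, coprod.inr_desc]
      · rw [coprod.inr_desc, coprod.braiding_hom, coprod.inr_desc_assoc, coprod.inl_desc]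
    rw [h]
    infer_instance
  weakEquivalence := J.weakEquivalence

lemma HomotopicOver.symm {X Y : V} {p : X ⟶ Y} {a b : 𝟙_ V ⟶ X} (h : HomotopicOver p a b) :
    HomotopicOver p b a := by
  have hab := h.comp_eq
  obtain ⟨J, h, hd, hc, he⟩ := h
  exact ⟨J.swap, h, hc, hd, he.trans (congrArg (J.e ≫ ·) hab)⟩

lemma HomotopicOver.map {X Y X' Y' : V} {p : X ⟶ Y} {a b : 𝟙_ V ⟶ X} (h : HomotopicOver p a b)
    {p' : X' ⟶ Y'} (f : X ⟶ X') (g : Y ⟶ Y') (hfg : f ≫ p' = p ≫ g) :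
    HomotopicOver p' (a ≫ f) (b ≫ f) := by
  obtain ⟨J, h, hd, hc, he⟩ := h
  exact ⟨J, h ≫ f, by rw [reassoc_of% hd], by rw [reassoc_of% hc], by simp [hfg, reassoc_of% he]⟩

lemma exists_interval_of_weakEquivalence {K : V} (d c : 𝟙_ V ⟶ K) (e : K ⟶ 𝟙_ V)
    (hd : d ≫ e = 𝟙 _) (hc : c ≫ e = 𝟙 _) (he : WeakEquivalence e) :
    ∃ (J : Interval V) (r : J.J ⟶ K), J.d ≫ r = d ∧ J.c ≫ r = c ∧ r ≫ e = J.e := by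
  let φ := MorphismProperty.factorizationData (cofibrations V) (trivialFibrations V)
    (coprod.desc d c)
  have inl_fac : coprod.inl ≫ φ.i ≫ φ.p = d := by rw [φ.fac, coprod.inl_desc]
  have inr_fac : coprod.inr ≫ φ.i ≫ φ.p = c := by rw [φ.fac, coprod.inr_desc]
  refine ⟨{
    J := φ.Z
    d := coprod.inl ≫ φ.i
    c := coprod.inr ≫ φ.i
    e := φ.p ≫ e
    d_e := by simp only [Category.assoc, reassoc_of% inl_fac, hd]
    c_e := by simp only [Category.assoc, reassoc_of% inr_fac, hc]
    cofibration := by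
      have h : coprod.desc (coprod.inl ≫ φ.i) (coprod.inr ≫ φ.i) = φ.i := by
        ext
        · rw [coprod.inl_desc]
        · rw [coprod.inr_desc]
      rw [h]
      infer_instance
    weakEquivalence := inferInstance }, φ.p, ?_, ?_, rfl⟩
  · rw [Category.assoc, inl_fac]
  · rw [Category.assoc, inr_fac]

lemma Interval.trivialCofibration_d (hI : IsCofibrant (𝟙_ V)) (J : Interval V) :
    Cofibration J.d ∧ WeakEquivalence J.d := by
  have := J.cofibration
  have := J.weakEquivalence
  constructor
  · have h : J.d = coprod.inl ≫ coprod.desc J.d J.c := by rw [coprod.inl_desc]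
    rw [h]
    infer_instance
  · exact weakEquivalence_of_postcomp_of_fac J.d_e

lemma HomotopicOver.trans (hI : IsCofibrant (𝟙_ V)) {X Y : V} {p : X ⟶ Y} {a b c : 𝟙_ V ⟶ X}
    (hab : HomotopicOver p a b) (hbc : HomotopicOver p b c) : HomotopicOver p a c := by
  have hab_comp := hab.comp_eq
  obtain ⟨J, h, hd, hc, he⟩ := hab
  obtain ⟨J', h', hd', hc', he'⟩ := hbc
  obtain ⟨_, _⟩ := J'.trivialCofibration_d hI
  have := J.weakEquivalence
  let e : pushout J.c J'.d ⟶ 𝟙_ V := pushout.desc J.e J'.e (by rw [J.c_e, J'.d_e])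
  have : WeakEquivalence e :=
    weakEquivalence_of_precomp_of_fac (pushout.inl_desc _ _ _ : pushout.inl _ _ ≫ e = J.e)
  obtain ⟨K, r, h_d, h_c, h_e⟩ := exists_interval_of_weakEquivalence
    (J.d ≫ pushout.inl J.c J'.d) (J'.c ≫ pushout.inr J.c J'.d) e
    (by rw [Category.assoc, pushout.inl_desc, J.d_e])
    (by rw [Category.assoc, pushout.inr_desc, J'.c_e]) this
  refine ⟨K, r ≫ pushout.desc h h' (by rw [hc, hd']), ?_, ?_, ?_⟩
  · rw [reassoc_of% h_d, pushout.inl_desc, hd]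
  · rw [reassoc_of% h_c, pushout.inr_desc, hc']
  · rw [← h_e, Category.assoc, Category.assoc]
    congr 1
    ext
    · rw [pushout.inl_desc_assoc, pushout.inl_desc_assoc, he]
    · rw [pushout.inr_desc_assoc, pushout.inr_desc_assoc, he', hab_comp]

lemma homotopicOver_of_trivialFibration {X Y : V} {p : X ⟶ Y} (hp : trivialFibrations V p)
    {a b : 𝟙_ V ⟶ X} (h : a ≫ p = b ≫ p) : HomotopicOver p a b := by
  obtain ⟨_, _⟩ := (mem_trivialFibrations_iff p).1 hp
  obtain ⟨J, -, -, -, -⟩ := exists_interval_of_weakEquivalence (𝟙 (𝟙_ V)) (𝟙 _) (𝟙 _) (by simp)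
    (by simp) inferInstance
  have := J.cofibration
  have sq : CommSq (coprod.desc a b) (coprod.desc J.d J.c) p (J.e ≫ a ≫ p) := ⟨by
    ext
    · rw [coprod.inl_desc_assoc, coprod.inl_desc_assoc, reassoc_of% J.d_e]
    · rw [coprod.inr_desc_assoc, coprod.inr_desc_assoc, reassoc_of% J.c_e, h]⟩
  refine ⟨J, sq.lift, ?_, ?_, sq.fac_right⟩
  · have := coprod.inl ≫= sq.fac_left
    rwa [coprod.inl_desc_assoc, coprod.inl_desc] at this
  · have := coprod.inr ≫= sq.fac_left
    rwa [coprod.inr_desc_assoc, coprod.inr_desc] at this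

lemma exists_section_of_trivialFibration (hI : IsCofibrant (𝟙_ V)) {X : V} {p : X ⟶ 𝟙_ V}
    (hp : trivialFibrations V p) : ∃ a : 𝟙_ V ⟶ X, a ≫ p = 𝟙 _ := by
  obtain ⟨_, _⟩ := (mem_trivialFibrations_iff p).1 hp
  have sq : CommSq (initial.to X) (initial.to (𝟙_ V)) p (𝟙 _) := ⟨by simp⟩
  exact ⟨sq.lift, sq.fac_right⟩

end Homotopy

/-! ### Full sub-`V`-categories on families of objects -/

section FullOn

variable {V : Type u} [Category.{v} V] [MonoidalCategory V] {B : Type u₁} [EnrichedCategory V B]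

/-- The object type of the full sub-`V`-category on a family of objects. -/
def FullOn {ι : Type u₂} (_ : ι → B) : Type u₂ := ι

instance fullOnEnriched {ι : Type u₂} (f : ι → B) : EnrichedCategory V (FullOn f) where
  Hom i j := EnrichedCategory.Hom (f i) (f j)
  id i := eId V (f i)
  comp i j k := eComp V (f i) (f j) (f k)
  id_comp _ _ := e_id_comp V _ _
  comp_id _ _ := e_comp_id V _ _
  assoc _ _ _ _ := e_assoc V _ _ _ _

/-- The inclusion of the full sub-`V`-category on a family of objects. -/
def fullOnInclusion {ι : Type u₂} (f : ι → B) : EnrichedFunctor V (FullOn f) B where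
  obj i := f i
  map i j := 𝟙 _
  map_id i := Category.comp_id _
  map_comp i j k := by
    rw [Category.comp_id, id_tensorHom_id]
    exact (Category.id_comp _).symm

end FullOn

/-! ### The `V`-category of elements of a weight -/

section Elements

variable {V : Type u} [Category.{v} V] [MonoidalCategory V] [MonoidalClosed V] [HasPullbacks V]
  {C : Type u₁} [EnrichedCategory V C]

/-- The objects of the `V`-category of elements of a weight `M`: a point of some value of `M`. -/
structure Elements (M : Weight V C) where
  base : C
  pt : 𝟙_ V ⟶ M.obj base

variable {M : Weight V C}

/-- The hom-object of elements: maps preserving the chosen points. -/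
def elHom (x y : Elements M) : V := pullback (evalAt M x.pt y.base) y.pt

/-- The `V`-functor from elements to `C`, on hom-objects. -/
def elFst (x y : Elements M) : elHom x y ⟶ (EnrichedCategory.Hom x.base y.base : V) :=
  pullback.fst _ _

/-- The `V`-functor from elements to the unit `V`-category, on hom-objects. -/
def elSnd (x y : Elements M) : elHom x y ⟶ 𝟙_ V := pullback.snd _ _

lemma elHom_condition (x y : Elements M) :
    elFst x y ≫ evalAt M x.pt y.base = elSnd x y ≫ y.pt := pullback.condition

/-- A map into a hom-object of elements from its components. -/
def elLift {x y : Elements M} {T : V} (a : T ⟶ (EnrichedCategory.Hom x.base y.base : V))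
    (b : T ⟶ 𝟙_ V) (h : a ≫ evalAt M x.pt y.base = b ≫ y.pt) : T ⟶ elHom x y :=
  pullback.lift a b h

@[simp]
lemma elLift_fst {x y : Elements M} {T : V} (a : T ⟶ (EnrichedCategory.Hom x.base y.base : V))
    (b : T ⟶ 𝟙_ V) (h) : elLift a b h ≫ elFst x y = a := pullback.lift_fst _ _ _

@[simp]
lemma elLift_snd {x y : Elements M} {T : V} (a : T ⟶ (EnrichedCategory.Hom x.base y.base : V))
    (b : T ⟶ 𝟙_ V) (h) : elLift a b h ≫ elSnd x y = b := pullback.lift_snd _ _ _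

lemma elHom_ext {x y : Elements M} {T : V} {a b : T ⟶ elHom x y}
    (fst : a ≫ elFst x y = b ≫ elFst x y) (snd : a ≫ elSnd x y = b ≫ elSnd x y) : a = b :=
  pullback.hom_ext fst snd

/-- The identity of an element. -/
def elId (x : Elements M) : 𝟙_ V ⟶ elHom x x :=
  elLift (eId V x.base) (𝟙 _) (by simp)

lemma elId_fst (x : Elements M) : elId x ≫ elFst x x = eId V x.base := elLift_fst _ _ _

lemma elId_snd (x : Elements M) : elId x ≫ elSnd x x = 𝟙 _ := elLift_snd _ _ _

variable [SymmetricCategory V]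

/-- Composition of maps of elements. -/
def elComp (x y z : Elements M) : elHom x y ⊗ elHom y z ⟶ elHom x z :=
  elLift ((elFst x y ⊗ₘ elFst y z) ≫ eComp V x.base y.base z.base)
    ((elSnd x y ⊗ₘ elSnd y z) ≫ (λ_ _).hom) (by
      have pt_act : y.pt ▷ _ ≫ act M y.base z.base = (λ_ _).hom ≫ evalAt M y.pt z.base := by
        simp [evalAt]
      rw [Category.assoc, eComp_evalAt, tensorHom_comp_whiskerRight_assoc, elHom_condition,
        ← tensorHom_comp_whiskerRight_assoc, pt_act]
      simp only [MonoidalCategory.tensorHom_def, Category.assoc]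
      rw [leftUnitor_naturality_assoc, elHom_condition, ← leftUnitor_naturality_assoc])

lemma elComp_fst (x y z : Elements M) : elComp x y z ≫ elFst x z =
    (elFst x y ⊗ₘ elFst y z) ≫ eComp V x.base y.base z.base := elLift_fst _ _ _

lemma elComp_snd (x y z : Elements M) : elComp x y z ≫ elSnd x z =
    (elSnd x y ⊗ₘ elSnd y z) ≫ (λ_ _).hom := elLift_snd _ _ _

instance elementsEnriched : EnrichedCategory V (Elements M) where
  Hom := elHom
  id := elId
  comp := elComp
  id_comp x y := by
    apply elHom_ext
    · rw [Category.assoc, Category.assoc, elComp_fst, whiskerRight_comp_tensorHom_assoc,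
        elId_fst, MonoidalCategory.tensorHom_def', Category.assoc,
        ← leftUnitor_inv_naturality_assoc, e_id_comp, Category.id_comp, Category.comp_id]
    · rw [Category.assoc, Category.assoc, elComp_snd, whiskerRight_comp_tensorHom_assoc,
        elId_snd, MonoidalCategory.tensorHom_def', Category.assoc,
        ← leftUnitor_inv_naturality_assoc]
      simp
  comp_id x y := by
    apply elHom_ext
    · rw [Category.assoc, Category.assoc, elComp_fst, whiskerLeft_comp_tensorHom_assoc,
        elId_fst, MonoidalCategory.tensorHom_def, Category.assoc,
        ← rightUnitor_inv_naturality_assoc, e_comp_id, Category.id_comp, Category.comp_id]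
    · rw [Category.assoc, Category.assoc, elComp_snd, whiskerLeft_comp_tensorHom_assoc,
        elId_snd, MonoidalCategory.tensorHom_def, Category.assoc,
        ← rightUnitor_inv_naturality_assoc]
      simp [unitors_equal]
  assoc x y z t := by
    apply elHom_ext
    · rw [Category.assoc, Category.assoc, Category.assoc, elComp_fst, elComp_fst,
        whiskerRight_comp_tensorHom_assoc, whiskerLeft_comp_tensorHom_assoc, elComp_fst,
        elComp_fst, ← tensorHom_comp_whiskerRight_assoc, ← tensorHom_comp_whiskerLeft_assoc,
        ← e_assoc, ← associator_inv_naturality_assoc]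
    · rw [Category.assoc, Category.assoc, Category.assoc, elComp_snd, elComp_snd,
        whiskerRight_comp_tensorHom_assoc, whiskerLeft_comp_tensorHom_assoc, elComp_snd,
        elComp_snd, ← tensorHom_comp_whiskerRight_assoc, ← tensorHom_comp_whiskerLeft_assoc,
        ← associator_inv_naturality_assoc]
      simp [unitors_equal]

end Elements

/-! ### Weak initial objects among elements -/

section WeakInitial

variable {V : Type u} [Category.{v} V] [MonoidalCategory V] {C : Type u₁} [EnrichedCategory V C]

lemma whiskerRight_eComp {x y z : C} (p : 𝟙_ V ⟶ (EnrichedCategory.Hom x y : V)) {T : V}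
    (g : T ⟶ (EnrichedCategory.Hom y z : V)) :
    p ▷ T ≫ _ ◁ g ≫ eComp V x y z = (λ_ T).hom ≫ g ≫ precomp p z := by
  rw [precomp, leftUnitor_inv_naturality_assoc, Iso.hom_inv_id_assoc, whisker_exchange_assoc]

variable [MonoidalClosed V]

lemma whiskerRight_act (M : Weight V C) {x y : C} (p : 𝟙_ V ⟶ M.obj x) {T : V}
    (g : T ⟶ (EnrichedCategory.Hom x y : V)) :
    p ▷ T ≫ M.obj x ◁ g ≫ act M x y = (λ_ T).hom ≫ g ≫ evalAt M p y := by
  rw [evalAt, leftUnitor_inv_naturality_assoc, Iso.hom_inv_id_assoc, whisker_exchange_assoc]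

variable [SymmetricCategory V]

lemma evalAt_coneHom {D : Type v} [EnrichedCategory V D] {W : Weight V D}
    {S : EnrichedFunctor V D C} {L : C} (η : VNatTrans W (S.comp V (corep L))) {x : D}
    (a : 𝟙_ V ⟶ W.obj x) (y : D) :
    evalAt W a y ≫ coneHom η y = S.map x y ≫ precomp (a ≫ coneHom η x) (S.obj y) := by
  rw [evalAt, Category.assoc, Category.assoc, act_coneHom, ← comp_whiskerRight_assoc,
    whiskerRight_eComp, Iso.inv_hom_id_assoc]

variable [HasLimits V] (M : Weight V C)

/-- The weight sends the weighted limits which exist in `C` to limits in `V`. -/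
def PreservesWeightedLimits : Prop :=
  ∀ (D : Type v) [EnrichedCategory V D] (W : Weight V D) (S : EnrichedFunctor V D C) (L : C)
    (η : VNatTrans W (S.comp V (corep L))), IsWeightedLimit η → IsIso (weightComparison M η)

variable {M} {ι : Type v} (f : ι → Elements M)

/-- The diagram in `C` underlying a family of elements. -/
abbrev familyBase : EnrichedFunctor V (FullOn f) C where
  obj i := (f i).base
  map i j := elFst (f i) (f j)
  map_id i := elId_fst (f i)
  map_comp i j k := elComp_fst (f i) (f j) (f k)

/-- The augmentation of the `V`-category of a family of elements. -/
abbrev familyAug : EnrichedFunctor V (FullOn f) (UnitCat V) where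
  obj _ := UnitCat.star
  map i j := elSnd (f i) (f j)
  map_id i := elId_snd (f i)
  map_comp i j k := elComp_snd (f i) (f j) (f k)

variable {f} {Q : Weight V (FullOn f)}

/-- The action of maps of elements on a weight. -/
def elAct (Q : Weight V (FullOn f)) (i j : ι) :
    Q.obj i ⊗ elHom (f i) (f j) ⟶ Q.obj j := act Q i j

/-- The action of maps of elements on a point of a weight. -/
def elEval {i : ι} (a : 𝟙_ V ⟶ Q.obj i) (j : ι) : elHom (f i) (f j) ⟶ Q.obj j := evalAt Q a j

lemma elComp_elEval {i : ι} (a : 𝟙_ V ⟶ Q.obj i) (j k : ι) :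
    elComp (f i) (f j) (f k) ≫ elEval a k = elEval a j ▷ _ ≫ elAct Q j k :=
  eComp_evalAt Q a j k

variable (f) in
lemma act_familyAug (i j : ι) : act ((familyAug f).comp V (unitFunctor V)) i j =
    (λ_ (elHom (f i) (f j))).hom ≫ elSnd (f i) (f j) := by
  refine (act_functorComp (familyAug f) (unitFunctor V) i j).trans ?_
  change 𝟙_ V ◁ elSnd (f i) (f j) ≫
    MonoidalClosed.uncurry (MonoidalClosed.curry (ρ_ (𝟙_ V)).hom) = _
  rw [MonoidalClosed.uncurry_curry, id_whiskerLeft, ← unitors_equal]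
  simp

variable (f) in
/-- The points of a family of elements, as a cone over the underlying diagram. -/
def elementPoints : VNatTrans ((familyAug f).comp V (unitFunctor V)) ((familyBase f).comp V M) :=
  .ofAct (fun i => (f i).pt) fun i j => by
    have act_base : (f i).pt ▷ _ ≫ act ((familyBase f).comp V M) i j =
        (λ_ _).hom ≫ elSnd (f i) (f j) ≫ (f j).pt := by
      rw [act_functorComp, ← elHom_condition]
      exact whiskerRight_act M (f i).pt (elFst (f i) (f j))
    exact (congrArg (· ≫ (f j).pt) (act_familyAug f i j)).trans
      ((Category.assoc _ _ _).trans act_base.symm)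

variable (q : VNatTrans Q ((familyAug f).comp V (unitFunctor V)))

/-- The components of an augmentation of a weight. -/
def augHom (i : ι) : Q.obj i ⟶ 𝟙_ V := q.app i

lemma elAct_augHom (i j : ι) :
    elAct Q i j ≫ augHom q j = augHom q i ▷ _ ≫ (λ_ _).hom ≫ elSnd (f i) (f j) :=
  (q.act_app i j).trans (congrArg (_ ≫ ·) (act_familyAug f i j))

lemma elEval_augHom {i : ι} {a : 𝟙_ V ⟶ Q.obj i} (ha : a ≫ augHom q i = 𝟙 _) (j : ι) :
    elEval a j ≫ augHom q j = elSnd (f i) (f j) := by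
  change ((λ_ _).inv ≫ a ▷ _ ≫ elAct Q i j) ≫ _ = _
  rw [Category.assoc, Category.assoc, elAct_augHom, ← comp_whiskerRight_assoc, ha]
  simp

lemma natObjMap_elementPoints_eval (i : ι) :
    (natObjMap Q q ≫ natObjMap Q (elementPoints f)) ▷ Q.obj i ≫
        weightEval Q (familyBase f) M i = natObjEval Q Q i ≫ augHom q i ≫ (f i).pt := by
  rw [comp_whiskerRight, Category.assoc]
  refine (congrArg (_ ≫ ·) (natObjMap_eval Q (elementPoints f) i)).trans ?_
  exact ((reassoc_of% natObjMap_eval Q q i) _)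

variable {L : C} (η : VNatTrans Q ((familyBase f).comp V (corep L)))

/-- The components of a cone on a family of elements. -/
def familyCone (i : ι) : Q.obj i ⟶ (EnrichedCategory.Hom L (f i).base : V) := coneHom η i

lemma elEval_familyCone {i : ι} (a : 𝟙_ V ⟶ Q.obj i) (j : ι) :
    elEval a j ≫ familyCone η j =
      elFst (f i) (f j) ≫ precomp (a ≫ familyCone η i) (f j).base :=
  evalAt_coneHom η a j

lemma elAct_familyCone (i j : ι) :
    elAct Q i j ≫ familyCone η j =
      familyCone η i ▷ _ ≫ _ ◁ elFst (f i) (f j) ≫ eComp V L (f i).base (f j).base :=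
  act_coneHom η i j

variable {q η}

lemma comp_weightComparison_eq_iff {x : 𝟙_ V ⟶ M.obj L} :
    x ≫ weightComparison M η = natObjPoint q ≫ natObjMap Q (elementPoints f) ↔
      ∀ i, familyCone η i ≫ evalAt M x (f i).base = augHom q i ≫ (f i).pt := by
  have comp_weightComparison_eval (i : ι) :
      (x ≫ weightComparison M η) ▷ Q.obj i ≫ weightEval Q (familyBase f) M i =
        (λ_ _).hom ≫ familyCone η i ≫ evalAt M x (f i).base := by
    rw [← whiskerRight_act, comp_whiskerRight, Category.assoc]
    exact congrArg (_ ≫ ·) (weightComparison_eval M η i)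
  have comp_elementPoints_eval (i : ι) :
      (natObjPoint q ≫ natObjMap Q (elementPoints f)) ▷ Q.obj i ≫
        weightEval Q (familyBase f) M i = (λ_ _).hom ≫ augHom q i ≫ (f i).pt := by
    rw [comp_whiskerRight, Category.assoc]
    refine (congrArg (_ ≫ ·) (natObjMap_eval Q (elementPoints f) i)).trans ?_
    exact (reassoc_of% natObjPoint_eval q i) _
  refine ⟨fun h i => ?_, fun h => weightEval_ext fun i => ?_⟩
  · rw [← cancel_epi (λ_ (Q.obj i)).hom, ← comp_weightComparison_eval, h, comp_elementPoints_eval]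
  · exact (comp_weightComparison_eval i).trans
      ((congrArg _ (h i)).trans (comp_elementPoints_eval i).symm)

variable (q) in
lemma exists_limitElement (hM : PreservesWeightedLimits M) (hη : IsWeightedLimit η) :
    ∃ x : 𝟙_ V ⟶ M.obj L, ∀ i, familyCone η i ≫ evalAt M x (f i).base =
      augHom q i ≫ (f i).pt := by
  have := hM _ _ _ _ η hη
  exact ⟨natObjPoint q ≫ natObjMap Q (elementPoints f) ≫ inv (weightComparison M η),
    comp_weightComparison_eq_iff.1 (by simp)⟩

variable (η) in
/-- The action `[D, V](Q, Q) ⟶ C(L, L)` of endomorphisms of a weight on a weighted limit. -/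
def limitEndo [IsIso (comparison η L)] : natObj Q Q ⟶ (EnrichedCategory.Hom L L : V) :=
  natObjMap Q η ≫ inv (comparison η L)

variable (η) in
lemma limitEndo_eval [IsIso (comparison η L)] (j : ι) :
    limitEndo η ▷ Q.obj j ≫ _ ◁ familyCone η j ≫ eComp V L L (f j).base =
      natObjEval Q Q j ≫ familyCone η j := by
  have comp_comparison : limitEndo η ≫ comparison η L = natObjMap Q η := by
    rw [limitEndo, Category.assoc, IsIso.inv_hom_id, Category.comp_id]
  refine (congrArg (_ ≫ ·) (comparison_eval η L j).symm).trans ?_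
  rw [← comp_whiskerRight_assoc, comp_comparison]
  exact natObjMap_eval Q η j

lemma limitEndo_evalAt [IsIso (comparison η L)] [IsIso (weightComparison M η)]
    {x : 𝟙_ V ⟶ M.obj L}
    (hx : ∀ i, familyCone η i ≫ evalAt M x (f i).base = augHom q i ≫ (f i).pt) :
    limitEndo η ≫ evalAt M x L = natObjMap Q q ≫
      natObjMap Q (elementPoints f) ≫ inv (weightComparison M η) := by
  rw [← Category.assoc (natObjMap Q q), IsIso.eq_comp_inv]
  refine weightEval_ext fun j => ?_
  refine Eq.trans ?_ ((congrArg (natObjEval Q Q j ≫ ·) (hx j)).trans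
    (natObjMap_elementPoints_eval q j).symm)
  rw [comp_whiskerRight, Category.assoc]
  refine (congrArg (_ ≫ ·) (weightComparison_eval M η j)).trans ?_
  have evalAt_act : evalAt M x L ▷ Q.obj j ≫ M.obj L ◁ familyCone η j ≫ act M L (f j).base =
      _ ◁ familyCone η j ≫ eComp V L L (f j).base ≫ evalAt M x (f j).base := by
    rw [eComp_evalAt, whisker_exchange_assoc]
  rw [comp_whiskerRight, Category.assoc]
  refine (congrArg (_ ≫ ·) evalAt_act).trans ?_
  exact ((reassoc_of% (limitEndo_eval η j)) (evalAt M x (f j).base))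

section

variable {x : 𝟙_ V ⟶ M.obj L}
    (hx : ∀ i, familyCone η i ≫ evalAt M x (f i).base = augHom q i ≫ (f i).pt) {i : ι}
    (a : 𝟙_ V ⟶ Q.obj i) (k : 𝟙_ V ⟶ (EnrichedCategory.Hom (f i).base L : V))
    (hk : k ≫ evalAt M (f i).pt L = x)

/-- The maps from a weight to the hom-objects of elements induced by a map of elements `k` from a
member of the family to the limit. -/
def weightToElHom (j : ι) : Q.obj j ⟶ elHom (f i) (f j) :=
  elLift (familyCone η j ≫ precomp k (f j).base) (augHom q j)
    (by rw [Category.assoc, precomp_evalAt, hk, hx])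

lemma weightToElHom_fst (j : ι) : weightToElHom hx k hk j ≫ elFst (f i) (f j) =
    familyCone η j ≫ precomp k (f j).base := elLift_fst _ _ _

lemma weightToElHom_snd (j : ι) : weightToElHom hx k hk j ≫ elSnd (f i) (f j) =
    augHom q j := elLift_snd _ _ _

lemma elAct_weightToElHom (j j' : ι) : elAct Q j j' ≫ weightToElHom hx k hk j' =
    weightToElHom hx k hk j ▷ _ ≫ elComp (f i) (f j) (f j') := by
  apply elHom_ext
  · rw [Category.assoc, weightToElHom_fst, Category.assoc, elComp_fst, ← Category.assoc,
      elAct_familyCone, whiskerRight_comp_tensorHom_assoc, weightToElHom_fst]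
    simp only [Category.assoc, eComp_precomp, MonoidalCategory.tensorHom_def,
      comp_whiskerRight, whisker_exchange_assoc]
  · rw [Category.assoc, weightToElHom_snd, Category.assoc, elComp_snd, elAct_augHom,
      whiskerRight_comp_tensorHom_assoc, weightToElHom_snd, MonoidalCategory.tensorHom_def,
      Category.assoc, leftUnitor_naturality]

lemma elAct_weightToElHom_elEval (j j' : ι) :
    elAct Q j j' ≫ weightToElHom hx k hk j' ≫ elEval a j' =
      (weightToElHom hx k hk j ≫ elEval a j) ▷ _ ≫ elAct Q j j' := by
  rw [comp_whiskerRight, Category.assoc, ← elComp_elEval, ← Category.assoc, ← Category.assoc,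
    elAct_weightToElHom]

/-- The endomorphism of the weight induced by a map of elements `k` from a member of the family
to the limit. -/
def weightEndo : VNatTrans Q Q :=
  VNatTrans.ofAct (fun j : ι => weightToElHom hx k hk j ≫ elEval a j)
    (elAct_weightToElHom_elEval hx a k hk)

lemma weightEndo_familyCone (j : ι) : (weightEndo hx a k hk).app j ≫ familyCone η j =
    familyCone η j ≫ precomp (k ≫ precomp (a ≫ familyCone η i) L) (f j).base := by
  change (weightToElHom hx k hk j ≫ elEval a j) ≫ _ = _
  rw [Category.assoc, elEval_familyCone, reassoc_of% weightToElHom_fst, precomp_precomp]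

lemma weightEndo_augHom (ha : a ≫ augHom q i = 𝟙 _) (j : ι) :
    (weightEndo hx a k hk).app j ≫ augHom q j = augHom q j := by
  change (weightToElHom hx k hk j ≫ elEval a j) ≫ _ = _
  rw [Category.assoc, elEval_augHom q ha, weightToElHom_snd]

lemma point_evalAt
    (hx : ∀ i, familyCone η i ≫ evalAt M x (f i).base = augHom q i ≫ (f i).pt)
    (a : 𝟙_ V ⟶ Q.obj i) (ha : a ≫ augHom q i = 𝟙 _) :
    (a ≫ familyCone η i) ≫ evalAt M x (f i).base = (f i).pt := by
  rw [Category.assoc, hx, reassoc_of% ha]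

lemma natObjPoint_limitEndo [IsIso (comparison η L)] {ε : VNatTrans Q Q}
    {g : 𝟙_ V ⟶ (EnrichedCategory.Hom L L : V)}
    (hg : ∀ j : ι, ε.app j ≫ familyCone η j = familyCone η j ≫ precomp g (f j).base) :
    natObjPoint ε ≫ limitEndo η = g := by
  rw [limitEndo, ← Category.assoc, IsIso.comp_inv_eq]
  refine coneEval_ext fun j => ?_
  rw [comp_comparison_eval, comp_whiskerRight, Category.assoc]
  refine (congrArg (_ ≫ ·) (natObjMap_eval Q η j)).trans ?_
  rw [reassoc_of% natObjPoint_eval]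
  exact congrArg _ (hg j)

variable [ModelCategory V]

lemma homotopicOver_endo
    (hx : ∀ i, familyCone η i ≫ evalAt M x (f i).base = augHom q i ≫ (f i).pt)
    (a : 𝟙_ V ⟶ Q.obj i) (k : 𝟙_ V ⟶ (EnrichedCategory.Hom (f i).base L : V))
    (hk : k ≫ evalAt M (f i).pt L = x) (hM : PreservesWeightedLimits M) (hη : IsWeightedLimit η)
    (hQ : IsCofibrantWeight Q) (hq : q.IsTrivialFibration) (ha : a ≫ augHom q i = 𝟙 _) :
    HomotopicOver (evalAt M x L) (k ≫ precomp (a ≫ familyCone η i) L) (eId V L) := by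
  have := hM _ _ _ _ η hη
  have := hη L
  let ident : VNatTrans Q Q := .ofAct (fun j => 𝟙 _) (by simp)
  have homotopic : HomotopicOver (natObjMap Q q) (natObjPoint (weightEndo hx a k hk))
      (natObjPoint ident) := by
    refine homotopicOver_of_trivialFibration (hQ _ _ q hq) (natObj_ext fun j => ?_)
    rw [comp_whiskerRight, comp_whiskerRight, Category.assoc, Category.assoc, natObjMap_eval,
      reassoc_of% natObjPoint_eval, reassoc_of% natObjPoint_eval]
    exact congrArg ((λ_ _).hom ≫ ·)
      ((weightEndo_augHom hx a k hk ha j).trans (Category.id_comp _).symm)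
  have weightEndo_limit : natObjPoint (weightEndo hx a k hk) ≫ limitEndo η =
      k ≫ precomp (a ≫ familyCone η i) L :=
    natObjPoint_limitEndo (weightEndo_familyCone hx a k hk)
  have ident_limit : natObjPoint ident ≫ limitEndo η = eId V L :=
    natObjPoint_limitEndo fun j => by
      rw [precomp_id]
      exact (Category.id_comp _).trans (Category.comp_id _).symm
  rw [← weightEndo_limit, ← ident_limit]
  exact homotopic.map _ _ (limitEndo_evalAt hx)

lemma homotopicOver_maps
    (hx : ∀ i, familyCone η i ≫ evalAt M x (f i).base = augHom q i ≫ (f i).pt)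
    (a : 𝟙_ V ⟶ Q.obj i) (hq : q.IsTrivialFibration) (ha : a ≫ augHom q i = 𝟙 _) {j : ι}
    {u t : 𝟙_ V ⟶ (EnrichedCategory.Hom (f i).base (f j).base : V)}
    (hu : u ≫ evalAt M (f i).pt (f j).base = (f j).pt)
    (ht : t ≫ evalAt M (f i).pt (f j).base = (f j).pt) :
    HomotopicOver (evalAt M x (f j).base) (u ≫ precomp (a ≫ familyCone η i) (f j).base)
      (t ≫ precomp (a ≫ familyCone η i) (f j).base) := by
  have exists_point {u : 𝟙_ V ⟶ (EnrichedCategory.Hom (f i).base (f j).base : V)}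
      (hu : u ≫ evalAt M (f i).pt (f j).base = (f j).pt) : ∃ y : 𝟙_ V ⟶ Q.obj j,
        y ≫ augHom q j = 𝟙 _ ∧
          y ≫ familyCone η j = u ≫ precomp (a ≫ familyCone η i) (f j).base := by
    refine ⟨elLift u (𝟙 _) (by rw [hu, Category.id_comp]) ≫ elEval a j, ?_, ?_⟩
    · rw [Category.assoc, elEval_augHom q ha, elLift_snd]
    · rw [Category.assoc, elEval_familyCone, reassoc_of% elLift_fst]
  obtain ⟨y, hy, hy_cone⟩ := exists_point hu
  obtain ⟨z, hz, hz_cone⟩ := exists_point ht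
  have homotopic : HomotopicOver (augHom q j) y z :=
    homotopicOver_of_trivialFibration (hq j) (hy.trans hz.symm)
  rw [← hy_cone, ← hz_cone]
  exact homotopic.map _ _ (hx j)

end

lemma exists_weaklyInitial [ModelCategory V] (hI : IsCofibrant (𝟙_ V))
    (hC : HasEnoughCofibrantlyWeightedLimits V C) (hM : PreservesWeightedLimits M)
    (f : ι → Elements M) :
    ∃ (L : Elements M) (t : ∀ i, 𝟙_ V ⟶ (EnrichedCategory.Hom L.base (f i).base : V)),
      (∀ i, t i ≫ evalAt M L.pt (f i).base = (f i).pt) ∧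
      (∀ i (k : 𝟙_ V ⟶ (EnrichedCategory.Hom (f i).base L.base : V)),
        k ≫ evalAt M (f i).pt L.base = L.pt →
          HomotopicOver (evalAt M L.pt L.base) (k ≫ precomp (t i) L.base) (eId V L.base)) ∧
      ∀ i j (r s : 𝟙_ V ⟶ (EnrichedCategory.Hom (f i).base (f j).base : V)),
        r ≫ evalAt M (f i).pt (f j).base = (f j).pt →
        s ≫ evalAt M (f i).pt (f j).base = (f j).pt →
          HomotopicOver (evalAt M L.pt (f j).base) (r ≫ precomp (t i) (f j).base)
            (s ≫ precomp (t i) (f j).base) := by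
  obtain ⟨Q, ⟨hQ, q, hq⟩, hlim⟩ := hC (FullOn f) (familyAug f)
  obtain ⟨L, η, hη⟩ := hlim (familyBase f)
  obtain ⟨x, hx⟩ := exists_limitElement q hM hη
  have ha (i : ι) : ∃ a : 𝟙_ V ⟶ Q.obj i, a ≫ augHom q i = 𝟙 _ :=
    exists_section_of_trivialFibration hI (hq i)
  choose a ha using ha
  exact ⟨⟨L, x⟩, fun i => a i ≫ familyCone η i, fun i => point_evalAt hx (a i) (ha i),
    fun i k hk => homotopicOver_endo hx (a i) k hk hM hη hQ hq (ha i),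
    fun i j r s hr hs => homotopicOver_maps hx (a i) hq (ha i) hr hs⟩

end WeakInitial

section WeakAdjoint

variable {V : Type u} [Category.{v} V] [MonoidalCategory V] {C : Type u₁} [EnrichedCategory V C]

/-- Postcomposition `C(X, Y) ⟶ C(X, Z)` with a point of `C(Y, Z)`. -/
def postcomp {Y Z : C} (g : 𝟙_ V ⟶ (EnrichedCategory.Hom Y Z : V)) (X : C) :
    (EnrichedCategory.Hom X Y : V) ⟶ (EnrichedCategory.Hom X Z : V) :=
  (ρ_ _).inv ≫ _ ◁ g ≫ eComp V X Y Z

lemma comp_postcomp {X Y Z : C} (a : 𝟙_ V ⟶ (EnrichedCategory.Hom X Y : V))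
    (g : 𝟙_ V ⟶ (EnrichedCategory.Hom Y Z : V)) :
    a ≫ postcomp g X = g ≫ precomp a Z := by
  rw [postcomp, rightUnitor_inv_naturality_assoc, whiskerRight_eComp, ← unitors_inv_equal,
    Iso.inv_hom_id_assoc]

lemma eId_postcomp {X Y : C} (g : 𝟙_ V ⟶ (EnrichedCategory.Hom X Y : V)) :
    eId V X ≫ postcomp g X = g := by
  rw [comp_postcomp, precomp_id, Category.comp_id]

variable [MonoidalClosed V] [SymmetricCategory V]

lemma postcomp_evalAt (M : Weight V C) {X Y Z : C} (x : 𝟙_ V ⟶ M.obj X)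
    (g : 𝟙_ V ⟶ (EnrichedCategory.Hom Y Z : V)) :
    postcomp g X ≫ evalAt M x Z = evalAt M x Y ≫ (ρ_ _).inv ≫ _ ◁ g ≫ act M Y Z := by
  rw [postcomp, Category.assoc, Category.assoc, eComp_evalAt, whisker_exchange_assoc,
    rightUnitor_inv_naturality_assoc]

variable [HasLimits V]

lemma comp_weightComparison_natObjπ (M : Weight V C) {D : Type v} [EnrichedCategory V D]
    {W : Weight V D} {S : EnrichedFunctor V D C} {L : C} (η : VNatTrans W (S.comp V (corep L)))
    (y : 𝟙_ V ⟶ M.obj L) (d : D) :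
    y ≫ weightComparison M η ≫ natObjπ W (S.comp V M) d =
      MonoidalClosed.curry ((ρ_ (W.obj d)).hom ≫ coneHom η d ≫ evalAt M y (S.obj d)) := by
  have point_eval : (y ≫ weightComparison M η) ▷ W.obj d ≫ weightEval W S M d =
      (λ_ (W.obj d)).hom ≫ coneHom η d ≫ evalAt M y (S.obj d) := by
    rw [comp_whiskerRight, Category.assoc, weightComparison_eval, whiskerRight_act]
  apply MonoidalClosed.uncurry_injective
  rw [← cancel_epi (β_ (𝟙_ V) (W.obj d)).hom, ← Category.assoc y]
  refine ((whiskerRight_natObjEval _ _).symm.trans point_eval).trans ?_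
  refine (congrArg (· ≫ coneHom η d ≫ evalAt M y (S.obj d))
    (braiding_rightUnitor (W.obj d)).symm).trans ((Category.assoc _ _ _).trans ?_)
  exact congrArg ((β_ (𝟙_ V) (W.obj d)).hom ≫ ·) (MonoidalClosed.uncurry_curry _).symm

variable {M : Weight V C} {X : V} {P c : C} {κ : X ⟶ (EnrichedCategory.Hom P c : V)}

lemma comp_weightComparison_powerCone (y : 𝟙_ V ⟶ M.obj P) :
    y ≫ weightComparison M (powerCone κ) ≫ natObjπ _ _ (pointCatStar V) =
      MonoidalClosed.curry ((ρ_ X).hom ≫ κ ≫ evalAt M y c) :=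
  comp_weightComparison_natObjπ M (powerCone κ) y (pointCatStar V)

lemma exists_powerPoint (hκ : IsIso (weightComparison M (powerCone κ))) (z : X ⟶ M.obj c) :
    ∃ y : 𝟙_ V ⟶ M.obj P, κ ≫ evalAt M y c = z := by
  obtain ⟨r, -, hr⟩ := (IsIso.comp_isIso' hκ (isIso_natObjπ_pointCat _ _ (pointCatStar V))).out
  refine ⟨MonoidalClosed.curry ((ρ_ X).hom ≫ z) ≫ r, ?_⟩
  rw [← cancel_epi (ρ_ X).hom]
  refine MonoidalClosed.curry_injective ((comp_weightComparison_powerCone _).symm.trans ?_)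
  exact (Category.assoc _ _ _).trans ((congrArg (_ ≫ ·) hr).trans (Category.comp_id _))

lemma powerPoint_ext (hκ : IsIso (weightComparison M (powerCone κ))) {y z : 𝟙_ V ⟶ M.obj P}
    (h : κ ≫ evalAt M y c = κ ≫ evalAt M z c) : y = z := by
  have := isIso_natObjπ_pointCat (pointFunctor X) ((pointFunctor c).comp V M) (pointCatStar V)
  rw [← cancel_mono (weightComparison M (powerCone κ) ≫ natObjπ _ _ (pointCatStar V))]
  refine (comp_weightComparison_powerCone y).trans (Eq.trans ?_
    (comp_weightComparison_powerCone z).symm)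
  exact congrArg (fun t => MonoidalClosed.curry ((ρ_ X).hom ≫ t)) h

lemma weightComparison_corep {D : Type v} [EnrichedCategory V D] {W : Weight V D}
    {S : EnrichedFunctor V D C} {L : C} (η : VNatTrans W (S.comp V (corep L))) (B : C) :
    weightComparison (corep B) η = comparison η B := by
  refine weightEval_ext fun d => (weightComparison_eval (corep B) η d).trans ?_
  rw [act_corep]
  exact (comparison_eval η B d).symm

lemma IsPower.exists_precomp_eq (hκ : IsPower κ) {B : C}
    (g : X ⟶ (EnrichedCategory.Hom B c : V)) :
    ∃ t : 𝟙_ V ⟶ (EnrichedCategory.Hom B P : V), κ ≫ precomp t c = g := by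
  have hcomparison : IsIso (weightComparison (corep B) (powerCone κ)) := by
    rw [weightComparison_corep]
    exact (isPower_iff κ).1 hκ B
  obtain ⟨t, ht⟩ := exists_powerPoint hcomparison g
  rw [evalAt, act_corep] at ht
  exact ⟨t, ht⟩

variable (M) in
/-- Every element of `M` receives a map from a member of the family `f`. -/
def IsSolutionSet {ι : Type v} (f : ι → Elements M) : Prop :=
  ∀ y : Elements M, ∃ (i : ι) (g : 𝟙_ V ⟶ (EnrichedCategory.Hom (f i).base y.base : V)),
    g ≫ evalAt M (f i).pt y.base = y.pt

variable [ModelCategory V]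

lemma exists_homotopyInitial (hI : IsCofibrant (𝟙_ V))
    (hC : HasEnoughCofibrantlyWeightedLimits V C) (hM : PreservesWeightedLimits M)
    {ι : Type v} {f : ι → Elements M} (hf : IsSolutionSet M f) :
    ∃ L : Elements M, ∀ y : Elements M,
      (∃ g : 𝟙_ V ⟶ (EnrichedCategory.Hom L.base y.base : V),
        g ≫ evalAt M L.pt y.base = y.pt) ∧
      ∀ r s : 𝟙_ V ⟶ (EnrichedCategory.Hom L.base y.base : V),
        r ≫ evalAt M L.pt y.base = y.pt → s ≫ evalAt M L.pt y.base = y.pt →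
          HomotopicOver (evalAt M L.pt y.base) r s := by
  obtain ⟨L, t, ht, hL, -⟩ := exists_weaklyInitial hI hC hM f
  refine ⟨L, fun y => ⟨?_, fun r s hr hs => ?_⟩⟩
  · obtain ⟨i, g, hg⟩ := hf y
    exact ⟨g ≫ precomp (t i) _, by rw [Category.assoc, precomp_evalAt, ht, hg]⟩
  · obtain ⟨L', t', ht', -, hL'⟩ := exists_weaklyInitial hI hC hM
      (fun b : ULift.{v} Bool => bif b.down then L else y)
    obtain ⟨i, g, hg⟩ := hf L'
    have hk : (g ≫ precomp (t i) L'.base) ≫ evalAt M L.pt L'.base = L'.pt := by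
      rw [Category.assoc, precomp_evalAt, ht, hg]
    have hk' : (t' ⟨true⟩ ≫ precomp g L.base) ≫ evalAt M (f i).pt L.base = L.pt := by
      rw [Category.assoc, precomp_evalAt, hg]
      exact ht' ⟨true⟩
    have homotopic_postcomp (r : 𝟙_ V ⟶ (EnrichedCategory.Hom L.base y.base : V)) :
        HomotopicOver (evalAt M L.pt y.base)
          ((r ≫ precomp (t' ⟨true⟩) y.base) ≫ precomp (g ≫ precomp (t i) L'.base) y.base) r := by
      have := (hL i _ hk').map (postcomp r L.base) _ (postcomp_evalAt M L.pt r)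
      rw [eId_postcomp, comp_postcomp, Category.assoc, precomp_precomp] at this
      rwa [Category.assoc, precomp_precomp]
    have homotopic_precomp : HomotopicOver (evalAt M L'.pt y.base)
        (r ≫ precomp (t' ⟨true⟩) y.base) (s ≫ precomp (t' ⟨true⟩) y.base) :=
      hL' ⟨true⟩ ⟨false⟩ r s hr hs
    refine (homotopic_postcomp r).symm.trans hI (HomotopicOver.trans hI ?_ (homotopic_postcomp s))
    exact homotopic_precomp.map _ (𝟙 _) (by rw [precomp_evalAt, hk, Category.comp_id])

lemma exists_shrinkable_evalAt (hI : IsCofibrant (𝟙_ V)) (hP : HasPowers V C)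
    (hC : HasEnoughCofibrantlyWeightedLimits V C) (hM : PreservesWeightedLimits M)
    {ι : Type v} {f : ι → Elements M} (hf : IsSolutionSet M f) :
    ∃ (c : C) (x : 𝟙_ V ⟶ M.obj c), ∀ a, Shrinkable V (evalAt M x a) := by
  obtain ⟨L, hL⟩ := exists_homotopyInitial hI hC hM hf
  refine ⟨L.base, L.pt, fun a => (shrinkable_iff _).2 ?_⟩
  obtain ⟨s, hs⟩ : ∃ s : M.obj a ⟶ (EnrichedCategory.Hom L.base a : V),
      s ≫ evalAt M L.pt a = 𝟙 _ := by
    obtain ⟨P, κ, hκ⟩ := hP (M.obj a) a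
    obtain ⟨y, hy⟩ := exists_powerPoint (hM _ _ _ _ _ ((isPower_iff κ).1 hκ)) (𝟙 _)
    obtain ⟨g, hg⟩ := (hL ⟨P, y⟩).1
    exact ⟨κ ≫ precomp g a, by rw [Category.assoc, precomp_evalAt, hg, hy]⟩
  refine ⟨s, hs, ?_⟩
  obtain ⟨P, κ, hκ⟩ := hP (EnrichedCategory.Hom L.base a : V) a
  obtain ⟨r, hr⟩ := IsPower.exists_precomp_eq hκ (evalAt M L.pt a ≫ s)
  obtain ⟨t, ht⟩ := IsPower.exists_precomp_eq hκ (𝟙 _)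
  have hrt : t ≫ evalAt M L.pt P = r ≫ evalAt M L.pt P := by
    refine powerPoint_ext (hM _ _ _ _ _ ((isPower_iff κ).1 hκ)) ?_
    rw [← precomp_evalAt, ← precomp_evalAt, reassoc_of% hr, reassoc_of% ht, hs, Category.comp_id]
  obtain ⟨J, h, hd, hc, he⟩ := (hL ⟨P, r ≫ evalAt M L.pt P⟩).2 r t rfl hrt
  refine ⟨J, h ▷ _ ≫ _ ◁ κ ≫ eComp V L.base P a, ?_, ?_, ?_⟩
  · rw [← comp_whiskerRight_assoc, hd, whiskerRight_eComp, hr]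
  · rw [← comp_whiskerRight_assoc, hc, whiskerRight_eComp, ht, Category.comp_id]
  · rw [Category.assoc, Category.assoc, eComp_evalAt, whisker_exchange_assoc,
      ← comp_whiskerRight_assoc, he, comp_whiskerRight_assoc, whiskerRight_act,
      ← precomp_evalAt, reassoc_of% hr, hs, Category.comp_id]

end WeakAdjoint

/-! ### Exchanging tensor factors -/

section SwapRight

variable {V : Type u} [Category.{v} V] [MonoidalCategory V] [SymmetricCategory V]

/-- The exchange of the last two factors of a threefold tensor product. -/
def swapRight (X Y Z : V) : (X ⊗ Y) ⊗ Z ⟶ (X ⊗ Z) ⊗ Y :=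
  (α_ X Y Z).hom ≫ X ◁ (β_ Y Z).hom ≫ (α_ X Z Y).inv

@[simp]
lemma swapRight_swapRight (X Y Z : V) : swapRight X Y Z ≫ swapRight X Z Y = 𝟙 _ := by
  simp only [swapRight, Category.assoc, Iso.inv_hom_id_assoc]
  rw [← MonoidalCategory.whiskerLeft_comp_assoc, SymmetricCategory.symmetry]
  simp

lemma swapRight_naturality_left {X X' : V} (f : X ⟶ X') (Y Z : V) :
    f ▷ Y ▷ Z ≫ swapRight X' Y Z = swapRight X Y Z ≫ f ▷ Z ▷ Y := by
  simp only [swapRight, Category.assoc, associator_naturality_left_assoc,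
    ← whisker_exchange_assoc, associator_inv_naturality_left]

lemma swapRight_naturality_middle (X : V) {Y Y' : V} (f : Y ⟶ Y') (Z : V) :
    (X ◁ f) ▷ Z ≫ swapRight X Y' Z = swapRight X Y Z ≫ (X ⊗ Z) ◁ f := by
  simp only [swapRight, Category.assoc, associator_naturality_middle_assoc,
    ← MonoidalCategory.whiskerLeft_comp_assoc, BraidedCategory.braiding_naturality_left]
  simp

lemma swapRight_naturality_right (X Y : V) {Z Z' : V} (f : Z ⟶ Z') :
    (X ⊗ Y) ◁ f ≫ swapRight X Y Z' = swapRight X Y Z ≫ (X ◁ f) ▷ Y := by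
  simp only [swapRight, Category.assoc, associator_naturality_right_assoc,
    ← MonoidalCategory.whiskerLeft_comp_assoc, BraidedCategory.braiding_naturality_right]
  simp

lemma swapRight_tensor_right (X Y Z T : V) :
    swapRight X Y (Z ⊗ T) ≫ (α_ X Z T).inv ▷ Y =
      (α_ (X ⊗ Y) Z T).inv ≫ swapRight X Y Z ▷ T ≫ swapRight (X ⊗ Z) Y T := by
  simp only [swapRight, BraidedCategory.braiding_tensor_right_hom]
  simp only [comp_whiskerRight, MonoidalCategory.whiskerLeft_comp, Category.assoc]
  monoidal

lemma swapRight_tensor_middle (X Y Z T : V) :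
    swapRight X (Y ⊗ Z) T ≫ (α_ (X ⊗ T) Y Z).inv =
      (α_ X Y Z).inv ▷ T ≫ swapRight (X ⊗ Y) Z T ≫ swapRight X Y T ▷ Z := by
  simp only [swapRight, BraidedCategory.braiding_tensor_left_hom]
  simp only [comp_whiskerRight, MonoidalCategory.whiskerLeft_comp, Category.assoc]
  monoidal

lemma swapRight_unit (X Y : V) :
    swapRight X (𝟙_ V) Y ≫ (ρ_ (X ⊗ Y)).hom = (ρ_ X).hom ▷ Y := by
  simp only [swapRight, braiding_tensorUnit_left, Category.assoc]
  simp

lemma swapRight_unit_left (X Y : V) :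
    (λ_ X).inv ▷ Y ≫ swapRight (𝟙_ V) X Y ≫ (λ_ Y).hom ▷ X = (β_ X Y).hom := by
  simp only [swapRight, Category.assoc, id_whiskerLeft]
  simp

end SwapRight

/-! ### Weights of natural transformations -/

section HomWeight

variable {V : Type u} [Category.{v} V] [MonoidalCategory V] [SymmetricCategory V]
  [MonoidalClosed V] {E : Type u₁} [EnrichedCategory V E] {D : Type v} [EnrichedCategory V D]

/-- The structure making a family of weights on `D` indexed by the objects of `E` into a
bimodule. -/
structure BimoduleAction (P : E → Weight V D) where
  lact (e e' : E) (d : D) : (P e).obj d ⊗ (EnrichedCategory.Hom e e' : V) ⟶ (P e').obj d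
  lact_id (e : E) (d : D) : (P e).obj d ◁ eId V e ≫ lact e e d = (ρ_ _).hom
  lact_comp (e e' e'' : E) (d : D) : (P e).obj d ◁ eComp V e e' e'' ≫ lact e e'' d =
    (α_ _ _ _).inv ≫ lact e e' d ▷ _ ≫ lact e' e'' d
  exchange (e e' : E) (d d' : D) : lact e e' d ▷ _ ≫ act (P e') d d' =
    swapRight _ _ _ ≫ act (P e) d d' ▷ _ ≫ lact e e' d'

variable {P : E → Weight V D} (A : BimoduleAction P)

lemma BimoduleAction.act_lact (e e' : E) (d d' : D) : act (P e) d d' ▷ _ ≫ A.lact e e' d' =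
    swapRight _ _ _ ≫ A.lact e e' d ▷ _ ≫ act (P e') d d' := by
  rw [A.exchange, reassoc_of% swapRight_swapRight]

/-- The weight `e ↦ P e d` on `E`. -/
def BimoduleAction.value (d : D) : Weight V E :=
  Weight.ofAct (fun e => (P e).obj d) (fun e e' => A.lact e e' d) (fun e => A.lact_id e d)
    (fun e e' e'' => A.lact_comp e e' e'' d)

lemma BimoduleAction.act_value (d : D) (e e' : E) : act (A.value d) e e' = A.lact e e' d :=
  Weight.act_ofAct _ _ _ _ _ _

variable [HasLimits V] (W : Weight V D)

/-- The action of `E` on the objects of natural transformations from `W`. -/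
def homAct (e e' : E) : natObj W (P e) ⊗ (EnrichedCategory.Hom e e' : V) ⟶ natObj W (P e') :=
  natObjCurry (fun d => swapRight _ _ _ ≫ natObjEval W (P e) d ▷ _ ≫ A.lact e e' d) (by
    intro d d'
    rw [reassoc_of% swapRight_naturality_right, ← comp_whiskerRight_assoc, natObjEval_act]
    simp only [comp_whiskerRight, Category.assoc]
    rw [A.exchange, reassoc_of% swapRight_naturality_left, reassoc_of% swapRight_tensor_right])

lemma homAct_eval (e e' : E) (d : D) : homAct A W e e' ▷ W.obj d ≫ natObjEval W (P e') d =
    swapRight _ _ _ ≫ natObjEval W (P e) d ▷ _ ≫ A.lact e e' d := natObjCurry_eval _ _ _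

/-- The weight `e ↦ [D, V](W, P e)`. -/
def homWeight : Weight V E :=
  Weight.ofAct (fun e => natObj W (P e)) (homAct A W)
    (fun e => by
      refine natObj_ext fun d => ?_
      rw [comp_whiskerRight, Category.assoc, homAct_eval, reassoc_of% swapRight_naturality_middle,
        whisker_exchange_assoc, A.lact_id, rightUnitor_naturality, reassoc_of% swapRight_unit])
    (fun e e' e'' => by
      refine natObj_ext fun d => ?_
      simp only [comp_whiskerRight, Category.assoc, homAct_eval]
      rw [reassoc_of% swapRight_naturality_middle, whisker_exchange_assoc, A.lact_comp,
        reassoc_of% swapRight_naturality_left, ← comp_whiskerRight_assoc, homAct_eval,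
        associator_inv_naturality_left_assoc, reassoc_of% swapRight_tensor_middle]
      simp only [comp_whiskerRight, Category.assoc])

/-- The evaluation of `e ↦ [D, V](W, P e)`. -/
def homWeightEval (e : E) (d : D) : (homWeight A W).obj e ⊗ W.obj d ⟶ (P e).obj d :=
  natObjEval W (P e) d

lemma homWeightEval_act (e : E) (d d' : D) :
    (homWeight A W).obj e ◁ act W d d' ≫ homWeightEval A W e d' =
      (α_ _ _ _).inv ≫ homWeightEval A W e d ▷ _ ≫ act (P e) d d' := natObjEval_act _ _ _ _

lemma act_homWeight_eval (e e' : E) (d : D) :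
    act (homWeight A W) e e' ▷ W.obj d ≫ homWeightEval A W e' d =
      swapRight _ _ _ ≫ homWeightEval A W e d ▷ _ ≫ A.lact e e' d := by
  rw [show act (homWeight A W) e e' = homAct A W e e' from Weight.act_ofAct _ _ _ _ _ _]
  exact homAct_eval A W e e' d

lemma homWeight_ext {e : E} {T : V} {f g : T ⟶ (homWeight A W).obj e}
    (h : ∀ d, f ▷ W.obj d ≫ homWeightEval A W e d = g ▷ W.obj d ≫ homWeightEval A W e d) :
    f = g := natObj_ext h

lemma exists_homWeight_lift {e : E} {T : V} (ψ : ∀ d, T ⊗ W.obj d ⟶ (P e).obj d)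
    (hψ : ∀ x y, T ◁ act W x y ≫ ψ y = (α_ _ _ _).inv ≫ ψ x ▷ _ ≫ act (P e) x y) :
    ∃ f : T ⟶ (homWeight A W).obj e, ∀ d, f ▷ W.obj d ≫ homWeightEval A W e d = ψ d :=
  ⟨natObjCurry ψ hψ, natObjCurry_eval ψ hψ⟩

lemma evalAt_homWeight_eval {e : E} {x : 𝟙_ V ⟶ (homWeight A W).obj e} {d : D}
    {t : W.obj d ⟶ (P e).obj d} (h : x ▷ W.obj d ≫ homWeightEval A W e d = (λ_ _).hom ≫ t)
    (e' : E) : evalAt (homWeight A W) x e' ▷ W.obj d ≫ homWeightEval A W e' d =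
      (β_ _ _).hom ≫ t ▷ _ ≫ A.lact e e' d := by
  simp only [evalAt, comp_whiskerRight, Category.assoc, act_homWeight_eval]
  rw [reassoc_of% swapRight_naturality_left, ← comp_whiskerRight_assoc, h, comp_whiskerRight,
    Category.assoc, ← swapRight_unit_left]
  simp only [Category.assoc]

section

variable {W : Weight V D} {S : EnrichedFunctor V D E} {L : E}
  {η : VNatTrans W (S.comp V (corep L))} {M : Weight V E}

lemma weightComparison_hom_ext (hη : IsIso (weightComparison M η)) {T : V} {f g : T ⟶ M.obj L}
    (h : ∀ x, f ▷ W.obj x ≫ _ ◁ coneHom η x ≫ act M L (S.obj x) =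
      g ▷ W.obj x ≫ _ ◁ coneHom η x ≫ act M L (S.obj x)) : f = g := by
  refine (cancel_mono (weightComparison M η)).1 (weightEval_ext fun x => ?_)
  rw [comp_whiskerRight, comp_whiskerRight, Category.assoc, Category.assoc,
    weightComparison_eval, h]

lemma exists_weightComparison_lift (hη : IsIso (weightComparison M η)) {T : V}
    (ψ : ∀ x, T ⊗ W.obj x ⟶ M.obj (S.obj x))
    (hψ : ∀ x y, T ◁ act W x y ≫ ψ y =
      (α_ _ _ _).inv ≫ ψ x ▷ _ ≫ _ ◁ S.map x y ≫ act M (S.obj x) (S.obj y)) :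
    ∃ f : T ⟶ M.obj L, ∀ x, f ▷ W.obj x ≫ _ ◁ coneHom η x ≫ act M L (S.obj x) = ψ x := by
  refine ⟨weightCurry ψ hψ ≫ inv (weightComparison M η), fun x => ?_⟩
  rw [← weightComparison_eval, ← comp_whiskerRight_assoc, Category.assoc, IsIso.inv_hom_id,
    Category.comp_id, weightCurry_eval]

lemma isIso_weightComparison_of_lift
    (hom_ext : ∀ {T : V} {f g : T ⟶ M.obj L},
      (∀ x, f ▷ W.obj x ≫ _ ◁ coneHom η x ≫ act M L (S.obj x) =
        g ▷ W.obj x ≫ _ ◁ coneHom η x ≫ act M L (S.obj x)) → f = g)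
    (k : natObj W (S.comp V M) ⟶ M.obj L)
    (hk : ∀ x, k ▷ W.obj x ≫ _ ◁ coneHom η x ≫ act M L (S.obj x) = weightEval W S M x) :
    IsIso (weightComparison M η) := by
  refine ⟨k, hom_ext fun x => ?_, weightEval_ext fun x => ?_⟩
  · rw [comp_whiskerRight, Category.assoc, hk, weightComparison_eval, id_whiskerRight,
      Category.id_comp]
  · rw [comp_whiskerRight, Category.assoc, weightComparison_eval, hk]
    exact ((congrArg (· ≫ weightEval W S M x) (id_whiskerRight _ _)).trans
      (Category.id_comp _)).symm

end

variable {D' : Type v} [EnrichedCategory V D'] {W' : Weight V D'} {S' : EnrichedFunctor V D' E}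
  {L : E} {η : VNatTrans W' (S'.comp V (corep L))}

lemma cone_homWeight_eval (x : D') (d : D) {T : V} (f : T ⟶ (homWeight A W).obj L) :
    (f ▷ W'.obj x ≫ _ ◁ coneHom η x ≫ act (homWeight A W) L (S'.obj x)) ▷ W.obj d ≫
      homWeightEval A W (S'.obj x) d = swapRight _ _ _ ≫
        (f ▷ W.obj d ≫ homWeightEval A W L d) ▷ W'.obj x ≫ _ ◁ coneHom η x ≫
          A.lact L (S'.obj x) d := by
  simp only [comp_whiskerRight, Category.assoc]
  rw [act_homWeight_eval, reassoc_of% swapRight_naturality_middle,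
    reassoc_of% swapRight_naturality_left, whisker_exchange_assoc]

variable (hη : ∀ d, IsIso (weightComparison (A.value d) η))

include hη in
lemma BimoduleAction.hom_ext_of_isIso {T : V} {d : D} {f g : T ⟶ (P L).obj d}
    (h : ∀ x, f ▷ W'.obj x ≫ _ ◁ coneHom η x ≫ A.lact L (S'.obj x) d =
      g ▷ W'.obj x ≫ _ ◁ coneHom η x ≫ A.lact L (S'.obj x) d) : f = g := by
  refine weightComparison_hom_ext (M := A.value d) (hη d) fun x => ?_
  rw [A.act_value]
  exact h x

include hη in
lemma BimoduleAction.exists_lift_of_isIso {T : V} {d : D}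
    (ψ : ∀ x, T ⊗ W'.obj x ⟶ (P (S'.obj x)).obj d)
    (hψ : ∀ x y, T ◁ act W' x y ≫ ψ y =
      (α_ _ _ _).inv ≫ ψ x ▷ _ ≫ _ ◁ S'.map x y ≫ A.lact (S'.obj x) (S'.obj y) d) :
    ∃ f : T ⟶ (P L).obj d, ∀ x,
      f ▷ W'.obj x ≫ _ ◁ coneHom η x ≫ A.lact L (S'.obj x) d = ψ x := by
  simp only [← A.act_value] at hψ ⊢
  exact exists_weightComparison_lift (hη d) ψ hψ

include hη in
lemma cone_homWeight_ext {T : V} {f g : T ⟶ (homWeight A W).obj L}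
    (h : ∀ x, f ▷ W'.obj x ≫ _ ◁ coneHom η x ≫ act (homWeight A W) L (S'.obj x) =
      g ▷ W'.obj x ≫ _ ◁ coneHom η x ≫ act (homWeight A W) L (S'.obj x)) : f = g := by
  refine homWeight_ext A W fun d => A.hom_ext_of_isIso hη fun x => ?_
  have eval_eq := congrArg
    (fun t => swapRight T (W.obj d) (W'.obj x) ≫ t ▷ W.obj d ≫ homWeightEval A W (S'.obj x) d)
    (h x)
  simpa only [cone_homWeight_eval, reassoc_of% swapRight_swapRight] using eval_eq

include hη in
lemma exists_homWeight_value_lift {T : V} {τ : ∀ x, T ⊗ W'.obj x ⟶ (homWeight A W).obj (S'.obj x)}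
    (hτ : ∀ x y, T ◁ act W' x y ≫ τ y = (α_ _ _ _).inv ≫ τ x ▷ _ ≫ _ ◁ S'.map x y ≫
      act (homWeight A W) (S'.obj x) (S'.obj y)) (d : D) :
    ∃ κ : T ⊗ W.obj d ⟶ (P L).obj d, ∀ x,
      κ ▷ W'.obj x ≫ _ ◁ coneHom η x ≫ A.lact L (S'.obj x) d =
        swapRight _ _ _ ≫ τ x ▷ W.obj d ≫ homWeightEval A W (S'.obj x) d := by
  refine A.exists_lift_of_isIso hη
    (fun x => swapRight _ _ _ ≫ τ x ▷ W.obj d ≫ homWeightEval A W (S'.obj x) d) fun x y => ?_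
  rw [reassoc_of% swapRight_naturality_right, ← comp_whiskerRight_assoc, hτ]
  simp only [comp_whiskerRight, Category.assoc]
  rw [act_homWeight_eval, reassoc_of% swapRight_naturality_middle,
    reassoc_of% swapRight_naturality_left, whisker_exchange_assoc,
    reassoc_of% swapRight_tensor_right, reassoc_of% swapRight_swapRight]

include hη in
lemma exists_cone_homWeight_lift {T : V}
    {τ : ∀ x, T ⊗ W'.obj x ⟶ (homWeight A W).obj (S'.obj x)}
    (hτ : ∀ x y, T ◁ act W' x y ≫ τ y = (α_ _ _ _).inv ≫ τ x ▷ _ ≫ _ ◁ S'.map x y ≫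
      act (homWeight A W) (S'.obj x) (S'.obj y)) :
    ∃ k : T ⟶ (homWeight A W).obj L, ∀ x,
      k ▷ W'.obj x ≫ _ ◁ coneHom η x ≫ act (homWeight A W) L (S'.obj x) = τ x := by
  choose κ hκ using exists_homWeight_value_lift A W hη hτ
  obtain ⟨k, hk⟩ := exists_homWeight_lift A W κ fun d d' => by
    refine A.hom_ext_of_isIso hη fun x => ?_
    rw [comp_whiskerRight, Category.assoc, hκ, reassoc_of% swapRight_naturality_middle,
      whisker_exchange_assoc, homWeightEval_act]
    simp only [comp_whiskerRight, Category.assoc]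
    rw [← whisker_exchange_assoc, A.act_lact,
      reassoc_of% swapRight_naturality_right, reassoc_of% swapRight_naturality_left,
      ← comp_whiskerRight_assoc, ← comp_whiskerRight_assoc, Category.assoc, hκ,
      associator_inv_naturality_left_assoc, reassoc_of% swapRight_tensor_middle]
    simp only [comp_whiskerRight, Category.assoc]
  refine ⟨k, fun x => homWeight_ext A W fun d => ?_⟩
  rw [cone_homWeight_eval, hk, hκ, reassoc_of% swapRight_swapRight]

include hη in
lemma isIso_weightComparison_homWeight : IsIso (weightComparison (homWeight A W) η) := by
  obtain ⟨k, hk⟩ := exists_cone_homWeight_lift A W hη (weightEval_act W' S' (homWeight A W))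
  exact isIso_weightComparison_of_lift (cone_homWeight_ext A W hη) k hk

end HomWeight

/-! ### The weight of weighted cocones -/

section CoconeWeight

variable {V : Type u} [Category.{v} V] [MonoidalCategory V] [SymmetricCategory V]
  [MonoidalClosed V] {C : Type u₁} [EnrichedCategory V C] {D : Type v} [EnrichedCategory V D]

omit [MonoidalClosed V] in
lemma eComp_op (x y z : C) : eComp V (op x) (op y) (op z) =
    ((β_ _ _).hom ≫ eComp V z y x :
      (EnrichedCategory.Hom y x : V) ⊗ (EnrichedCategory.Hom z y : V) ⟶ _) :=
  eComp_op_eq V (op z) (op y) (op x)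

omit [MonoidalClosed V] in
lemma precomp_op {x y : C} (u : 𝟙_ V ⟶ (EnrichedCategory.Hom x y : V)) (z : C) :
    precomp (X := op y) (Y := op x) u (op z) = postcomp u z := by
  rw [precomp, eComp_op]
  change _ ≫ _ ≫ (β_ _ _).hom ≫ _ = _
  rw [BraidedCategory.braiding_naturality_left_assoc, leftUnitor_inv_braiding_assoc]
  rfl

lemma act_opFunctor_corep (S : EnrichedFunctor V D C) (a : C) (d d' : Dᵒᵖ) :
    act ((opFunctor S).comp V (corep (op a))) d d' =
      ((EnrichedCategory.Hom (S.obj d.unop) a : V) ◁ S.map d'.unop d.unop ≫ (β_ _ _).hom ≫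
        eComp V (S.obj d'.unop) (S.obj d.unop) a :) := by
  rw [act_functorComp, act_corep]
  exact congrArg (_ ◁ S.map d'.unop d.unop ≫ ·) (eComp_op a _ _)

omit [MonoidalClosed V] in
lemma eComp_exchange (S : EnrichedFunctor V D C) (a a' : C) (d d' : D) :
    eComp V (S.obj d) a a' ▷ _ ≫ (_ ◁ S.map d' d ≫ (β_ _ _).hom ≫
        eComp V (S.obj d') (S.obj d) a') =
      swapRight _ _ _ ≫ (_ ◁ S.map d' d ≫ (β_ _ _).hom ≫
        eComp V (S.obj d') (S.obj d) a) ▷ _ ≫ eComp V (S.obj d') a a' := by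
  rw [← whisker_exchange_assoc, comp_whiskerRight, Category.assoc,
    ← reassoc_of% swapRight_naturality_right]
  congr 1
  rw [BraidedCategory.braiding_naturality_left_assoc, ← e_assoc]
  simp only [swapRight, comp_whiskerRight, Category.assoc, BraidedCategory.braiding_tensor_left_hom,
    Iso.hom_inv_id_assoc]

/-- The bimodule `C(S-, -)`. -/
def coconeAction (S : EnrichedFunctor V D C) :
    BimoduleAction fun a : C => (opFunctor S).comp V (corep (V := V) (op a)) where
  lact a a' d := eComp V (S.obj d.unop) a a'
  lact_id a d := by
    have value_id := act_id (corep (V := V) (S.obj d.unop)) a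
    rwa [act_corep] at value_id
  lact_comp a a' a'' d := by
    have value_comp := act_comp (corep (V := V) (S.obj d.unop)) a a' a''
    rwa [act_corep, act_corep, act_corep] at value_comp
  exchange a a' d d' := by
    rw [act_opFunctor_corep, act_opFunctor_corep]
    exact eComp_exchange S a a' d.unop d'.unop

variable [HasLimits V]

/-- The weight `a ↦ [Dᵒᵖ, V](W, C(S-, a))`. -/
def coconeWeight (W : Weight V Dᵒᵖ) (S : EnrichedFunctor V D C) : Weight V C :=
  homWeight (coconeAction S) W

omit [HasLimits V] in
lemma coconeAction_value (S : EnrichedFunctor V D C) (d : Dᵒᵖ) :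
    (coconeAction S).value d = corep (S.obj d.unop) :=
  Weight.ofAct_eq (F := corep (S.obj d.unop)) _ _ _ fun _ _ => (act_corep _ _ _).symm

lemma preservesWeightedLimits_coconeWeight (W : Weight V Dᵒᵖ) (S : EnrichedFunctor V D C) :
    PreservesWeightedLimits (coconeWeight W S) := fun D' _ W' S' L η hη =>
  isIso_weightComparison_homWeight (coconeAction S) W fun d => by
    rw [coconeAction_value, weightComparison_corep]
    exact hη (S.obj d.unop)

lemma comparison_eq_evalAt_coconeWeight (W : Weight V Dᵒᵖ) (S : EnrichedFunctor V D C) {c : C}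
    (η : VNatTrans W ((opFunctor S).comp V (corep (op c)))) (a : C) :
    comparison η (op a) = evalAt (coconeWeight W S) (x := c) (conePoint η) a := by
  refine coneEval_ext fun d => ?_
  rw [comparison_eval]
  rw [eComp_op]
  refine Eq.trans ?_ (evalAt_homWeight_eval (coconeAction S) W (conePoint_eval η d) a).symm
  exact BraidedCategory.braiding_naturality_right_assoc _ _ _

end CoconeWeight

/-! ### Raising the index of accessibility -/

section RaiseIndex

/-- Every set of cardinality `< μ` has a cofinal family of fewer than `μ` subsets of cardinality
`< κ`. This is one of the forms of the sharply-less relation of Makkai and Paré. -/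
def HasSmallCofinalFamilies (κ μ : Cardinal.{v}) [Fact κ.IsRegular] : Prop :=
  ∀ X : Type v, HasCardinalLT X μ →
    ∃ Y : Set (CardinalDirectedPoset.SetCardinalLT κ X), HasCardinalLT Y μ ∧ IsCofinal Y

lemma mk_setCardinalLT_le {κ ν : Cardinal.{v}} [Fact κ.IsRegular] (hκν : κ ≤ ν) {X : Type v}
    (hX : Cardinal.mk X ≤ 2 ^ ν) :
    Cardinal.mk (CardinalDirectedPoset.SetCardinalLT κ X) ≤ 2 ^ ν := by
  have aleph0_le : Cardinal.aleph0 ≤ κ := (Fact.out : κ.IsRegular).aleph0_le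
  have aleph0_le' : Cardinal.aleph0 ≤ ν := aleph0_le.trans hκν
  calc Cardinal.mk (CardinalDirectedPoset.SetCardinalLT κ X)
      ≤ Cardinal.mk { t : Set X // Cardinal.mk t ≤ κ } :=
        Cardinal.mk_subtype_mono fun t ht => ((hasCardinalLT_iff_cardinal_mk_lt _ _).1 ht).le
    _ ≤ max (Cardinal.mk X) Cardinal.aleph0 ^ κ := Cardinal.mk_bounded_set_le X κ
    _ ≤ (2 ^ ν) ^ κ :=
        Cardinal.power_le_power_right (max_le hX (aleph0_le'.trans (Cardinal.cantor ν).le))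
    _ = 2 ^ ν := by
        rw [← Cardinal.power_mul, Cardinal.mul_eq_left aleph0_le' hκν
          (Cardinal.aleph0_pos.trans_le aleph0_le).ne']

lemma exists_hasSmallCofinalFamilies (κ ν : Cardinal.{v}) [Fact κ.IsRegular] :
    ∃ (μ : Cardinal.{v}) (_ : Fact μ.IsRegular), κ < μ ∧ ν < μ ∧ HasSmallCofinalFamilies κ μ := by
  let l := max κ ν
  have lt_succ (c : Cardinal.{v}) (hc : c ≤ l) : c < Order.succ ((2 : Cardinal.{v}) ^ l) :=
    (hc.trans_lt (Cardinal.cantor l)).trans (Order.lt_succ _)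
  have isRegular : (Order.succ ((2 : Cardinal.{v}) ^ l)).IsRegular :=
    Cardinal.isRegular_succ (((Fact.out : κ.IsRegular).aleph0_le.trans (le_max_left _ _)).trans
      (Cardinal.cantor l).le)
  refine ⟨_, ⟨isRegular⟩, lt_succ _ (le_max_left _ _), lt_succ _ (le_max_right _ _),
    fun X hX => ⟨Set.univ, ?_, fun a => ⟨a, trivial, le_rfl⟩⟩⟩
  rw [hasCardinalLT_iff_cardinal_mk_lt, Order.lt_succ_iff] at hX ⊢
  rw [Cardinal.mk_univ]
  exact mk_setCardinalLT_le (le_max_left _ _) hX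

variable {C : Type u} [Category.{v} C] (κ μ : Cardinal.{v}) [Fact κ.IsRegular] [Fact μ.IsRegular]
  [HasCardinalFilteredColimits C κ] {α : Type v} [PartialOrder α]

variable (α) in
/-- The poset of `κ`-directed subsets of cardinality `< μ`. -/
abbrev SmallDirectedSet : Type v :=
  { B : Set α // IsCardinalFiltered B κ ∧ HasCardinalLT B μ }

variable {κ μ}

/-- The inclusion of a directed subset. -/
abbrev SmallDirectedSet.incl (B : SmallDirectedSet κ μ α) : B.1 ⥤ α :=
  (Subtype.mono_coe (· ∈ B.1)).functor

instance (B : SmallDirectedSet κ μ α) : HasColimitsOfShape B.1 C :=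
  have := B.2.1
  HasCardinalFilteredColimits.hasColimitsOfShape C κ B.1

variable (F : α ⥤ C)

/-- The cocone on the restriction of `F` to a smaller directed subset. -/
abbrev stageCocone {B B' : SmallDirectedSet κ μ α} (h : B ⟶ B') : Cocone (B.incl ⋙ F) :=
  Cocone.mk (colimit (B'.incl ⋙ F))
    { app b := colimit.ι (B'.incl ⋙ F) ⟨b.1, leOfHom h b.2⟩
      naturality b b' g := (colimit.w (B'.incl ⋙ F) (homOfLE (leOfHom g) :
        (⟨b.1, leOfHom h b.2⟩ : B'.1) ⟶ ⟨b'.1, leOfHom h b'.2⟩)).trans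
          (Category.comp_id _).symm }

/-- The diagram of colimits over the small directed subsets. -/
def smallDirectedColimit : SmallDirectedSet κ μ α ⥤ C where
  obj B := colimit (B.incl ⋙ F)
  map h := colimit.desc _ (stageCocone F h)
  map_id B := colimit.hom_ext fun b => (colimit.ι_desc _ _).trans (Category.comp_id _).symm
  map_comp {_ B _} h h' := colimit.hom_ext fun b => by
    rw [colimit.ι_desc, colimit.ι_desc_assoc]
    exact (colimit.ι_desc (stageCocone F h') ⟨b.1, leOfHom h b.2⟩).symm

/-- The inclusion of a stage into the colimit over a small directed subset. -/
def stageι (B : SmallDirectedSet κ μ α) {i : α} (hi : i ∈ B.1) :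
    F.obj i ⟶ (smallDirectedColimit F).obj B := colimit.ι (B.incl ⋙ F) ⟨i, hi⟩

omit [Fact μ.IsRegular] in
lemma stageι_map {B B' : SmallDirectedSet κ μ α} (h : B ⟶ B') {i : α} (hi : i ∈ B.1) :
    stageι F B hi ≫ (smallDirectedColimit F).map h = stageι F B' (leOfHom h hi) :=
  colimit.ι_desc _ _

omit [Fact μ.IsRegular] in
lemma map_stageι (B : SmallDirectedSet κ μ α) {i j : α} (hi : i ∈ B.1) (hj : j ∈ B.1)
    (h : i ⟶ j) : F.map h ≫ stageι F B hj = stageι F B hi :=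
  colimit.w (B.incl ⋙ F) (homOfLE (leOfHom h) : (⟨i, hi⟩ : B.1) ⟶ ⟨j, hj⟩)

omit [Fact μ.IsRegular] in
lemma stage_hom_ext {B : SmallDirectedSet κ μ α} {X : C}
    {f g : (smallDirectedColimit F).obj B ⟶ X}
    (h : ∀ (i : α) (hi : i ∈ B.1), stageι F B hi ≫ f = stageι F B hi ≫ g) : f = g :=
  colimit.hom_ext fun i => h i.1 i.2

variable {F} (c : Cocone F)

/-- The comparison from the colimit over a small directed subset to a cocone. -/
def stageDesc (B : SmallDirectedSet κ μ α) : (smallDirectedColimit F).obj B ⟶ c.pt :=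
  colimit.desc (B.incl ⋙ F) (c.whisker B.incl)

omit [Fact μ.IsRegular] in
lemma stageι_desc (B : SmallDirectedSet κ μ α) {i : α} (hi : i ∈ B.1) :
    stageι F B hi ≫ stageDesc c B = c.ι.app i := colimit.ι_desc _ _

/-- The cocone on the colimits over small directed subsets. -/
def smallDirectedCocone : Cocone (smallDirectedColimit (κ := κ) (μ := μ) F) :=
  Cocone.mk c.pt
    { app := stageDesc c
      naturality B B' h := stage_hom_ext F fun i hi => by
        rw [reassoc_of% stageι_map, stageι_desc]
        exact (((Category.assoc _ _ _).symm.trans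
          (congrArg (· ≫ 𝟙 c.pt) (stageι_desc c B hi))).trans (Category.comp_id _)).symm }

variable [IsCardinalFiltered α κ]

lemma exists_smallDirectedSet (hκμ : κ < μ) (hμ : HasSmallCofinalFamilies κ μ) (A : Set α)
    (hA : HasCardinalLT A μ) : ∃ B : SmallDirectedSet κ μ α, A ⊆ B.1 := by
  obtain ⟨B, subset, isCardinalFiltered, hasCardinalLT⟩ :=
    Cardinal.SharplyLT.exists_isCardinalFiltered_set_of_exists_cofinal hκμ hμ A hA
  exact ⟨⟨B, isCardinalFiltered, hasCardinalLT⟩, subset⟩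

lemma isCardinalFiltered_smallDirectedSet (hκμ : κ < μ) (hμ : HasSmallCofinalFamilies κ μ) :
    IsCardinalFiltered (SmallDirectedSet κ μ α) μ := by
  refine isCardinalFiltered_preorder _ _ fun K s hK => ?_
  obtain ⟨B, hB⟩ := exists_smallDirectedSet hκμ hμ (⋃ k, (s k).1)
    (hasCardinalLT_iUnion _ ((hasCardinalLT_iff_cardinal_mk_lt _ _).2 hK) fun k => (s k).2.2)
  exact ⟨B, fun k => (Set.subset_iUnion (fun k => (s k).1) k).trans hB⟩

omit [IsCardinalFiltered α κ] [Fact μ.IsRegular] in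
lemma stageι_cocone_eq [IsFiltered (SmallDirectedSet κ μ α)]
    (s : Cocone (smallDirectedColimit (κ := κ) (μ := μ) F)) {i : α}
    {B B' : SmallDirectedSet κ μ α} (hi : i ∈ B.1) (hi' : i ∈ B'.1) :
    stageι F B hi ≫ s.ι.app B = stageι F B' hi' ≫ s.ι.app B' := by
  rw [← s.w (IsFiltered.leftToMax B B'), ← s.w (IsFiltered.rightToMax B B'),
    ← Category.assoc, ← Category.assoc, stageι_map, stageι_map]

lemma nonempty_isColimit_smallDirectedCocone (hκμ : κ < μ) (hμ : HasSmallCofinalFamilies κ μ)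
    (hc : IsColimit c) : Nonempty (IsColimit (smallDirectedCocone (κ := κ) (μ := μ) c)) := by
  have := isCardinalFiltered_smallDirectedSet (α := α) hκμ hμ
  have := isFiltered_of_isCardinalFiltered (SmallDirectedSet κ μ α) μ
  have exists_pair (i j : α) : ∃ B : SmallDirectedSet κ μ α, i ∈ B.1 ∧ j ∈ B.1 := by
    obtain ⟨B, hB⟩ := exists_smallDirectedSet hκμ hμ {i, j}
      (hasCardinalLT_of_finite _ _ (Fact.out : μ.IsRegular).aleph0_le)
    exact ⟨B, hB (by simp), hB (by simp)⟩
  choose B left_mem right_mem using exists_pair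
  refine ⟨{
    desc s := hc.desc (Cocone.mk s.pt
      { app i := stageι F (B i i) (left_mem i i) ≫ s.ι.app (B i i)
        naturality i j h := ?_ })
    fac s B' := stage_hom_ext F fun i hi => ?_
    uniq s m hm := hc.hom_ext fun i => ?_ }⟩
  · rw [stageι_cocone_eq s _ (right_mem i j), stageι_cocone_eq s _ (left_mem i j),
      ← Category.assoc, map_stageι]
    exact (Category.comp_id _).symm
  · refine (Category.assoc _ _ _).symm.trans ((congrArg (· ≫ _) (stageι_desc c B' hi)).trans ?_)
    exact (hc.fac _ _).trans (stageι_cocone_eq s _ _)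
  · rw [hc.fac]
    exact (congrArg (· ≫ m) (stageι_desc c (B i i) (left_mem i i))).symm.trans
      ((Category.assoc _ _ _).trans
        (congrArg (stageι F (B i i) (left_mem i i) ≫ ·) (hm (B i i))))

lemma hasCardinalLT_arrow {B : Type v} [PartialOrder B] (hB : HasCardinalLT B μ) :
    HasCardinalLT (Arrow B) μ := by
  refine (hasCardinalLT_prod (Fact.out : μ.IsRegular).aleph0_le hB hB).of_injective
    (fun f => (f.left, f.right)) fun f g h => ?_
  obtain ⟨left_eq, right_eq⟩ := Prod.mk.inj h
  exact Arrow.ext left_eq right_eq (Subsingleton.elim _ _)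

lemma colimitsOfShape_colimitsCardinalClosure {P : ObjectProperty C} (hκμ : κ < μ)
    (hμ : HasSmallCofinalFamilies κ μ) {H : Type v} [SmallCategory H] [IsCardinalFiltered H κ]
    {X : C} (hX : P.colimitsOfShape H X) :
    ∃ (J : Type v) (_ : SmallCategory J) (_ : IsCardinalFiltered J μ),
      (P.colimitsCardinalClosure μ).colimitsOfShape J X := by
  obtain ⟨p⟩ := hX
  obtain ⟨α, _, _, φ, _⟩ := IsCardinalFiltered.exists_cardinal_directed H κ
  let c := (Cocone.mk X p.ι).whisker φ
  obtain ⟨isColimit⟩ := nonempty_isColimit_smallDirectedCocone c hκμ hμ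
    ((Functor.Final.isColimitWhiskerEquiv φ _).symm p.isColimit)
  refine ⟨SmallDirectedSet κ μ α, inferInstance, isCardinalFiltered_smallDirectedSet hκμ hμ,
    ⟨⟨_, (smallDirectedCocone c).ι, isColimit⟩, fun B => ?_⟩⟩
  have := P.isClosedUnderColimitsOfShape_colimitsCardinalClosure μ B.1
    (hasCardinalLT_arrow B.2.2)
  exact ObjectProperty.prop_colimit _ (B.incl ⋙ φ ⋙ p.diag)
    fun b => P.le_colimitsCardinalClosure μ _ (p.prop_diag_obj _)

end RaiseIndex

/-! ### Accessibility of the hom-functors -/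

section Accessibility

lemma exists_forall_isCardinalAccessible {E : Type u₁} [Category.{u₂} E] {E' : Type u₃}
    [Category.{w} E'] {σ : Type v} (Φ : σ → E ⥤ E') [∀ s, Functor.IsAccessible.{v} (Φ s)] :
    ∃ ν : Cardinal.{v}, ∀ (μ : Cardinal.{v}) [Fact μ.IsRegular], ν ≤ μ →
      ∀ s, (Φ s).IsCardinalAccessible μ := by
  choose ν isRegular isCardinalAccessible using fun s =>
    Functor.IsAccessible.exists_cardinal.{v} (F := Φ s)
  refine ⟨iSup ν, fun μ _ hμ s => ?_⟩
  have := isRegular s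
  have := isCardinalAccessible s
  exact Functor.isCardinalAccessible_of_le _ ((le_ciSup Cardinal.bddAbove_of_small s).trans hμ)

variable {V : Type u} [Category.{v} V] [MonoidalCategory V] [MonoidalClosed V]
  {C : Type w} [Category.{v} C] [EnrichedOrdinaryCategory V C] {κ : Cardinal.{v}}
  [Fact κ.IsRegular]

lemma IsEnrichedCardinalAccessible.hasCardinalFilteredColimits
    (hC : IsEnrichedCardinalAccessible V C κ) : HasCardinalFilteredColimits C κ where
  hasColimitsOfShape J _ _ := ⟨fun F => by
    obtain ⟨t, ht⟩ := hC.exists_colimit J F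
    exact ⟨⟨⟨t, ht.isColimit.some⟩⟩⟩⟩

lemma IsEnrichedPresentable.isCardinalAccessible (hC : IsEnrichedCardinalAccessible V C κ)
    {A : C} (hA : IsEnrichedPresentable V κ A) : (eCoyoneda V A).IsCardinalAccessible κ where
  preservesColimitOfShape J _ _ := ⟨fun {F} => by
    obtain ⟨t, ht⟩ := hC.exists_colimit J F
    exact preservesColimit_of_preserves_colimit_cocone ht.isColimit.some
      (hA J F t ht).isColimit.some⟩

lemma isAccessible_points_eCoyoneda (hC : IsEnrichedCardinalAccessible V C κ) (Y : C) (T : V)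
    [IsPresentable.{v} T] : Functor.IsAccessible.{v} (eCoyoneda V Y ⋙ coyoneda.obj (op T)) := by
  obtain ⟨ι, G, presentable, exists_presentation⟩ := hC.exists_generator
  obtain ⟨H, _, _, F, t, mem_range, ht⟩ := exists_presentation Y
  let N : Cᵒᵖ ⥤ C ⥤ Type v := eHomFunctor V C ⋙
    (Functor.whiskeringRight C V (Type v)).obj (coyoneda.obj (op T))
  let s : Cone (F.op ⋙ N) := N.mapCone (Cocone.mk Y t).op
  have isLimit : IsLimit s := evaluationJointlyReflectsLimits _ fun X =>
    isLimitOfPreserves (coyoneda.obj (op T)) (ht.isLimit X).some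
  have (h : Hᵒᵖ) : Functor.IsAccessible.{v} ((F.op ⋙ N).obj h) := by
    obtain ⟨i, hi⟩ := mem_range h.unop
    have := (presentable i).isCardinalAccessible hC
    rw [hi] at this
    have := Functor.isAccessible_of_isCardinalAccessible (eCoyoneda V (F.obj h.unop)) κ
    exact inferInstanceAs (eCoyoneda V (F.obj h.unop) ⋙ coyoneda.obj (op T)).IsAccessible
  obtain ⟨ν, hν⟩ := exists_forall_isCardinalAccessible (F.op ⋙ N).obj
  let μ := Order.succ (max ν (max (Cardinal.mk (Arrow Hᵒᵖ)) Cardinal.aleph0))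
  have : Fact μ.IsRegular :=
    ⟨Cardinal.isRegular_succ ((le_max_right _ _).trans (le_max_right _ _))⟩
  have := hν μ ((le_max_left _ _).trans (Order.le_succ _))
  have := Functor.isCardinalAccessible_of_isLimit s isLimit μ
    ((hasCardinalLT_iff_cardinal_mk_lt _ _).2
      (Order.lt_succ_of_le ((le_max_left _ _).trans (le_max_right _ _))))
  exact Functor.isAccessible_of_isCardinalAccessible s.pt μ

variable {μ : Cardinal.{v}} [Fact μ.IsRegular] {Y : C} {T : V}
  {H : Type v} [SmallCategory H] [IsCardinalFiltered H μ] {F : H ⥤ C} {t : Cocone F}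

omit [MonoidalClosed V] in
lemma exists_stage_factorization
    (hY : (eCoyoneda V Y ⋙ coyoneda.obj (op T)).IsCardinalAccessible μ) (ht : IsColimit t)
    (f : T ⟶ (EnrichedCategory.Hom Y t.pt : V)) :
    ∃ (h : H) (g : T ⟶ (EnrichedCategory.Hom Y (F.obj h) : V)),
      g ≫ eHomWhiskerLeft V Y (t.ι.app h) = f := by
  have := Functor.preservesColimitsOfShape_of_isCardinalAccessible
    (eCoyoneda V Y ⋙ coyoneda.obj (op T)) μ H
  exact Types.jointly_surjective_of_isColimit
    (isColimitOfPreserves (eCoyoneda V Y ⋙ coyoneda.obj (op T)) ht) f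

omit [MonoidalClosed V] in
lemma exists_stage_eq
    (hY : (eCoyoneda V Y ⋙ coyoneda.obj (op T)).IsCardinalAccessible μ) (ht : IsColimit t) {h : H}
    {f g : T ⟶ (EnrichedCategory.Hom Y (F.obj h) : V)}
    (hfg : f ≫ eHomWhiskerLeft V Y (t.ι.app h) = g ≫ eHomWhiskerLeft V Y (t.ι.app h)) :
    ∃ (h' : H) (a : h ⟶ h'), f ≫ eHomWhiskerLeft V Y (F.map a) =
      g ≫ eHomWhiskerLeft V Y (F.map a) := by
  have := Functor.preservesColimitsOfShape_of_isCardinalAccessible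
    (eCoyoneda V Y ⋙ coyoneda.obj (op T)) μ H
  have := isFiltered_of_isCardinalFiltered H μ
  exact (Types.FilteredColimit.isColimit_eq_iff'
    (isColimitOfPreserves (eCoyoneda V Y ⋙ coyoneda.obj (op T)) ht) f g).1 hfg

section Family

variable {σ : Type v} {Y : σ → C} {T : σ → V}

omit [MonoidalClosed V] in
lemma exists_stage_factorization_family (hσ : HasCardinalLT σ μ)
    (hY : ∀ s, (eCoyoneda V (Y s) ⋙ coyoneda.obj (op (T s))).IsCardinalAccessible μ)
    (ht : IsColimit t) (f : ∀ s, T s ⟶ (EnrichedCategory.Hom (Y s) t.pt : V)) :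
    ∃ (h : H) (g : ∀ s, T s ⟶ (EnrichedCategory.Hom (Y s) (F.obj h) : V)),
      ∀ s, g s ≫ eHomWhiskerLeft V (Y s) (t.ι.app h) = f s := by
  choose h g hg using fun s => exists_stage_factorization (hY s) ht (f s)
  refine ⟨IsCardinalFiltered.max h hσ, fun s => g s ≫ eHomWhiskerLeft V (Y s)
    (F.map (IsCardinalFiltered.toMax h hσ s)), fun s => ?_⟩
  rw [Category.assoc, ← eHomWhiskerLeft_comp]
  exact (congrArg (fun k => g s ≫ eHomWhiskerLeft V (Y s) k) (t.w _)).trans (hg s)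

omit [MonoidalClosed V] in
lemma exists_stage_eq_family (hσ : HasCardinalLT σ μ)
    (hY : ∀ s, (eCoyoneda V (Y s) ⋙ coyoneda.obj (op (T s))).IsCardinalAccessible μ)
    (ht : IsColimit t) {h : H} {f g : ∀ s, T s ⟶ (EnrichedCategory.Hom (Y s) (F.obj h) : V)}
    (hfg : ∀ s, f s ≫ eHomWhiskerLeft V (Y s) (t.ι.app h) =
      g s ≫ eHomWhiskerLeft V (Y s) (t.ι.app h)) :
    ∃ (h' : H) (k : h ⟶ h'), ∀ s, f s ≫ eHomWhiskerLeft V (Y s) (F.map k) =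
      g s ≫ eHomWhiskerLeft V (Y s) (F.map k) := by
  choose h' a ha using fun s => exists_stage_eq (hY s) ht (hfg s)
  obtain ⟨m, b, k, hk⟩ := IsCardinalFiltered.wideSpan a hσ
  refine ⟨m, k, fun s => ?_⟩
  rw [← hk s, F.map_comp, eHomWhiskerLeft_comp, reassoc_of% (ha s)]

end Family

end Accessibility

/-! ### The solution set condition -/

section SolutionSet

variable {V : Type u} [Category.{v} V] [MonoidalCategory V] [SymmetricCategory V]
  [MonoidalClosed V] {C : Type w} [Category.{v} C] [EnrichedOrdinaryCategory V C]
  {D : Type v} [EnrichedCategory V D]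

/-- The `V`-natural transformation `C(S-, a) ⟶ C(S-, a')` induced by a morphism `a ⟶ a'`. -/
def coconePostcomp (S : EnrichedFunctor V D C) {a a' : C} (g : a ⟶ a') :
    VNatTrans ((opFunctor S).comp V (corep (op a))) ((opFunctor S).comp V (corep (op a'))) :=
  VNatTrans.ofAct (fun d => eHomWhiskerLeft V (S.obj d.unop) g) fun d d' => by
    rw [act_opFunctor_corep, act_opFunctor_corep]
    have exchange : ((EnrichedCategory.Hom (S.obj d.unop) a : V) ◁ S.map d'.unop d.unop ≫
        (β_ _ _).hom ≫ eComp V _ (S.obj d.unop) a) ≫ eHomWhiskerLeft V (S.obj d'.unop) g =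
        eHomWhiskerLeft V (S.obj d.unop) g ▷ _ ≫ _ ◁ S.map d'.unop d.unop ≫
          (β_ _ _).hom ≫ eComp V _ (S.obj d.unop) a' := by
      simp only [Category.assoc, eComp_eHomWhiskerLeft]
      rw [← BraidedCategory.braiding_naturality_left_assoc, whisker_exchange_assoc]
    exact exchange

section Stage

omit [SymmetricCategory V] [EnrichedOrdinaryCategory V C] in
lemma VNatTrans.comp_natural_iff {W G G' : Weight V D} (p : VNatTrans G G')
    (y : ∀ d, W.obj d ⟶ G.obj d) (d d' : D) :
    (act W d d' ≫ y d') ≫ p.app d' = (y d ▷ _ ≫ act G d d') ≫ p.app d' ↔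
      act W d d' ≫ y d' ≫ p.app d' = (y d ≫ p.app d) ▷ _ ≫ act G' d d' := by
  rw [Category.assoc, Category.assoc, p.act_app, comp_whiskerRight, Category.assoc]

variable {W : Weight V Dᵒᵖ} {S : EnrichedFunctor V D C} {μ : Cardinal.{v}} [Fact μ.IsRegular]
  {H : Type v} [SmallCategory H] [IsCardinalFiltered H μ] {F : H ⥤ C} {t : Cocone F}

lemma exists_stage_cocone (hD : HasCardinalLT Dᵒᵖ μ)
    (hW : ∀ d : Dᵒᵖ, (eCoyoneda V (S.obj d.unop) ⋙
      coyoneda.obj (op (W.obj d))).IsCardinalAccessible μ)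
    (hWD : ∀ p : Dᵒᵖ × Dᵒᵖ, (eCoyoneda V (S.obj p.2.unop) ⋙ coyoneda.obj
      (op (W.obj p.1 ⊗ (EnrichedCategory.Hom p.1 p.2 : V)))).IsCardinalAccessible μ)
    (ht : IsColimit t) (η : VNatTrans W ((opFunctor S).comp V (corep (op t.pt)))) :
    ∃ (m : H) (θ : VNatTrans W ((opFunctor S).comp V (corep (op (F.obj m))))),
      ∀ d, θ.app d ≫ (coconePostcomp S (t.ι.app m)).app d = η.app d := by
  obtain ⟨h, g, hg⟩ := exists_stage_factorization_family hD hW ht η.app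
  obtain ⟨m, k, natural_k⟩ := exists_stage_eq_family
    (hasCardinalLT_prod (Fact.out : μ.IsRegular).aleph0_le hD hD) hWD ht
    fun p => ((coconePostcomp S (t.ι.app h)).comp_natural_iff g p.1 p.2).2
      (((congrArg (act W p.1 p.2 ≫ ·) (hg p.2)).trans (η.act_app _ _)).trans
        (congrArg (· ▷ _ ≫ act ((opFunctor S).comp V (corep (op t.pt))) p.1 p.2) (hg p.1).symm))
  refine ⟨m, VNatTrans.ofAct (fun d => g d ≫ (coconePostcomp S (F.map k)).app d)
    fun d d' => ((coconePostcomp S (F.map k)).comp_natural_iff g d d').1 (natural_k (d, d')),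
    fun d => ?_⟩
  have whisker_k : eHomWhiskerLeft V (S.obj d.unop) (F.map k) ≫
      eHomWhiskerLeft V (S.obj d.unop) (t.ι.app m) =
        eHomWhiskerLeft V (S.obj d.unop) (t.ι.app h) :=
    (eHomWhiskerLeft_comp _ _ _ _).symm.trans (congrArg (eHomWhiskerLeft V _) (t.w k))
  exact (Category.assoc _ _ _).trans ((congrArg (g d ≫ ·) whisker_k).trans (hg d))

end Stage

omit [SymmetricCategory V] [MonoidalClosed V] in
lemma eHomEquiv_comp_eHomWhiskerLeft {X Y Z : C} (f : X ⟶ Y) (g : Y ⟶ Z) :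
    eHomEquiv V f ≫ eHomWhiskerLeft V X g = eHomEquiv V (f ≫ g) := by
  rw [eHomEquiv_comp, eHomWhiskerLeft, rightUnitor_inv_naturality_assoc,
    MonoidalCategory.tensorHom_def, unitors_inv_equal, Category.assoc]

omit [SymmetricCategory V] [MonoidalClosed V] in
lemma eHomEquiv_comp_eHomWhiskerRight {X Y Z : C} (f : X ⟶ Y) (g : Y ⟶ Z) :
    eHomEquiv V g ≫ eHomWhiskerRight V f Z = eHomEquiv V (f ≫ g) := by
  rw [eHomEquiv_comp, eHomWhiskerRight, leftUnitor_inv_naturality_assoc,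
    MonoidalCategory.tensorHom_def', Category.assoc]

lemma eHomEquiv_evalAt_evalAt (M : EnrichedFunctor V C V) {X Y Z : C} (x : 𝟙_ V ⟶ M.obj X)
    (f : X ⟶ Y) (g : Y ⟶ Z) :
    eHomEquiv V g ≫ evalAt M (eHomEquiv V f ≫ evalAt M x Y) Z =
      eHomEquiv V (f ≫ g) ≫ evalAt M x Z := by
  rw [← precomp_evalAt, precomp_eHomEquiv, reassoc_of% eHomEquiv_comp_eHomWhiskerRight]

lemma exists_forall_isCardinalAccessible_points {κ : Cardinal.{v}} [Fact κ.IsRegular]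
    [IsLocallyPresentable.{v} V] (hC : IsEnrichedCardinalAccessible V C κ) (W : Weight V Dᵒᵖ)
    (S : EnrichedFunctor V D C) :
    ∃ ν : Cardinal.{v}, ∀ (μ : Cardinal.{v}) [Fact μ.IsRegular], ν ≤ μ →
      (∀ d : Dᵒᵖ, (eCoyoneda V (S.obj d.unop) ⋙
        coyoneda.obj (op (W.obj d))).IsCardinalAccessible μ) ∧
      ∀ p : Dᵒᵖ × Dᵒᵖ, (eCoyoneda V (S.obj p.2.unop) ⋙ coyoneda.obj
        (op (W.obj p.1 ⊗ (EnrichedCategory.Hom p.1 p.2 : V)))).IsCardinalAccessible μ := by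
  have (d : Dᵒᵖ) := isAccessible_points_eCoyoneda hC (S.obj d.unop) (W.obj d)
  have (p : Dᵒᵖ × Dᵒᵖ) := isAccessible_points_eCoyoneda hC (S.obj p.2.unop)
    (W.obj p.1 ⊗ (EnrichedCategory.Hom p.1 p.2 : V))
  obtain ⟨ν, hν⟩ := exists_forall_isCardinalAccessible fun d : Dᵒᵖ =>
    eCoyoneda V (S.obj d.unop) ⋙ coyoneda.obj (op (W.obj d))
  obtain ⟨ρ, hρ⟩ := exists_forall_isCardinalAccessible fun p : Dᵒᵖ × Dᵒᵖ =>
    eCoyoneda V (S.obj p.2.unop) ⋙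
      coyoneda.obj (op (W.obj p.1 ⊗ (EnrichedCategory.Hom p.1 p.2 : V)))
  exact ⟨max ν ρ, fun μ _ hμ =>
    ⟨hν μ ((le_max_left _ _).trans hμ), hρ μ ((le_max_right _ _).trans hμ)⟩⟩

variable [HasLimits V]

lemma eHomEquiv_evalAt_coconeWeight {W : Weight V Dᵒᵖ} {S : EnrichedFunctor V D C} {a a' : C}
    {g : a ⟶ a'} {θ : VNatTrans W ((opFunctor S).comp V (corep (op a)))}
    {η : VNatTrans W ((opFunctor S).comp V (corep (op a')))}
    (h : ∀ d, θ.app d ≫ (coconePostcomp S g).app d = η.app d) :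
    eHomEquiv V g ≫ evalAt (coconeWeight W S) (x := a) (conePoint θ) a' = conePoint η := by
  rw [← comparison_eq_evalAt_coconeWeight]
  exact (comp_comparison_eq_conePoint_iff (X := op a')).2 fun d =>
    (congrArg (θ.app d ≫ ·) (precomp_op (eHomEquiv V g) (S.obj d.unop))).trans (h d)

lemma exists_evalAt_coconeWeight_eq {W : Weight V Dᵒᵖ} {S : EnrichedFunctor V D C}
    {μ : Cardinal.{v}} [Fact μ.IsRegular] {H : Type v} [SmallCategory H] [IsCardinalFiltered H μ]
    {F : H ⥤ C} {t : Cocone F} (hD : HasCardinalLT Dᵒᵖ μ)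
    (hW : ∀ d : Dᵒᵖ, (eCoyoneda V (S.obj d.unop) ⋙
      coyoneda.obj (op (W.obj d))).IsCardinalAccessible μ)
    (hWD : ∀ p : Dᵒᵖ × Dᵒᵖ, (eCoyoneda V (S.obj p.2.unop) ⋙ coyoneda.obj
      (op (W.obj p.1 ⊗ (EnrichedCategory.Hom p.1 p.2 : V)))).IsCardinalAccessible μ)
    (ht : IsColimit t) (x : 𝟙_ V ⟶ (coconeWeight W S).obj t.pt) :
    ∃ (h : H) (y : 𝟙_ V ⟶ (coconeWeight W S).obj (F.obj h)),
      eHomEquiv V (t.ι.app h) ≫ evalAt (coconeWeight W S) y t.pt = x := by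
  obtain ⟨η, rfl⟩ := conePoint_surjective (W := W) (S := opFunctor S) (X := op t.pt) x
  obtain ⟨h, θ, hθ⟩ := exists_stage_cocone hD hW hWD ht η
  exact ⟨h, conePoint θ, eHomEquiv_evalAt_coconeWeight hθ⟩

lemma exists_isSolutionSet_coconeWeight (hC : IsEnrichedAccessible V C) (W : Weight V Dᵒᵖ)
    (S : EnrichedFunctor V D C) :
    ∃ (ι : Type v) (f : ι → Elements (coconeWeight W S)), IsSolutionSet (coconeWeight W S) f := by
  obtain ⟨κ₀, κ, _, _, hκ₀, -, hC⟩ := hC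
  have := hκ₀.locallyPresentable
  have : IsLocallyPresentable.{v} V := ⟨κ₀, inferInstance, inferInstance⟩
  have := hC.hasCardinalFilteredColimits
  obtain ⟨ν, hν⟩ := exists_forall_isCardinalAccessible_points hC W S
  obtain ⟨μ, _, hκμ, lt_μ, hμ⟩ := exists_hasSmallCofinalFamilies κ (max ν (Cardinal.mk Dᵒᵖ))
  obtain ⟨hW, hWD⟩ := hν μ ((le_max_left _ _).trans lt_μ.le)
  obtain ⟨ι, G, -, exists_presentation⟩ := hC.exists_generator
  obtain ⟨Q, _, -, hQ⟩ := ObjectProperty.EssentiallySmall.exists_small_le.{v}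
    ((ObjectProperty.ofObj G).colimitsCardinalClosure μ)
  let K (s : Shrink.{v} (Subtype Q)) : C := ((equivShrink _).symm s).1
  refine ⟨Σ s, 𝟙_ V ⟶ (coconeWeight W S).obj (K s), fun p => ⟨K p.1, p.2⟩, fun z => ?_⟩
  obtain ⟨H, _, _, F, t, mem_range, ht⟩ := exists_presentation z.base
  obtain ⟨J, _, _, ⟨p⟩⟩ := colimitsOfShape_colimitsCardinalClosure hκμ hμ
    (P := ObjectProperty.ofObj G) (X := z.base) (H := H)
    ⟨⟨F, t, ht.isColimit.some⟩, fun h => by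
      obtain ⟨i, hi⟩ := mem_range h
      exact hi ▸ ObjectProperty.ofObj_apply G i⟩
  obtain ⟨j, y, hy⟩ := exists_evalAt_coconeWeight_eq ((hasCardinalLT_iff_cardinal_mk_lt _ _).2
    ((le_max_right _ _).trans_lt lt_μ)) hW hWD p.isColimit z.pt
  obtain ⟨s, ⟨e⟩⟩ : ∃ s, Nonempty (p.diag.obj j ≅ K s) := by
    obtain ⟨Y, hY, he⟩ := hQ _ (p.prop_diag_obj j)
    exact ⟨equivShrink _ ⟨Y, hY⟩, by simpa only [K, Equiv.symm_apply_apply] using he⟩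
  refine ⟨⟨s, eHomEquiv V e.hom ≫ evalAt (coconeWeight W S) y _⟩,
    eHomEquiv V (e.inv ≫ p.ι.app j), ?_⟩
  refine (eHomEquiv_evalAt_evalAt (coconeWeight W S) y e.hom (e.inv ≫ p.ι.app j)).trans ?_
  rw [e.hom_inv_id_assoc]
  exact hy

variable [ModelCategory V]

theorem hasEWeakColimits_of_hasPowers (hI : IsCofibrant (𝟙_ V)) (hC : IsEnrichedAccessible V C)
    (hP : HasPowers V C) (hL : HasEnoughCofibrantlyWeightedLimits V C) :
    HasEWeakColimits V C := by
  intro D _ W S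
  obtain ⟨ι, f, hf⟩ := exists_isSolutionSet_coconeWeight hC W S
  obtain ⟨c, x, hx⟩ := exists_shrinkable_evalAt hI hP hL
    (preservesWeightedLimits_coconeWeight W S) hf
  obtain ⟨η, rfl⟩ := conePoint_surjective (W := W) (S := opFunctor S) (X := op c) x
  refine ⟨c, η, fun a => ?_⟩
  rw [comparison_eq_evalAt_coconeWeight]
  exact hx a

end SolutionSet

/-! ### Transposition of weighted cones -/

section Transpose

variable {V : Type u} [Category.{v} V] [MonoidalCategory V] [SymmetricCategory V]

lemma braiding_swapRight (X Y Z : V) :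
    (β_ X (Y ⊗ Z)).hom ≫ swapRight Y Z X = (α_ X Y Z).inv ≫ (β_ X Y).hom ▷ Z := by
  simp only [swapRight, BraidedCategory.braiding_tensor_right_hom, Category.assoc,
    Iso.inv_hom_id_assoc]
  rw [← MonoidalCategory.whiskerLeft_comp_assoc, SymmetricCategory.symmetry]
  simp

lemma swapRight_braiding (X Y Z : V) :
    swapRight X Y Z ≫ (β_ X Z).hom ▷ Y = (β_ (X ⊗ Y) Z).hom ≫ (α_ Z X Y).inv := by
  simp only [swapRight, BraidedCategory.braiding_tensor_left_hom, Category.assoc,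
    Iso.hom_inv_id, Category.comp_id]

variable [MonoidalClosed V] {E : Type u₁} [EnrichedCategory V E]

/-- The `V`-natural transformation `E(X, -) ⟶ M` corresponding to a point of `M X` under the Yoneda
lemma. -/
def ofPoint (M : Weight V E) {X : E} (x : 𝟙_ V ⟶ M.obj X) : VNatTrans (corep X) M :=
  VNatTrans.ofAct (evalAt M x) fun Y Z => by
    rw [act_corep]
    exact eComp_evalAt M x Y Z

variable [HasLimits V] {A D : Type v} [EnrichedCategory V A] [EnrichedCategory V D]
  {P : E → Weight V A} (B : BimoduleAction P) {F : Weight V A} {W : Weight V D}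
  {S : EnrichedFunctor V D E}

lemma BimoduleAction.exists_transpose (ev : ∀ i d, F.obj i ⊗ W.obj d ⟶ (P (S.obj d)).obj i)
    (act_ev : ∀ i j d, act F i j ▷ W.obj d ≫ ev j d =
      swapRight _ _ _ ≫ ev i d ▷ _ ≫ act (P (S.obj d)) i j)
    (ev_act : ∀ i d d', F.obj i ◁ act W d d' ≫ ev i d' =
      (α_ _ _ _).inv ≫ ev i d ▷ _ ≫ _ ◁ S.map d d' ≫ B.lact (S.obj d) (S.obj d') i) :
    ∃ τ : VNatTrans W (S.comp V (homWeight B F)), ∀ i d,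
      τ.app d ▷ F.obj i ≫ homWeightEval B F (S.obj d) i = (β_ _ _).hom ≫ ev i d := by
  choose τ hτ using fun d => exists_homWeight_lift B F (fun i => (β_ _ _).hom ≫ ev i d)
    fun i j => by
      rw [BraidedCategory.braiding_naturality_right_assoc, act_ev,
        ← Category.assoc (β_ _ _).hom, braiding_swapRight]
      simp only [comp_whiskerRight, Category.assoc]
  have natural (d d' : D) : act W d d' ≫ τ d' = τ d ▷ _ ≫ _ ◁ S.map d d' ≫
      act (homWeight B F) (S.obj d) (S.obj d') := by
    refine homWeight_ext B F fun i => ?_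
    simp only [comp_whiskerRight, Category.assoc]
    rw [hτ, act_homWeight_eval, reassoc_of% swapRight_naturality_middle,
      reassoc_of% swapRight_naturality_left, whisker_exchange_assoc, ← comp_whiskerRight_assoc, hτ,
      BraidedCategory.braiding_naturality_left_assoc, ev_act, comp_whiskerRight, Category.assoc,
      ← Category.assoc (swapRight _ _ _), swapRight_braiding]
    simp only [Category.assoc]
  refine ⟨VNatTrans.ofAct τ fun d d' => ?_, fun i d => hτ d i⟩
  rw [act_functorComp]
  exact natural d d'

lemma act_functorComp_homWeight_eval (F : Weight V A) (K : EnrichedFunctor V D E) (i j : D)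
    (a : A) :
    act (K.comp V (homWeight B F)) i j ▷ F.obj a ≫ homWeightEval B F (K.obj j) a =
      swapRight _ _ _ ≫ homWeightEval B F (K.obj i) a ▷ _ ≫ _ ◁ K.map i j ≫
        B.lact (K.obj i) (K.obj j) a := by
  have eval_act : (_ ◁ K.map i j ≫ act (homWeight B F) (K.obj i) (K.obj j)) ▷ F.obj a ≫
      homWeightEval B F (K.obj j) a = swapRight _ _ _ ≫ homWeightEval B F (K.obj i) a ▷ _ ≫
        _ ◁ K.map i j ≫ B.lact (K.obj i) (K.obj j) a := by
    rw [comp_whiskerRight, Category.assoc, act_homWeight_eval,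
      reassoc_of% swapRight_naturality_middle, whisker_exchange_assoc]
  rw [act_functorComp]
  exact eval_act

lemma IsEStable.exists_cone_comp_evalAt [ModelCategory V] (hW : IsEStable W) {M : Weight V E}
    {X : E} {x : 𝟙_ V ⟶ M.obj X} (hx : ∀ d, Shrinkable V (evalAt M x (S.obj d)))
    (τ : VNatTrans W (S.comp V M)) :
    ∃ ζ : VNatTrans W (S.comp V (corep X)), ∀ d,
      coneHom ζ d ≫ evalAt M x (S.obj d) = τ.app d := by
  obtain ⟨s, hs, -⟩ := hW.shrinkable_natObjMap ((ofPoint M x).whiskerLeft S) hx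
  obtain ⟨ζ, hζ⟩ := conePoint_surjective (natObjPoint τ ≫ s)
  refine ⟨ζ, fun d => (cancel_epi (λ_ (W.obj d)).hom).1 ?_⟩
  have point_eq : conePoint ζ ≫ natObjMap W ((ofPoint M x).whiskerLeft S) = natObjPoint τ := by
    rw [hζ, Category.assoc, hs, Category.comp_id]
  have eval_eq := congrArg (· ▷ W.obj d ≫ natObjEval W (S.comp V M) d) point_eq
  simp only [natObjPoint_eval, comp_whiskerRight, Category.assoc, natObjMap_eval] at eval_eq
  refine (Category.assoc _ _ _).symm.trans (Eq.trans ?_ eval_eq)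
  exact (congrArg (· ≫ evalAt M x (S.obj d)) (conePoint_eval ζ d).symm).trans (Category.assoc _ _ _)

end Transpose

/-! ### The weight of weighted cones -/

section ConeWeight

variable {V : Type u} [Category.{v} V] [MonoidalCategory V] [SymmetricCategory V]
  {C : Type u₁} [EnrichedCategory V C] {D : Type v} [EnrichedCategory V D]

lemma eComp_braiding_eComp (X' X Y Z : C) :
    ((β_ _ _).hom ≫ eComp V X' X Y) ▷ _ ≫ eComp V X' Y Z =
      swapRight _ _ _ ≫ eComp V X Y Z ▷ _ ≫ (β_ _ _).hom ≫ eComp V X' X Z := by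
  rw [BraidedCategory.braiding_naturality_left_assoc, ← e_assoc,
    ← Category.assoc (β_ _ _).hom (α_ _ _ _).inv, ← swapRight_braiding, Category.assoc,
    reassoc_of% swapRight_swapRight, comp_whiskerRight, Category.assoc]

lemma eComp_braiding_exchange (S : EnrichedFunctor V D C) (X X' : C) (d d' : D) :
    ((β_ _ _).hom ≫ eComp V X' X (S.obj d)) ▷ _ ≫ _ ◁ S.map d d' ≫
        eComp V X' (S.obj d) (S.obj d') =
      swapRight _ _ _ ≫ (_ ◁ S.map d d' ≫ eComp V X (S.obj d) (S.obj d')) ▷ _ ≫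
        (β_ _ _).hom ≫ eComp V X' X (S.obj d') := by
  rw [← whisker_exchange_assoc, eComp_braiding_eComp, reassoc_of% swapRight_naturality_right]
  simp only [comp_whiskerRight, Category.assoc]

variable [MonoidalClosed V]

/-- The bimodule `C(-, S-)`. -/
def coneAction (S : EnrichedFunctor V D C) :
    BimoduleAction fun X : Cᵒᵖ => S.comp V (corep (V := V) X.unop) where
  lact X X' d := eComp V (op (S.obj d)) X X'
  lact_id X d := by
    have value_id := act_id (corep (V := V) (op (S.obj d))) X
    rwa [act_corep] at value_id
  lact_comp X X' X'' d := by
    have value_comp := act_comp (corep (V := V) (op (S.obj d))) X X' X''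
    rwa [act_corep, act_corep, act_corep] at value_comp
  exchange X X' d d' := by
    rw [act_functorComp, act_functorComp, act_corep, act_corep, eComp_op, eComp_op]
    exact eComp_braiding_exchange S X.unop X'.unop d d'

variable [HasLimits V] (W : Weight V D) (S : EnrichedFunctor V D C)

/-- The weight `X ↦ [D, V](W, C(X, S-))`. -/
def coneWeight : Weight V Cᵒᵖ := homWeight (coneAction S) W

variable {W S} in
lemma comparison_eq_evalAt_coneWeight {c : C} (ζ : VNatTrans W (S.comp V (corep c))) (X : C) :
    comparison ζ X = evalAt (coneWeight W S) (x := op c) (conePoint ζ) (op X) := by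
  refine coneEval_ext fun d => ?_
  rw [comparison_eval]
  refine Eq.trans ?_ (evalAt_homWeight_eval (coneAction S) W (x := conePoint ζ) (e := op c)
    (conePoint_eval ζ d) (op X)).symm
  change _ = _ ≫ _ ≫ eComp V (op (S.obj d)) (op c) (op X)
  rw [eComp_op]
  exact (SymmetricCategory.symmetry_assoc _ _ _).symm.trans (congrArg ((β_ _ _).hom ≫ ·)
    (BraidedCategory.braiding_naturality_left_assoc _ _ _).symm)

variable {A : Type v} [EnrichedCategory V A] (K : EnrichedFunctor V A C)

/-- The weight `i ↦ [D, V](W, C(K i, S-))`. -/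
def restrictedConeWeight : Weight V Aᵒᵖ := (opFunctor K).comp V (coneWeight W S)

lemma act_restrictedConeWeight_eval (i j : Aᵒᵖ) (d : D) :
    act (restrictedConeWeight W S K) i j ▷ W.obj d ≫ coneEval W S (K.obj j.unop) d =
      swapRight _ _ _ ≫ coneEval W S (K.obj i.unop) d ▷ _ ≫
        act ((opFunctor K).comp V (corep (op (S.obj d)))) i j := by
  rw [act_functorComp, act_corep]
  exact act_functorComp_homWeight_eval (coneAction S) W (opFunctor K) i j d

lemma exists_coneEval_transpose :
    ∃ τ : VNatTrans W (S.comp V (coconeWeight (restrictedConeWeight W S K) K)), ∀ i d,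
      τ.app d ▷ _ ≫ coneEval (restrictedConeWeight W S K) (opFunctor K) (op (S.obj d)) (op i) =
        (β_ _ _).hom ≫ coneEval W S (K.obj i) d := by
  obtain ⟨τ, hτ⟩ := (coconeAction K).exists_transpose (F := restrictedConeWeight W S K) (W := W)
    (S := S) (fun i d => coneEval W S (K.obj i.unop) d)
    (fun i j d => act_restrictedConeWeight_eval W S K i j d)
    (fun i d d' => coneEval_act W S (K.obj i.unop) d d')
  exact ⟨τ, fun i => hτ (op i)⟩

variable {K} in
/-- The components `F i ⟶ C(K i, c)` of an `F`-weighted cocone under `K`. -/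
def coconeHom {F : Weight V Aᵒᵖ} {c : C} (η : VNatTrans F ((opFunctor K).comp V (corep (op c))))
    (i : A) : F.obj (op i) ⟶ EnrichedCategory.Hom (K.obj i) c := η.app (op i)

variable {K} in
lemma comp_evalAt_coconeWeight_eval {F : Weight V Aᵒᵖ} {c : C}
    (η : VNatTrans F ((opFunctor K).comp V (corep (op c)))) (i : A) (a : C) {T : V}
    (f : T ⟶ EnrichedCategory.Hom c a) :
    (f ≫ evalAt (coconeWeight F K) (conePoint η) a) ▷ _ ≫
        coneEval F (opFunctor K) (op a) (op i) =
      (β_ _ _).hom ≫ coconeHom η i ▷ _ ≫ _ ◁ f ≫ eComp V (K.obj i) c a := by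
  refine (congrArg (· ≫ _) (comp_whiskerRight _ _ _)).trans ((Category.assoc _ _ _).trans ?_)
  refine (congrArg (f ▷ _ ≫ ·)
    (evalAt_homWeight_eval (coconeAction K) F (conePoint_eval η (op i)) a)).trans ?_
  exact (BraidedCategory.braiding_naturality_left_assoc _ _ _).trans
    (congrArg ((β_ _ _).hom ≫ ·) (whisker_exchange_assoc _ _ _))

variable {W S} in
lemma comp_comparison_eq_id {c X : C} {ζ : VNatTrans W (S.comp V (corep c))}
    {σ : natObj W (S.comp V (corep X)) ⟶ EnrichedCategory.Hom X c}
    (hσ : ∀ d, σ ▷ _ ≫ _ ◁ coneHom ζ d ≫ eComp V X c (S.obj d) = coneEval W S X d) :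
    σ ≫ comparison ζ X = 𝟙 _ := by
  refine coneEval_ext fun d => ?_
  rw [comp_whiskerRight, Category.assoc, comparison_eval, id_whiskerRight, Category.id_comp, hσ]

lemma exists_section_comparison [ModelCategory V] (hC : HasEWeakColimits V C) (hW : IsEStable W) :
    ∃ (c : C) (ζ : VNatTrans W (S.comp V (corep c)))
      (σ : VNatTrans (restrictedConeWeight W S K) ((opFunctor K).comp V (corep (op c)))),
      ∀ i, coconeHom σ i ≫ comparison ζ (K.obj i) = 𝟙 _ := by
  obtain ⟨c, η, hη⟩ := hC A (restrictedConeWeight W S K) K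
  obtain ⟨τ, hτ⟩ := exists_coneEval_transpose W S K
  obtain ⟨ζ, hζ⟩ := hW.exists_cone_comp_evalAt
    (M := coconeWeight (restrictedConeWeight W S K) K) (x := conePoint η) (fun d => by
      rw [← comparison_eq_evalAt_coconeWeight]
      exact hη (S.obj d)) τ
  refine ⟨c, ζ, η, fun i => comp_comparison_eq_id fun d => (cancel_epi (β_ _ _).hom).1 ?_⟩
  exact (comp_evalAt_coconeWeight_eval η i (S.obj d) (coneHom ζ d)).symm.trans
    ((congrArg (· ▷ _ ≫ _) (hζ d)).trans (hτ i d))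

end ConeWeight

/-! ### Splitting of idempotents -/

section Idempotent

/-- The shape of the diagram given by an idempotent: the monoid `Bool` under conjunction, regarded
as a category with one object. Its colimit splits the idempotent, and it is `κ`-filtered for every
`κ`. -/
inductive IdempotentShape : Type v
  | star : IdempotentShape

instance : SmallCategory IdempotentShape.{v} where
  Hom _ _ := ULift Bool
  id _ := ⟨true⟩
  comp f g := ⟨f.down && g.down⟩
  id_comp _ := rfl
  comp_id f := by simp only [Bool.and_true]
  assoc f g h := by simp only [Bool.and_assoc]

namespace IdempotentShape

/-- The nontrivial endomorphism. -/
def e : star.{v} ⟶ star := ULift.up false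

lemma comp_e (f : star.{v} ⟶ star) : f ≫ e = e := ULift.ext _ _ (Bool.and_false _)

instance isCardinalFiltered (κ : Cardinal.{v}) [Fact κ.IsRegular] :
    IsCardinalFiltered IdempotentShape.{v} κ where
  nonempty_cocone F _ := ⟨Cocone.mk star
    { app _ := e
      naturality _ _ f := (comp_e (F.map f)).trans (Category.comp_id _).symm }⟩

variable {C : Type w} [Category.{u} C] {c : C} (p : c ⟶ c) (hp : p ≫ p = p)

/-- The diagram given by an idempotent. -/
def diagram : IdempotentShape.{v} ⥤ C where
  obj _ := c
  map f := if f.down then 𝟙 c else p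
  map_id _ := rfl
  map_comp := by
    rintro _ _ _ ⟨_ | _⟩ ⟨_ | _⟩
    · exact hp.symm
    · exact (Category.comp_id _).symm
    · exact (Category.id_comp _).symm
    · exact (Category.id_comp _).symm

/-- The cocone under the diagram of an idempotent given by the idempotent itself. -/
def cocone : Cocone (diagram.{v} p hp) where
  pt := c
  ι :=
    { app _ := p
      naturality := by
        rintro _ _ ⟨_ | _⟩
        · exact hp.trans (Category.comp_id _).symm
        · exact (Category.id_comp _).trans (Category.comp_id _).symm }

end IdempotentShape

lemma isIdempotentComplete_of_hasCardinalFilteredColimits {C : Type w} [Category.{u} C]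
    (κ : Cardinal.{v}) [Fact κ.IsRegular] [HasCardinalFilteredColimits C κ] :
    IsIdempotentComplete C where
  idempotents_split c p hp := by
    have := HasCardinalFilteredColimits.hasColimitsOfShape C κ IdempotentShape.{v}
    let r : c ⟶ colimit (IdempotentShape.diagram.{v} p hp) :=
      colimit.ι (IdempotentShape.diagram.{v} p hp) IdempotentShape.star
    let m : colimit (IdempotentShape.diagram.{v} p hp) ⟶ c :=
      colimit.desc _ (IdempotentShape.cocone.{v} p hp)
    have r_m : r ≫ m = p := colimit.ι_desc _ _
    have p_r : p ≫ r = r := colimit.w (IdempotentShape.diagram.{v} p hp) IdempotentShape.e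
    refine ⟨_, m, r, colimit.hom_ext fun _ => ?_, r_m⟩
    change r ≫ m ≫ r = r ≫ 𝟙 _
    rw [reassoc_of% r_m, p_r, Category.comp_id]

end Idempotent

/-! ### Determination by presentable generators -/

section Generators

lemma exists_comp_inducedFunctor_eq {C : Type w} [Category.{v} C] {ι : Type u₁} {G : ι → C}
    {H : Type u₂} [Category.{u} H] {F : H ⥤ C} (hF : ∀ h, F.obj h ∈ Set.range G) :
    ∃ F' : H ⥤ InducedCategory C G, F' ⋙ inducedFunctor G = F := by
  choose i hi using hF
  obtain ⟨obj, map, map_id, map_comp⟩ := F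
  obtain rfl : (fun h => G (i h)) = obj := funext hi
  exact ⟨{  obj := i
            map f := InducedCategory.homMk (map f)
            map_id h := InducedCategory.hom_ext (map_id h)
            map_comp f g := InducedCategory.hom_ext (map_comp f g) }, rfl⟩

variable {V : Type u} [Category.{v} V] [MonoidalCategory V]
  {C : Type w} [Category.{v} C] [EnrichedOrdinaryCategory V C]
  {ι : Type u₁} {G : ι → C} {H : Type u₂} [Category.{u₃} H] {F : H ⥤ C} {t : Cocone F}

lemma hom_eq_of_eHomWhiskerLeft_eq (hF : ∀ h, F.obj h ∈ Set.range G) (ht : IsColimit t) {X : C}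
    {f g : t.pt ⟶ X} (hfg : ∀ i, eHomWhiskerLeft V (G i) f = eHomWhiskerLeft V (G i) g) :
    f = g := by
  have whisker_eq (Y : C) (hY : Y ∈ Set.range G) :
      eHomWhiskerLeft V Y f = eHomWhiskerLeft V Y g := by
    obtain ⟨i, rfl⟩ := hY
    exact hfg i
  refine ht.hom_ext fun h => (eHomEquiv V).injective ?_
  rw [← eHomEquiv_comp_eHomWhiskerLeft, ← eHomEquiv_comp_eHomWhiskerLeft, whisker_eq _ (hF h)]

variable [MonoidalClosed V] {κ : Cardinal.{v}} [Fact κ.IsRegular]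
  {H : Type v} [SmallCategory H] [IsCardinalFiltered H κ] {F : H ⥤ C} {t : Cocone F}

lemma exists_eHomWhiskerLeft_eq (hG : ∀ i, IsEnrichedPresentable V κ (G i))
    (hF : ∀ h, F.obj h ∈ Set.range G) (ht : IsConicalColimit V t) {X : C}
    (E : ∀ i, (EnrichedCategory.Hom (G i) t.pt : V) ⟶ EnrichedCategory.Hom (G i) X)
    (eComp_E : ∀ i j, eComp V (G i) (G j) t.pt ≫ E i = _ ◁ E j ≫ eComp V (G i) (G j) X) :
    ∃ e : t.pt ⟶ X, ∀ i, eHomWhiskerLeft V (G i) e = E i := by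
  obtain ⟨F, rfl⟩ := exists_comp_inducedFunctor_eq hF
  let τ (h : H) : G (F.obj h) ⟶ t.pt := t.ι.app h
  have τ_natural {h h' : H} (f : h ⟶ h') : (F.map f).hom ≫ τ h' = τ h := t.w f
  let a (h : H) : G (F.obj h) ⟶ X := (eHomEquiv V).symm (eHomEquiv V (τ h) ≫ E (F.obj h))
  have eHomEquiv_a (h : H) : eHomEquiv V (a h) = eHomEquiv V (τ h) ≫ E (F.obj h) :=
    (eHomEquiv V).apply_symm_apply _
  have natural {h h' : H} (f : h ⟶ h') : (F.map f).hom ≫ a h' = a h := by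
    have E_natural : eHomWhiskerRight V (F.map f).hom t.pt ≫ E (F.obj h) =
        E (F.obj h') ≫ eHomWhiskerRight V (F.map f).hom X := by
      rw [eHomWhiskerRight, eHomWhiskerRight, Category.assoc, Category.assoc, eComp_E,
        leftUnitor_inv_naturality_assoc, whisker_exchange_assoc]
    apply (eHomEquiv V).injective
    rw [← eHomEquiv_comp_eHomWhiskerRight, eHomEquiv_a, eHomEquiv_a, Category.assoc, ← E_natural,
      ← Category.assoc, eHomEquiv_comp_eHomWhiskerRight, τ_natural]
  obtain ⟨e, he⟩ : ∃ e : t.pt ⟶ X, ∀ h, τ h ≫ e = a h :=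
    ⟨ht.isColimit.some.desc (Cocone.mk X
      { app := a
        naturality _ _ f := (natural f).trans (Category.comp_id _).symm }),
      ht.isColimit.some.fac _⟩
  refine ⟨e, fun i => (hG i H _ t ht).isColimit.some.hom_ext fun h => ?_⟩
  change eHomWhiskerLeft V (G i) (τ h) ≫ eHomWhiskerLeft V (G i) e =
    eHomWhiskerLeft V (G i) (τ h) ≫ E i
  rw [← eHomWhiskerLeft_comp, he, eHomWhiskerLeft, eHomEquiv_a, eHomWhiskerLeft,
    MonoidalCategory.whiskerLeft_comp, Category.assoc, Category.assoc, Category.assoc, eComp_E]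

end Generators

/-! ### Weighted limits from weak colimits -/

section Comparison

variable {V : Type u} [Category.{v} V] [MonoidalCategory V] [SymmetricCategory V]
  [MonoidalClosed V] {C : Type u₁} [EnrichedCategory V C]

/-- The `V`-natural transformation `C(Y, -) ⟶ C(X, -)` given by precomposition. -/
def corepMap {X Y : C} (u : 𝟙_ V ⟶ EnrichedCategory.Hom X Y) :
    VNatTrans (corep Y) (corep (V := V) X) :=
  VNatTrans.ofAct (precomp u) fun Z T => by
    rw [act_corep, act_corep]
    exact eComp_precomp u Z T

variable [HasLimits V] {D : Type v} [EnrichedCategory V D]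
  (W : Weight V D) (S : EnrichedFunctor V D C)

/-- The map `[D, V](W, C(Y, S-)) ⟶ [D, V](W, C(X, S-))` given by precomposition. -/
def conePrecomp {X Y : C} (u : 𝟙_ V ⟶ EnrichedCategory.Hom X Y) :
    natObj W (S.comp V (corep Y)) ⟶ natObj W (S.comp V (corep X)) :=
  natObjMap W ((corepMap u).whiskerLeft S)

lemma conePrecomp_eval {X Y : C} (u : 𝟙_ V ⟶ EnrichedCategory.Hom X Y) (d : D) :
    conePrecomp W S u ▷ W.obj d ≫ coneEval W S X d = coneEval W S Y d ≫ precomp u (S.obj d) :=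
  natObjMap_whiskerLeft_eval W S (corepMap u) d

lemma conePrecomp_conePrecomp {X Y Z : C} (u : 𝟙_ V ⟶ EnrichedCategory.Hom X Y)
    (t : 𝟙_ V ⟶ EnrichedCategory.Hom Y Z) :
    conePrecomp W S t ≫ conePrecomp W S u = conePrecomp W S (t ≫ precomp u Z) := by
  refine coneEval_ext fun d => ?_
  rw [comp_whiskerRight, Category.assoc, conePrecomp_eval, conePrecomp_eval, ← precomp_precomp,
    ← Category.assoc, conePrecomp_eval, Category.assoc]

variable {W S}

lemma comparison_conePrecomp {L : C} (ζ : VNatTrans W (S.comp V (corep L))) {X Y : C}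
    (u : 𝟙_ V ⟶ EnrichedCategory.Hom X Y) :
    comparison ζ Y ≫ conePrecomp W S u = precomp u L ≫ comparison ζ X := by
  refine coneEval_ext fun d => ?_
  rw [comp_whiskerRight, comp_whiskerRight, Category.assoc, Category.assoc, conePrecomp_eval,
    comparison_eval, ← Category.assoc, comparison_eval, Category.assoc, eComp_precomp,
    whisker_exchange_assoc]

end Comparison

section ConicalColimit

variable {V : Type u} [Category.{v} V] [MonoidalCategory V] [SymmetricCategory V]
  [MonoidalClosed V] [HasLimits V] {C : Type w} [Category.{v} C] [EnrichedOrdinaryCategory V C]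
  {D : Type v} [EnrichedCategory V D] {W : Weight V D} {S : EnrichedFunctor V D C}
  {H : Type v} [SmallCategory H] {F : H ⥤ C} {t : Cocone F}

omit [SymmetricCategory V] [MonoidalClosed V] [HasLimits V] in
lemma IsConicalColimit.hom_ext (ht : IsConicalColimit V t) (Y : C) {T : V}
    {f g : T ⟶ EnrichedCategory.Hom t.pt Y}
    (hfg : ∀ h, f ≫ precomp (eHomEquiv V (t.ι.app h)) Y = g ≫ precomp (eHomEquiv V (t.ι.app h)) Y) :
    f = g :=
  (ht.isLimit Y).some.hom_ext fun h => hfg h.unop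

lemma isIso_comparison_of_isConicalColimit {L : C} (ζ : VNatTrans W (S.comp V (corep L)))
    (ht : IsConicalColimit V t) (hF : ∀ h, IsIso (comparison ζ (F.obj h))) :
    IsIso (comparison ζ t.pt) := by
  let u (h : H) : 𝟙_ V ⟶ EnrichedCategory.Hom (F.obj h) t.pt := eHomEquiv V (t.ι.app h)
  let q (h : H) : natObj W (S.comp V (corep t.pt)) ⟶ EnrichedCategory.Hom (F.obj h) L :=
    conePrecomp W S (u h) ≫ inv (comparison ζ (F.obj h))
  have natural {h h' : H} (f : h ⟶ h') : q h = q h' ≫ eHomWhiskerRight V (F.map f) L := by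
    have u_eq : u h = u h' ≫ precomp (eHomEquiv V (F.map f)) t.pt := by
      rw [precomp_eHomEquiv, eHomEquiv_comp_eHomWhiskerRight, t.w]
    dsimp only [q]
    rw [IsIso.comp_inv_eq, Category.assoc, Category.assoc, ← precomp_eHomEquiv,
      ← comparison_conePrecomp, IsIso.inv_hom_id_assoc, conePrecomp_conePrecomp, ← u_eq]
  obtain ⟨k, hk⟩ : ∃ k : natObj W (S.comp V (corep t.pt)) ⟶ EnrichedCategory.Hom t.pt L,
      ∀ h, k ≫ precomp (u h) L = q h :=
    ⟨(ht.isLimit L).some.lift (Cone.mk _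
      { app h := q h.unop
        naturality _ _ f := (Category.id_comp _).trans (natural f.unop) }),
      fun h => (ht.isLimit L).some.fac _ (op h)⟩
  refine ⟨k, ht.hom_ext L fun h => ?_, coneEval_ext fun d => ht.hom_ext (S.obj d) fun h => ?_⟩
  · rw [Category.assoc, hk, reassoc_of% comparison_conePrecomp ζ (u h), IsIso.hom_inv_id,
      Category.comp_id, Category.id_comp]
  · rw [Category.assoc, Category.assoc, ← conePrecomp_eval, ← comp_whiskerRight_assoc,
      ← comp_whiskerRight_assoc, Category.assoc, comparison_conePrecomp, reassoc_of% hk,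
      Category.assoc, IsIso.inv_hom_id, Category.id_comp, Category.comp_id]

end ConicalColimit

section FullSubcategory

variable {V : Type u} [Category.{v} V] [MonoidalCategory V] [SymmetricCategory V]
  [MonoidalClosed V] {C : Type w} [EnrichedCategory V C]

/-- The vertical composite of two `V`-natural transformations between weights. -/
def VNatTrans.comp {D : Type u₁} [EnrichedCategory V D] {F G H : Weight V D} (p : VNatTrans F G)
    (q : VNatTrans G H) : VNatTrans F H :=
  VNatTrans.ofAct (fun d => p.app d ≫ q.app d) fun d d' => by
    rw [← Category.assoc, p.act_app, Category.assoc, q.act_app, comp_whiskerRight, Category.assoc]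

variable {A : Type v} {G : A → C}

lemma eComp_coconeHom_fullOnInclusion {c c' : C}
    (E : VNatTrans ((opFunctor (fullOnInclusion G)).comp V (corep (op c)))
      ((opFunctor (fullOnInclusion G)).comp V (corep (op c')))) (i j : FullOn G) :
    eComp V (G i) (G j) c ≫ (coconeHom E i :) =
      (EnrichedCategory.Hom (G i) (G j) : V) ◁ (coconeHom E j :) ≫ eComp V (G i) (G j) c' := by
  have act_eq (a : C) : act ((opFunctor (fullOnInclusion G)).comp V (corep (op a))) (op j) (op i) =
      (β_ (EnrichedCategory.Hom (G j) a) (EnrichedCategory.Hom (G i) (G j) : V)).hom ≫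
        eComp V (G i) (G j) a :=
    (act_opFunctor_corep (fullOnInclusion G) a (op j) (op i)).trans
      ((congrArg (· ≫ _) (MonoidalCategory.whiskerLeft_id _ _)).trans (Category.id_comp _))
  have natural := E.act_app (op j) (op i)
  rw [act_eq, act_eq] at natural
  refine (cancel_epi (β_ _ _).hom).1 ((Category.assoc _ _ _).symm.trans (natural.trans ?_))
  exact BraidedCategory.braiding_naturality_left_assoc _ _ _

variable [HasLimits V] {D : Type v} [EnrichedCategory V D] {W : Weight V D}
  {S : EnrichedFunctor V D C}

lemma exists_section_comparison_family [ModelCategory V] (G : A → C) (hC : HasEWeakColimits V C)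
    (hW : IsEStable W) (S : EnrichedFunctor V D C) :
    ∃ (c : C) (ζ : VNatTrans W (S.comp V (corep c)))
      (s : ∀ i, natObj W (S.comp V (corep (G i))) ⟶ EnrichedCategory.Hom (G i) c),
      (∀ i, s i ≫ comparison ζ (G i) = 𝟙 _) ∧
      ∀ i j, eComp V (G i) (G j) c ≫ comparison ζ (G i) ≫ s i =
        _ ◁ (comparison ζ (G j) ≫ s j) ≫ eComp V (G i) (G j) c := by
  obtain ⟨c, ζ, σ, hσ⟩ := exists_section_comparison W S (fullOnInclusion G) hC hW
  refine ⟨c, ζ, fun i => coconeHom σ i, hσ, fun i j => ?_⟩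
  rw [comparison_eq_evalAt_coneWeight, comparison_eq_evalAt_coneWeight]
  exact eComp_coconeHom_fullOnInclusion
    (((ofPoint (coneWeight W S) (conePoint ζ)).whiskerLeft (opFunctor (fullOnInclusion G))).comp σ)
    i j

end FullSubcategory

section StableLimits

variable {V : Type u} [Category.{v} V] [MonoidalCategory V] [SymmetricCategory V]
  [MonoidalClosed V] [HasLimits V] {C : Type w} [Category.{v} C] [EnrichedOrdinaryCategory V C]
  {D : Type v} [EnrichedCategory V D] {W : Weight V D} {S : EnrichedFunctor V D C}

lemma exists_comparison_eq_eHomWhiskerLeft_comp {L c : C} (ζ : VNatTrans W (S.comp V (corep c)))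
    (m : L ⟶ c) : ∃ ζ' : VNatTrans W (S.comp V (corep L)), ∀ X,
      comparison ζ' X = eHomWhiskerLeft V X m ≫ comparison ζ X := by
  obtain ⟨ζ', hζ'⟩ := conePoint_surjective (eHomEquiv V m ≫ comparison ζ L)
  have coneHom_precomp := comp_comparison_eq_conePoint_iff.1 hζ'.symm
  refine ⟨ζ', fun X => coneEval_ext fun d => ?_⟩
  rw [comparison_eval, ← coneHom_precomp d, comp_whiskerRight, Category.assoc, comparison_eval,
    precomp_eHomEquiv, MonoidalCategory.whiskerLeft_comp, Category.assoc, ← eHomWhiskerLeft_eComp,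
    whisker_exchange_assoc]

lemma exists_isIso_comparison_of_section [IsIdempotentComplete C] {c : C}
    (ζ : VNatTrans W (S.comp V (corep c))) {A : Type u₁} {G : A → C}
    {s : ∀ i, natObj W (S.comp V (corep (G i))) ⟶ EnrichedCategory.Hom (G i) c}
    (s_comparison : ∀ i, s i ≫ comparison ζ (G i) = 𝟙 _) {e : c ⟶ c} (idem : e ≫ e = e)
    (whisker_e : ∀ i, eHomWhiskerLeft V (G i) e = comparison ζ (G i) ≫ s i) :
    ∃ (L : C) (ζ' : VNatTrans W (S.comp V (corep L))), ∀ i, IsIso (comparison ζ' (G i)) := by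
  obtain ⟨L, m, r, m_r, r_m⟩ := IsIdempotentComplete.idempotents_split c e idem
  obtain ⟨ζ', hζ'⟩ := exists_comparison_eq_eHomWhiskerLeft_comp ζ m
  have m_e : m ≫ e = m := by rw [← r_m, reassoc_of% m_r]
  refine ⟨L, ζ', fun i => ⟨s i ≫ eHomWhiskerLeft V (G i) r, ?_, ?_⟩⟩
  · rw [hζ', Category.assoc, ← reassoc_of% whisker_e, ← eHomWhiskerLeft_comp,
      ← eHomWhiskerLeft_comp, reassoc_of% m_e, m_r, eHomWhiskerLeft_id]
  · rw [hζ', Category.assoc, ← eHomWhiskerLeft_comp_assoc, r_m, whisker_e, Category.assoc,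
      s_comparison, Category.comp_id, s_comparison]

theorem hasEStableLimits_of_hasEWeakColimits [ModelCategory V] (hC : IsEnrichedAccessible V C)
    (weakColimits : HasEWeakColimits V C) : HasEStableLimits V C := by
  intro D _ W hW S
  obtain ⟨-, κ, -, _, -, -, hC⟩ := hC
  have := hC.hasCardinalFilteredColimits
  have := isIdempotentComplete_of_hasCardinalFilteredColimits (C := C) κ
  obtain ⟨A, G, hG, exists_presentation⟩ := hC.exists_generator
  obtain ⟨c, ζ, s, s_comparison, eComp_s⟩ :=
    exists_section_comparison_family G weakColimits hW S
  obtain ⟨_, _, _, F, t, hF, ht⟩ := exists_presentation c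
  obtain ⟨e, he⟩ := exists_eHomWhiskerLeft_eq hG hF ht
    (fun i => comparison ζ (G i) ≫ s i) eComp_s
  have idem : e ≫ e = e := hom_eq_of_eHomWhiskerLeft_eq (V := V) hF ht.isColimit.some fun i => by
    rw [eHomWhiskerLeft_comp, he, Category.assoc, reassoc_of% s_comparison i]
  obtain ⟨L, ζ', hζ'⟩ := exists_isIso_comparison_of_section ζ s_comparison idem he
  refine ⟨L, ζ', fun X => ?_⟩
  obtain ⟨_, _, _, F, t, hF, ht⟩ := exists_presentation X
  have isIso_comparison_obj (h) : IsIso (comparison ζ' (F.obj h)) := by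
    obtain ⟨i, hi⟩ := hF h
    exact hi ▸ hζ' i
  exact isIso_comparison_of_isConicalColimit (t := Cocone.mk X t) ζ' ht isIso_comparison_obj

end StableLimits

end HEnriched

end

theorem mainTheorem4_general
    (V : Type u) [Category.{v} V] [MonoidalCategory V] [SymmetricCategory V] [MonoidalClosed V]
    [HasLimits V] [ModelCategory V] (hI : IsCofibrant (𝟙_ V))
    (hE : EnoughCofibrantlyWeightedLimitsEStable V)
    (C : Type w) [Category.{v} C] [EnrichedOrdinaryCategory V C]
    (hC : IsEnrichedAccessible V C) :
    List.TFAE [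
      HasEStableLimits V C,
      HasPowers V C ∧ HasEnoughCofibrantlyWeightedLimits V C,
      HasEWeakColimits V C] := by
  tfae_have 1 → 2 := fun limits => ⟨hasPowers_of_hasEStableLimits limits, fun D _ P => by
    obtain ⟨Q, hQ, hQ_stable⟩ := hE D P
    exact ⟨Q, hQ, limits D Q hQ_stable⟩⟩
  tfae_have 2 → 3 := fun ⟨powers, limits⟩ => hasEWeakColimits_of_hasPowers hI hC powers limits
  tfae_have 3 → 1 := hasEStableLimits_of_hasEWeakColimits hC
  tfae_finish

theorem mainTheorem4
    (V : Type u) [Category.{v} V] [MonoidalCategory V] [SymmetricCategory V] [MonoidalClosed V]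
    [HasLimits V] [HasColimits V] [IsLocallyPresentable.{v} V]
    [ModelCategory V] [PushoutProductAxiom V] (hI : IsCofibrant (𝟙_ V))
    (hE : EnoughCofibrantlyWeightedLimitsEStable V)
    (C : Type w) [Category.{v} C] [EnrichedOrdinaryCategory V C]
    (hC : IsEnrichedAccessible V C) :
    List.TFAE [
      HasEStableLimits V C,
      HasPowers V C ∧ HasEnoughCofibrantlyWeightedLimits V C,
      HasEWeakColimits V C] :=
  mainTheorem4_general V hI hE C hC
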